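/- **Setting.** An $n$-valent plabic graph $\Gamma$ is a finite graph embedded in a rectangle, with $n$ univalent vertices on each of the two vertical sides and all other vertices in the interior of the rectangle and coloured black or white. Its faces, indexed by a set $I$, are the connected components of its complement in the rectangle. The dual quiver $\mathcal Q$ has vertex set $I$; every edge $e$ of $\Gamma$ that joins two internal vertices of different colours (respectively, an internal vertex and a boundary vertex) gives an arrow (respectively, a half-arrow) of $\mathcal Q$ crossing $e$ with the white end of $e$, if any, on its left and the black end, if any, on its right. Let $q_{ij}=\#\{i\to j\}-\#\{j\to i\}$, half-arrows counted as $\tfrac12$. The face weight space is $\mathcal F(\Gamma)=\{(y_i)\in(\mathbb C^*)^I:\prod_i y_i=1\}$, with the log-canonical Poisson bracket $\{y_i,y_j\}'=q_{ij}y_iy_j$. A square move at a square face (four trivalent vertices of alternating colours) of weight $y_0$ reverses the colours of its four vertices, replaces $y_0$ by $y_0^{-1}$, and multiplies the weights of the adjacent faces by $1+y_0$ for every arrow to the square and by $(1+y_0^{-1})^{-1}$ for every arrow from the square. The midline is the horizontal line through the centre of the rectangle. $\Gamma$ is move-symmetric if performing square moves at all square faces with two opposite vertices on the midline and then reflecting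 in the midline gives $\Gamma$ with opposite colours. The same operation on weights is a birational involution $\sigma$ of $\mathcal F(\Gamma)$, whose fixed point set, in the domain where $\sigma$ is regular, is the space $\mathcal F^{ms}(\Gamma)$ of move-symmetric weightings. The induced bracket on $\mathcal F^{ms}(\Gamma)$ is the Poisson bracket of regular functions such that $\{f|_{\mathcal F^{ms}(\Gamma)},g|_{\mathcal F^{ms}(\Gamma)}\}=\{f,g\}'|_{\mathcal F^{ms}(\Gamma)}$ for all $\sigma$-invariant regular functions $f,g$. For a face $i$ let $i'$ be its mirror image in the midline. Let $I_0$ be the set of faces whose interior meets the midline and $I_+$ the set of faces above the midline. **Proposition.** Let $\Gamma$ be an $n$-valent move-symmetric plabic graph with $n$ even. Then the log-canonical bracket on $\mathcal F(\Gamma)$ and the induced bracket on $\mathcal F^{ms}(\Gamma)$ exist and are uniquely determined by the above conditions, and the latter is given by $$\{y_i,y_j\}=q_{ij}\,y_iy_j\ \text{ if } i\in I_0 \text{ or } j\in I_0,\qquad \{y_i,y_j\}=\tfrac12\,q_{ij}\,y_iy_j\ \text{ if } i,j\in I_+.$$ Thus twice this bracket is the log-canonical bracket on the variables $y_i$, $i\in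 I_0\sqcup I_+$, of the quiver obtained by folding $\mathcal Q$ along the midline: $2\{y_i,y_j\}=d_i\big(\sum_{k\in\{i,i'\}}q_{kj}\big)y_iy_j$ for $i,j\in I_0\sqcup I_+$, where $d_i=2$ if $i\in I_0$ and $d_i=1$ if $i\in I_+$. -/

import Mathlib

open Set Topology

/-! ### Polygonal arcs in the plane `ℂ` -/

/-- The polygonal line through `p 0, p 1, p 2, …`, parametrized so that it is at `p k` at time `k`
and moves at constant speed along the segment from `p k` to `p (k + 1)` in between. -/
noncomputable def polyLine (p : ℕ → ℂ) (t : ℝ) : ℂ :=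
  AffineMap.lineMap (p ⌊t⌋₊) (p (⌊t⌋₊ + 1)) (Int.fract t)

/-- The points `p 0, …, p m` are the successive break points of a polygonal arc from `u` to `v`
whose set of points is `A`. The arc has no self-intersections, except that its two ends are
allowed to coincide (a loop). -/
structure IsArcParam (A : Set ℂ) (u v : ℂ) (m : ℕ) (p : ℕ → ℂ) : Prop where
  pos : 0 < m
  start : p 0 = u
  finish : p m = v
  injOn_left : InjOn (polyLine p) (Ico 0 (m : ℝ))
  injOn_right : InjOn (polyLine p) (Ioc 0 (m : ℝ))
  image : A = polyLine p '' Icc 0 (m : ℝ)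

/-- `A` is a polygonal arc from `u` to `v` (a loop if `u = v`). -/
def IsArc (A : Set ℂ) (u v : ℂ) : Prop := ∃ m p, IsArcParam A u v m p

/-- Travelling along the arc `A` from `u` to `v`, one has the region `F` on the left hand side. -/
def LiesLeft (A : Set ℂ) (u v : ℂ) (F : Set ℂ) : Prop :=
  ∃ m p, IsArcParam A u v m p ∧ ∃ k < m, ∃ s ∈ Ioo (0 : ℝ) 1, ∀ᶠ ε : ℝ in 𝓝[>] 0,
    AffineMap.lineMap (p k) (p (k + 1)) s + ε * (Complex.I * (p (k + 1) - p k)) ∈ F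

/-- Travelling along the arc `A` from `u` to `v`, one has the region `F` on the right hand side. -/
def LiesRight (A : Set ℂ) (u v : ℂ) (F : Set ℂ) : Prop :=
  ∃ m p, IsArcParam A u v m p ∧ ∃ k < m, ∃ s ∈ Ioo (0 : ℝ) 1, ∀ᶠ ε : ℝ in 𝓝[>] 0,
    AffineMap.lineMap (p k) (p (k + 1)) s - ε * (Complex.I * (p (k + 1) - p k)) ∈ F

/-! ### Plabic graphs in a rectangle -/

/-- The closed rectangle in which all graphs are drawn. Its midline is the real axis. -/
def rect : Set ℂ := {z | |z.re| ≤ 1 ∧ |z.im| ≤ 1}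

/-- The interior of the rectangle. -/
def openRect : Set ℂ := {z | |z.re| < 1 ∧ |z.im| < 1}

/-- Reflection in the midline. -/
noncomputable def mirror : ℂ ≃ₜ ℂ := Complex.conjCLE.toHomeomorph

/-- An `n`-valent plabic graph: a finite graph (multiple edges and loops are allowed) embedded in
the rectangle, with `n` univalent vertices on each vertical side, and with all other vertices in
the interior of the rectangle and coloured white or black. -/
structure PlabicGraph (n : ℕ) where
  /-- boundary vertices on the left side -/
  left : Set ℂ
  /-- boundary vertices on the right side -/
  right : Set ℂ
  /-- white internal vertices -/
  white : Set ℂ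
  /-- black internal vertices -/
  black : Set ℂ
  /-- edges, including their end points -/
  edges : Set (Set ℂ)
  finite_left : left.Finite
  finite_right : right.Finite
  finite_white : white.Finite
  finite_black : black.Finite
  finite_edges : edges.Finite
  card_left : left.ncard = n
  card_right : right.ncard = n
  left_side : ∀ z ∈ left, z.re = -1 ∧ |z.im| < 1
  right_side : ∀ z ∈ right, z.re = 1 ∧ |z.im| < 1
  white_subset : white ⊆ openRect
  black_subset : black ⊆ openRect
  disjoint_colors : Disjoint white black
  /-- every edge is an arc between two vertices, and it runs inside the rectangle without
  meeting vertices other than its ends -/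
  edge_arc : ∀ A ∈ edges, ∃ u ∈ left ∪ right ∪ (white ∪ black),
    ∃ v ∈ left ∪ right ∪ (white ∪ black), IsArc A u v ∧ A \ {u, v} ⊆ openRect ∧
      Disjoint (A \ {u, v}) (left ∪ right ∪ (white ∪ black))
  /-- edges meet only at vertices -/
  edge_inter : ∀ A ∈ edges, ∀ B ∈ edges, A ≠ B → A ∩ B ⊆ left ∪ right ∪ (white ∪ black)
  /-- boundary vertices are univalent -/
  univalent : ∀ b ∈ left ∪ right, {A ∈ edges | b ∈ A}.ncard = 1 ∧ ∀ A ∈ edges, ¬ IsArc A b b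

namespace PlabicGraph

variable {n : ℕ} (Γ : PlabicGraph n)

/-- The boundary vertices. -/
def boundary : Set ℂ := Γ.left ∪ Γ.right

/-- All vertices. -/
def vertices : Set ℂ := Γ.left ∪ Γ.right ∪ (Γ.white ∪ Γ.black)

/-- The degree of a vertex; loops count twice. -/
noncomputable def degree (v : ℂ) : ℕ :=
  {A ∈ Γ.edges | v ∈ A}.ncard + {A ∈ Γ.edges | IsArc A v v}.ncard

/-- The complement of the graph in the rectangle. -/
def complement : Set ℂ := rect \ (Γ.vertices ∪ ⋃₀ Γ.edges)

/-- The faces: connected components of the complement of the graph in the rectangle. -/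
def Face : Type :=
  {F : Set ℂ // ∃ z ∈ Γ.complement, F = connectedComponentIn Γ.complement z}

/-- The face is on the midline: its interior meets the midline. -/
def OnMidline (i : Γ.Face) : Prop := ∃ z ∈ interior i.1, z.im = 0

/-- The face is above the midline. -/
def Above (i : Γ.Face) : Prop := ∀ z ∈ i.1, 0 < z.im

/-! ### The dual quiver -/

/-- The number of whole edges `i → j` of the dual quiver. They come from the edges of the graph
with a white end `u` and a black end `v`, crossed from `i` to `j` with `u` on the left and `v` on
the right; that is, `i` is to the right and `j` to the left of the edge, directed from `u` to
`v`. -/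
noncomputable def wholeArrows (i j : Γ.Face) : ℕ :=
  {A ∈ Γ.edges | ∃ u ∈ Γ.white, ∃ v ∈ Γ.black, IsArc A u v ∧
    LiesRight A u v i.1 ∧ LiesLeft A u v j.1}.ncard

/-- The number of half-edges `i → j` of the dual quiver. They come from the edges of the graph
that join an internal vertex `u` to a boundary vertex `b`, crossed from `i` to `j` with `u` on the
left if `u` is white, and with `u` on the right if `u` is black. -/
noncomputable def halfArrows (i j : Γ.Face) : ℕ :=
  {A ∈ Γ.edges | ∃ b ∈ Γ.boundary,
    (∃ u ∈ Γ.white, IsArc A u b ∧ LiesRight A u b i.1 ∧ LiesLeft A u b j.1) ∨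
    (∃ u ∈ Γ.black, IsArc A b u ∧ LiesRight A b u i.1 ∧ LiesLeft A b u j.1)}.ncard

/-- The skew-symmetric adjacency matrix of the dual quiver; half-edges count as `1/2`. -/
noncomputable def q (i j : Γ.Face) : ℂ :=
  (Γ.wholeArrows i j + Γ.halfArrows i j / 2) - (Γ.wholeArrows j i + Γ.halfArrows j i / 2)

/-! ### Square moves and move-symmetric graphs -/

/-- `i` is a square face (four trivalent vertices of alternating colours, joined cyclically by
four edges which form the boundary of the face) with vertices `v 0, v 1, v 2, v 3`, of which the
opposite vertices `v 0` and `v 2` are on the midline. -/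
def IsMidlineSquareWith (i : Γ.Face) (v : Fin 4 → ℂ) : Prop :=
  Function.Injective v ∧
  ((v 0 ∈ Γ.white ∧ v 1 ∈ Γ.black ∧ v 2 ∈ Γ.white ∧ v 3 ∈ Γ.black) ∨
    (v 0 ∈ Γ.black ∧ v 1 ∈ Γ.white ∧ v 2 ∈ Γ.black ∧ v 3 ∈ Γ.white)) ∧
  (∀ k, Γ.degree (v k) = 3) ∧
  (∃ A : Fin 4 → Set ℂ, (∀ k, A k ∈ Γ.edges ∧ IsArc (A k) (v k) (v (k + 1))) ∧
    frontier i.1 = ⋃ k, A k) ∧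
  (v 0).im = 0 ∧ (v 2).im = 0

/-- `i` is a square face with two opposite vertices on the midline. -/
def IsMidlineSquare (i : Γ.Face) : Prop := ∃ v, Γ.IsMidlineSquareWith i v

/-- The vertices whose colour is reversed by performing square moves at all square faces which have
two opposite vertices on the midline. A square move reverses the colours of the four vertices of
the square and leaves everything else in place, so these are the points that are a vertex of an odd
number of such squares. -/
def recolored : Set ℂ :=
  {z | Odd {i : Γ.Face | ∃ v, Γ.IsMidlineSquareWith i v ∧ z ∈ range v}.ncard}

/-- The white vertices after square moves at all square faces which have two opposite vertices on
the midline. -/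
def movedWhite : Set ℂ := (Γ.white \ Γ.recolored) ∪ (Γ.black ∩ Γ.recolored)

/-- The black vertices after these square moves. -/
def movedBlack : Set ℂ := (Γ.black \ Γ.recolored) ∪ (Γ.white ∩ Γ.recolored)

/-- The graph is move-symmetric: after square moves at all square faces which have two opposite
vertices on the midline, and reflection in the midline, one gets the initial graph with opposite
colours. -/
structure IsMoveSymmetric : Prop where
  left : mirror '' Γ.left = Γ.left
  right : mirror '' Γ.right = Γ.right
  edges : (fun A => mirror '' A) '' Γ.edges = Γ.edges
  white : mirror '' Γ.movedWhite = Γ.black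
  black : mirror '' Γ.movedBlack = Γ.white

variable {Γ}

theorem moved_union : Γ.movedWhite ∪ Γ.movedBlack = Γ.white ∪ Γ.black := by
  ext z
  simp only [movedWhite, movedBlack, mem_union, mem_sdiff, mem_inter_iff]
  tauto

theorem mirror_rect : mirror '' rect = rect := by
  have h : ∀ z ∈ rect, mirror z ∈ rect := fun z hz => by
    simpa [rect, mirror] using hz
  apply Subset.antisymm
  · rintro _ ⟨z, hz, rfl⟩
    exact h z hz
  · intro z hz
    exact ⟨mirror z, h z hz, by simp [mirror]⟩

theorem IsMoveSymmetric.mirror_complement (h : Γ.IsMoveSymmetric) :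
    mirror '' Γ.complement = Γ.complement := by
  have h1 : mirror '' Γ.vertices = Γ.vertices := by
    rw [vertices, image_union, image_union, h.left, h.right, ← moved_union, image_union, h.white,
      h.black, moved_union, union_comm Γ.black]
  have h2 : mirror '' (⋃₀ Γ.edges) = ⋃₀ Γ.edges := by
    rw [sUnion_eq_biUnion, image_iUnion₂, ← sUnion_image, h.edges, ← sUnion_eq_biUnion]
  rw [complement, image_sdiff mirror.injective, image_union, h1, h2, mirror_rect]

/-- The mirror image `i'` of a face `i`. -/
noncomputable def reflect (h : Γ.IsMoveSymmetric) (i : Γ.Face) : Γ.Face :=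
  ⟨mirror '' i.1, by
    obtain ⟨F, z, hz, rfl⟩ := i
    refine ⟨mirror z, ?_, ?_⟩
    · rw [← h.mirror_complement]
      exact mem_image_of_mem _ hz
    · rw [mirror.image_connectedComponentIn hz, h.mirror_complement]⟩

variable (Γ)

/-! ### Face weightings -/

/-- The face weight space: nonzero weights of the faces, with product `1`. -/
def FaceWeighting : Type := {Y : Γ.Face → ℂ // (∀ i, Y i ≠ 0) ∧ ∏ᶠ i, Y i = 1}

open Classical in
/-- The face weights after square moves at all square faces which have two opposite vertices on
the midline. A square move at a face of weight `y` inverts the weight of that face, and multiplies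
the weight of an adjacent face by `1 + y` for every arrow of the dual quiver to the square, and by
`(1 + y⁻¹)⁻¹` for every arrow from the square. -/
noncomputable def movedWeight (Y : Γ.Face → ℂ) (i : Γ.Face) : ℂ :=
  if Γ.IsMidlineSquare i then (Y i)⁻¹
  else Y i * ∏ᶠ s : {s : Γ.Face // Γ.IsMidlineSquare s},
    ((1 + Y s.1) ^ Γ.wholeArrows i s.1 * ((1 + (Y s.1)⁻¹) ^ Γ.wholeArrows s.1 i)⁻¹)

/-- The face weight space without the indeterminacy locus of the above square moves. -/
def RegularWeighting : Type :=
  {Y : Γ.FaceWeighting // ∀ s, Γ.IsMidlineSquare s → 1 + Y.1 s ≠ 0}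

variable {Γ}

/-- The involution `σ` on face weights: square moves at all square faces which have two opposite
vertices on the midline, and reflection in the midline. -/
noncomputable def sigma (h : Γ.IsMoveSymmetric) (Y : Γ.Face → ℂ) : Γ.Face → ℂ :=
  fun i => Γ.movedWeight Y (reflect h i)

/-- The space of move-symmetric face weightings: the fixed points of `σ`. -/
def MSWeighting (h : Γ.IsMoveSymmetric) : Type :=
  {Y : Γ.RegularWeighting // sigma h Y.1.1 = Y.1.1}

variable (Γ)

/-- The weight of the face `i`, as a function on the face weight space. -/
def coord (i : Γ.Face) : Γ.RegularWeighting → ℂ := fun Y => Y.1.1 i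

/-- The algebra of regular functions on the face weight space (without the indeterminacy
locus): it is generated by the face weights, their inverses, and the inverses of `1 + y` for the
weights `y` of the square faces which have two opposite vertices on the midline. -/
def regularFunctions : Subalgebra ℂ (Γ.RegularWeighting → ℂ) :=
  Algebra.adjoin ℂ (range Γ.coord ∪ (range fun i => (Γ.coord i)⁻¹) ∪
    {f | ∃ s, Γ.IsMidlineSquare s ∧ f = (1 + Γ.coord s)⁻¹})

/-- The weight of the face `i`, as a regular function on the face weight space. -/
def y (i : Γ.Face) : Γ.regularFunctions :=
  ⟨Γ.coord i, Algebra.subset_adjoin (Or.inl (Or.inl ⟨i, rfl⟩))⟩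

variable {Γ}

/-- Restriction of functions to the space of move-symmetric weightings. -/
def restrictHom (h : Γ.IsMoveSymmetric) :
    (Γ.RegularWeighting → ℂ) →ₐ[ℂ] (MSWeighting h → ℂ) where
  toFun f := fun Y => f Y.1
  map_one' := rfl
  map_mul' _ _ := rfl
  map_zero' := rfl
  map_add' _ _ := rfl
  commutes' _ := rfl

/-- The algebra of regular functions on the space of move-symmetric weightings. -/
def msFunctions (h : Γ.IsMoveSymmetric) : Subalgebra ℂ (MSWeighting h → ℂ) :=
  Γ.regularFunctions.map (restrictHom h)

/-- Restriction of a regular function to the space of move-symmetric weightings. -/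
def res (h : Γ.IsMoveSymmetric) (f : Γ.regularFunctions) : msFunctions h :=
  ⟨restrictHom h f.1, f.1, f.2, rfl⟩

/-- The regular function `f` is invariant under `σ`. -/
def IsInvariant (h : Γ.IsMoveSymmetric) (f : Γ.regularFunctions) : Prop :=
  ∀ Y Y' : Γ.RegularWeighting, Y'.1.1 = sigma h Y.1.1 → f.1 Y' = f.1 Y

end PlabicGraph

/-! ### Poisson brackets -/

/-- A Poisson bracket on a commutative `ℂ`-algebra. -/
@[ext] structure PoissonBracket (A : Type*) [CommRing A] [Algebra ℂ A] where
  /-- the bracket -/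
  br : A →ₗ[ℂ] A →ₗ[ℂ] A
  skew : ∀ f, br f f = 0
  jacobi : ∀ f g k, br f (br g k) + br g (br k f) + br k (br f g) = 0
  leibniz : ∀ f g k, br f (g * k) = br f g * k + g * br f k

namespace PlabicGraph

variable {n : ℕ} {Γ : PlabicGraph n}

/-- The Poisson bracket is the log-canonical bracket on the face weight space defined by the dual
quiver. -/
def IsQuiverBracket (P : PoissonBracket Γ.regularFunctions) : Prop :=
  ∀ i j, P.br (Γ.y i) (Γ.y j) = Γ.q i j • (Γ.y i * Γ.y j)

/-- `P'` is the Poisson bracket induced by the Poisson bracket `P` on the fixed point set of `σ`: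
the bracket of the restrictions of two `σ`-invariant functions is the restriction of their
bracket. -/
def IsInducedBracket (h : Γ.IsMoveSymmetric) (P : PoissonBracket Γ.regularFunctions)
    (P' : PoissonBracket (msFunctions h)) : Prop :=
  ∀ f g, IsInvariant h f → IsInvariant h g → P'.br (res h f) (res h g) = res h (P.br f g)

/-- The weight of the face `i`, as a function on the space of move-symmetric weightings. -/
def yms (h : Γ.IsMoveSymmetric) (i : Γ.Face) : msFunctions h := res h (Γ.y i)

open Classical in
/-- The matrix obtained from the adjacency matrix of the dual quiver by folding along the midline
(the rows of a face and of its mirror image are added) and then skew-symmetrizing (the rows of the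
faces on the midline are doubled). -/
noncomputable def foldedMatrix (h : Γ.IsMoveSymmetric) (i j : Γ.Face) : ℂ :=
  (if Γ.OnMidline i then 2 else 1) * ∑ k ∈ ({i, reflect h i} : Finset Γ.Face), Γ.q k j

end PlabicGraph

/-! ### Polygonal lines -/

/-! For even `n` no vertex lies on the midline (`im_ne_zero`). Hence there are no midline squares,
no square move is performed, and `σ` just permutes the face weights by the reflection `i ↦ i'`
(`sigma_eq`). The reflection swaps the colours and also swaps left and right; the two effects cancel
and `q i' j' = q i j` (`q_reflect`).

Midline vertices are excluded by parity. A reflection-invariant set of `n` points on a vertical side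
cannot contain the midpoint of that side when `n` is even. So let `w` be the leftmost internal
vertex on the midline. Its colour has to be reversed, so it belongs to an odd number of midline
squares. It is trivalent: one edge `e` runs along the midline to the right, and the two others are
mirror images of each other. To the left of `w` the midline stays away from all midline squares,
which forces every midline square at `w` to have `e` as an edge. Then all four of its vertices are
real (`square_real`), its reflection is a different midline square at `w`, and the squares at `w`
come in pairs: a contradiction.

The weight space is the torus `∏ y = 1`. Its monomials are characters, so the distinct ones form a
basis of the regular functions, and a bilinear form on exponents gives a log-canonical bracket as
soon as it vanishes on exponents of trivial monomials. For `q` this means that its rows sum to zero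
(`sum_q`), which is a count around each vertex: every sector has one ray on its right and one on its
left (`sum_left_eq_sum_right`). This needs the local topology of polygonal graphs: each edge has one
face on each side (`exists_edge_sides`), and there are finitely many faces (`finite_face`).

The fixed points of `σ` form a torus too, with the form averaged over the reflection. This is the
induced bracket, because invariant functions are spanned by symmetrized monomials
(`br_restrict_of_invariant`). Its coefficient at `y i`, `y j` is `(q i j + q i j') / 2`. If `i` or
`j` is on the midline, the two terms are equal. If both are above, `q i j' = 0`, because an edge
separating the two faces would start on the midline (`q_above_reflect`). Uniqueness holds because
the coordinates and their inverses generate, and a coordinate on the fixed set is the restriction of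
the invariant function `(y i + y i') / 2`. -/

theorem polyLine_of_mem {p : ℕ → ℂ} {k : ℕ} {t : ℝ} (h : t ∈ Icc (k : ℝ) (k + 1)) :
    polyLine p t = AffineMap.lineMap (p k) (p (k + 1)) (t - k) := by
  rcases h.2.lt_or_eq with h2 | h2
  · have h3 : ⌊t⌋₊ = k := (Nat.floor_eq_iff ((Nat.cast_nonneg k).trans h.1)).2 ⟨h.1, h2⟩
    have h4 : Int.fract t = t - k := by
      rw [Int.fract_eq_iff]
      refine ⟨by linarith [h.1], by linarith, k, by push_cast; ring⟩
    rw [polyLine, h3, h4]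
  · have h3 : ⌊t⌋₊ = k + 1 := by rw [h2]; exact_mod_cast Nat.floor_natCast (R := ℝ) (k + 1)
    have h4 : Int.fract t = 0 := by rw [h2]; exact_mod_cast Int.fract_natCast (R := ℝ) (k + 1)
    rw [polyLine, h3, h4, h2]
    simp

theorem polyLine_natCast (p : ℕ → ℂ) (k : ℕ) : polyLine p k = p k := by
  rw [polyLine_of_mem (k := k) ⟨le_rfl, by linarith⟩]
  simp

theorem polyLine_add {p : ℕ → ℂ} {k : ℕ} {s : ℝ} (h : s ∈ Icc (0 : ℝ) 1) :
    polyLine p (k + s) = AffineMap.lineMap (p k) (p (k + 1)) s := by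
  rw [polyLine_of_mem (k := k) ⟨by linarith [h.1], by linarith [h.2]⟩]
  simp

theorem continuousOn_polyLine (p : ℕ → ℂ) (m : ℕ) : ContinuousOn (polyLine p) (Icc 0 (m : ℝ)) := by
  induction m with
  | zero => simp
  | succ m ih =>
    have h : ContinuousOn (polyLine p) (Icc (m : ℝ) (m + 1)) := by
      refine ContinuousOn.congr (f := fun t : ℝ =>
        AffineMap.lineMap (p m) (p (m + 1)) (t - m)) ?_ fun t ht => polyLine_of_mem ht
      refine Continuous.continuousOn ?_
      exact AffineMap.lineMap_continuous.comp (continuous_id.sub continuous_const)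
    have := ih.union_of_isClosed h isClosed_Icc isClosed_Icc
    rwa [Icc_union_Icc_eq_Icc (Nat.cast_nonneg m) (by linarith), ← Nat.cast_succ] at this

theorem exists_mem_segment_index {m : ℕ} {t : ℝ} (hm : 0 < m) (h : t ∈ Icc 0 (m : ℝ)) :
    ∃ k < m, ∃ s ∈ Icc (0 : ℝ) 1, t = k + s := by
  rcases h.2.lt_or_eq with h2 | h2
  · refine ⟨⌊t⌋₊, (Nat.floor_lt h.1).2 h2, t - ⌊t⌋₊, ⟨?_, ?_⟩, by ring⟩
    · linarith [Nat.floor_le h.1]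
    · linarith [Nat.lt_floor_add_one t]
  · refine ⟨m - 1, by omega, 1, by simp, ?_⟩
    rw [h2, Nat.cast_sub hm]
    simp

theorem polyLine_reverse (p : ℕ → ℂ) {m : ℕ} (hm : 0 < m) {t : ℝ} (h : t ∈ Icc 0 (m : ℝ)) :
    polyLine (fun k => p (m - k)) t = polyLine p (m - t) := by
  obtain ⟨k, hk, s, hs, rfl⟩ := exists_mem_segment_index hm h
  have e : (m : ℝ) - (k + s) = ((m - (k + 1) : ℕ) : ℝ) + (1 - s) := by
    rw [Nat.cast_sub hk]
    push_cast
    ring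
  rw [polyLine_add hs, e, polyLine_add ⟨by linarith [hs.2], by linarith [hs.1]⟩,
    AffineMap.lineMap_apply_one_sub]
  congr 3
  omega

namespace IsArcParam

variable {A : Set ℂ} {u v : ℂ} {m : ℕ} {p : ℕ → ℂ}

theorem reverse (h : IsArcParam A u v m p) : IsArcParam A v u m fun k => p (m - k) where
  pos := h.pos
  start := by simpa using h.finish
  finish := by simpa using h.start
  injOn_left := by
    intro s hs t ht e
    rw [polyLine_reverse p h.pos ⟨hs.1, hs.2.le⟩, polyLine_reverse p h.pos ⟨ht.1, ht.2.le⟩] at e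
    have := h.injOn_right (x₁ := m - s) (x₂ := m - t) ⟨by linarith [hs.2], by linarith [hs.1]⟩
      ⟨by linarith [ht.2], by linarith [ht.1]⟩ e
    linarith
  injOn_right := by
    intro s hs t ht e
    rw [polyLine_reverse p h.pos ⟨hs.1.le, hs.2⟩, polyLine_reverse p h.pos ⟨ht.1.le, ht.2⟩] at e
    have := h.injOn_left (x₁ := m - s) (x₂ := m - t) ⟨by linarith [hs.2], by linarith [hs.1]⟩
      ⟨by linarith [ht.2], by linarith [ht.1]⟩ e
    linarith
  image := by
    rw [h.image]
    ext z
    constructor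
    · rintro ⟨t, ht, rfl⟩
      have ht' : (m : ℝ) - t ∈ Icc 0 (m : ℝ) := ⟨by linarith [ht.2], by linarith [ht.1]⟩
      exact ⟨m - t, ht', by rw [polyLine_reverse p h.pos ht']; simp⟩
    · rintro ⟨t, ht, rfl⟩
      exact ⟨m - t, ⟨by linarith [ht.2], by linarith [ht.1]⟩, (polyLine_reverse p h.pos ht).symm⟩

theorem mem_iff (h : IsArcParam A u v m p) {z : ℂ} :
    z ∈ A ↔ ∃ k < m, ∃ s ∈ Icc (0 : ℝ) 1, AffineMap.lineMap (p k) (p (k + 1)) s = z := by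
  rw [h.image]
  constructor
  · rintro ⟨t, ht, rfl⟩
    obtain ⟨k, hk, s, hs, rfl⟩ := exists_mem_segment_index h.pos ht
    exact ⟨k, hk, s, hs, (polyLine_add hs).symm⟩
  · rintro ⟨k, hk, s, hs, rfl⟩
    have : (k : ℝ) + 1 ≤ m := by exact_mod_cast hk
    exact ⟨k + s, ⟨by linarith [hs.1, Nat.cast_nonneg (α := ℝ) k], by linarith [hs.2]⟩,
      polyLine_add hs⟩

theorem start_mem (h : IsArcParam A u v m p) : u ∈ A :=
  h.mem_iff.2 ⟨0, h.pos, 0, by simp, by simp [h.start]⟩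

theorem isCompact (h : IsArcParam A u v m p) : IsCompact A := by
  rw [h.image]
  exact isCompact_Icc.image_of_continuousOn (continuousOn_polyLine p m)

theorem injOn_of_ne (h : IsArcParam A u v m p) (huv : u ≠ v) :
    InjOn (polyLine p) (Icc 0 (m : ℝ)) := by
  have hm : (0 : ℝ) < m := by exact_mod_cast h.pos
  have e0 : polyLine p 0 = u := by
    have := polyLine_natCast p 0
    rwa [Nat.cast_zero, h.start] at this
  have e1 : polyLine p m = v := by rw [polyLine_natCast, h.finish]
  intro s hs t ht e
  rcases hs.2.lt_or_eq with h1 | h1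
  · rcases ht.2.lt_or_eq with h2 | h2
    · exact h.injOn_left ⟨hs.1, h1⟩ ⟨ht.1, h2⟩ e
    · rcases hs.1.lt_or_eq with h3 | h3
      · exact h.injOn_right ⟨h3, hs.2⟩ ⟨h2 ▸ hm, ht.2⟩ e
      · exact absurd (by rw [← e0, h3, e, h2, e1]) huv
  · rcases ht.1.lt_or_eq with h2 | h2
    · exact h.injOn_right ⟨h1 ▸ hm, hs.2⟩ ⟨h2, ht.2⟩ e
    · exact absurd (by rw [← e0, h2, ← e, h1, e1]) huv

theorem ne_succ (h : IsArcParam A u v m p) {k : ℕ} (hk : k < m) : p k ≠ p (k + 1) := by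
  intro e
  have h1 : (k : ℝ) + 1 ≤ m := by exact_mod_cast hk
  have h0 : (0 : ℝ) ≤ k := Nat.cast_nonneg k
  -- On a degenerate segment the parametrization would be constant, so any two inner parameters
  -- violate injectivity.
  have : ((k : ℝ) + 1 / 3) = k + 2 / 3 := by
    refine h.injOn_left ⟨by linarith, by linarith⟩ ⟨by linarith, by linarith⟩ ?_
    rw [polyLine_add (by norm_num), polyLine_add (by norm_num), e]
    simp
  linarith

/-- A point in the interior of a segment of an arc is in no other segment. -/
theorem index_unique (h : IsArcParam A u v m p) {k l : ℕ} (hk : k < m) (hl : l < m) {s t : ℝ}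
    (hs : s ∈ Ioo (0 : ℝ) 1) (ht : t ∈ Icc (0 : ℝ) 1)
    (e : (AffineMap.lineMap (p k) (p (k + 1)) s : ℂ) = AffineMap.lineMap (p l) (p (l + 1)) t) :
    k = l ∧ s = t := by
  have h1 : (k : ℝ) + 1 ≤ m := by exact_mod_cast hk
  have h2 : (l : ℝ) + 1 ≤ m := by exact_mod_cast hl
  have h0 : (0 : ℝ) ≤ k := Nat.cast_nonneg k
  have h0' : (0 : ℝ) ≤ l := Nat.cast_nonneg l
  rw [← polyLine_add ⟨hs.1.le, hs.2.le⟩, ← polyLine_add ht] at e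
  have key : (k : ℝ) + s = l + t := by
    rcases (show (l : ℝ) + t ≤ m by linarith [ht.2]).lt_or_eq with h3 | h3
    · exact h.injOn_left ⟨by linarith [hs.1], by linarith [hs.2]⟩ ⟨by linarith [ht.1], h3⟩ e
    · exact h.injOn_right ⟨by linarith [hs.1], by linarith [hs.2]⟩
        ⟨by linarith [hs.1, hs.2], h3.le⟩ e
  have hkl : k ≤ l := by
    by_contra hc
    have : (l : ℝ) + 1 ≤ k := by exact_mod_cast not_le.1 hc
    linarith [hs.1, ht.2]
  have hlk : l ≤ k := by
    by_contra hc
    have : (k : ℝ) + 1 ≤ l := by exact_mod_cast not_le.1 hc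
    linarith [hs.2, ht.1]
  obtain rfl := le_antisymm hkl hlk
  exact ⟨rfl, by linarith⟩

theorem lineMap_mem_sdiff (h : IsArcParam A u v m p) {k : ℕ} (hk : k < m) {s : ℝ}
    (hs : s ∈ Ioo (0 : ℝ) 1) : (AffineMap.lineMap (p k) (p (k + 1)) s : ℂ) ∈ A \ {u, v} := by
  refine ⟨h.mem_iff.2 ⟨k, hk, s, ⟨hs.1.le, hs.2.le⟩, rfl⟩, ?_⟩
  rintro (e | e)
  · have := h.index_unique hk h.pos hs (t := 0) (by simp) (by rw [e]; simp [h.start])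
    linarith [hs.1, this.2]
  · have hm : m - 1 + 1 = m := Nat.sub_add_cancel h.pos
    have := h.index_unique hk (l := m - 1) (by omega) hs (t := 1) (by simp)
      (by rw [e, hm]; simp [h.finish])
    linarith [hs.2, this.2]

theorem breakpoint_mem_sdiff (h : IsArcParam A u v m p) {k : ℕ} (h0 : 0 < k) (hk : k < m) :
    p k ∈ A \ {u, v} := by
  have h0' : (0 : ℝ) < k := by exact_mod_cast h0
  have hk' : (k : ℝ) < m := by exact_mod_cast hk
  refine ⟨h.mem_iff.2 ⟨k, hk, 0, by simp, by simp⟩, ?_⟩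
  rintro (e | e)
  · have := h.injOn_left (x₁ := k) (x₂ := 0) ⟨h0'.le, hk'⟩ ⟨le_rfl, h0'.trans hk'⟩ (by
      have := polyLine_natCast p 0
      rw [Nat.cast_zero, h.start] at this
      rw [polyLine_natCast, e, this])
    linarith
  · have := h.injOn_right (x₁ := k) (x₂ := m) ⟨h0', hk'.le⟩ ⟨h0'.trans hk', le_rfl⟩ (by
      rw [polyLine_natCast, polyLine_natCast, h.finish, e])
    linarith

/-- The image of an arc under a real affine map is an arc. -/
theorem map (h : IsArcParam A u v m p) : IsArcParam (mirror '' A) (mirror u) (mirror v) m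
    (fun k => mirror (p k)) := by
  have e : ∀ t, polyLine (fun k => mirror (p k)) t = mirror (polyLine p t) := by
    intro t
    simp [polyLine, mirror, AffineMap.lineMap_apply]
  have e' : polyLine (fun k => mirror (p k)) = mirror ∘ polyLine p := funext e
  refine ⟨h.pos, by simp [h.start], by simp [h.finish], ?_, ?_, ?_⟩
  · rw [e']
    exact mirror.injective.comp_injOn h.injOn_left
  · rw [e']
    exact mirror.injective.comp_injOn h.injOn_right
  · rw [e', image_comp, h.image]

end IsArcParam

namespace IsArc

variable {A : Set ℂ} {u v : ℂ}

theorem symm (h : IsArc A u v) : IsArc A v u := by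
  obtain ⟨m, p, hp⟩ := h
  exact ⟨m, _, hp.reverse⟩

theorem left_mem (h : IsArc A u v) : u ∈ A := by
  obtain ⟨m, p, hp⟩ := h
  exact hp.start_mem

theorem right_mem (h : IsArc A u v) : v ∈ A := h.symm.left_mem

theorem isCompact (h : IsArc A u v) : IsCompact A := by
  obtain ⟨m, p, hp⟩ := h
  exact hp.isCompact

theorem mirror (h : IsArc A u v) : IsArc (mirror '' A) (mirror u) (mirror v) := by
  obtain ⟨m, p, hp⟩ := h
  exact ⟨m, _, hp.map⟩

/-- A continuous injective parametrization of an arc with distinct ends. -/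
theorem exists_param (h : IsArc A u v) (huv : u ≠ v) : ∃ (m : ℝ) (γ : ℝ → ℂ), 0 < m ∧
    ContinuousOn γ (Icc 0 m) ∧ InjOn γ (Icc 0 m) ∧ γ 0 = u ∧ γ m = v ∧ A = γ '' Icc 0 m := by
  obtain ⟨m, p, hp⟩ := h
  have := polyLine_natCast p 0
  refine ⟨m, polyLine p, by exact_mod_cast hp.pos, continuousOn_polyLine p m, hp.injOn_of_ne huv,
    ?_, ?_, hp.image⟩
  · rwa [Nat.cast_zero, hp.start] at this
  · rw [polyLine_natCast, hp.finish]

end IsArc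

/-- Paths in an arc can be lifted to its parameter interval. -/
theorem exists_lift_of_injOn {m : ℝ} {γ : ℝ → ℂ} (hc : ContinuousOn γ (Icc 0 m))
    (hi : InjOn γ (Icc 0 m)) : ∃ f : ℂ → ℝ, ContinuousOn f (γ '' Icc 0 m) ∧
      (∀ t ∈ Icc 0 m, f (γ t) = t) ∧ ∀ z ∈ γ '' Icc 0 m, f z ∈ Icc 0 m ∧ γ (f z) = z := by
  refine ⟨Function.invFunOn γ (Icc 0 m), ?_, fun t ht => hi.leftInvOn_invFunOn ht, fun z hz =>
    ⟨Function.invFunOn_mem hz, Function.invFunOn_eq hz⟩⟩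
  -- The inverse of a continuous injection on a compact interval is continuous because images of
  -- compact sets are closed.
  rw [continuousOn_iff_isClosed]
  intro K hK
  refine ⟨γ '' (K ∩ Icc 0 m), ?_, ?_⟩
  · exact ((isCompact_Icc.inter_left hK).image_of_continuousOn
      (hc.mono inter_subset_right)).isClosed
  · ext z
    constructor
    · rintro ⟨hz, t, ht, rfl⟩
      rw [mem_preimage, hi.leftInvOn_invFunOn ht] at hz
      exact ⟨⟨t, ⟨hz, ht⟩, rfl⟩, t, ht, rfl⟩
    · rintro ⟨⟨t, ⟨htK, ht⟩, rfl⟩, hz⟩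
      refine ⟨?_, hz⟩
      rwa [mem_preimage, hi.leftInvOn_invFunOn ht]

/-- An arc with distinct ends is not a loop. -/
theorem IsArc.not_loop {A : Set ℂ} {u v : ℂ} (h : IsArc A u v) (huv : u ≠ v) : ¬ IsArc A u u := by
  rintro ⟨l, q, hq⟩
  obtain ⟨m, γ, hm, hc, hi, h0, -, hA⟩ := h.exists_param huv
  obtain ⟨f, fc, f1, f2⟩ := exists_lift_of_injOn hc hi
  rw [← hA] at fc f2
  have hl : (0 : ℝ) < l := by exact_mod_cast hq.pos
  have hmap : MapsTo (polyLine q) (Icc 0 (l : ℝ)) A := fun t ht => by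
    rw [hq.image]
    exact mem_image_of_mem _ ht
  -- `g` is the position on the simple arc of the point that runs through the loop. It vanishes at
  -- both ends and is positive in between, so it takes half its maximal value both before and after
  -- a maximum, against injectivity of the loop.
  set g : ℝ → ℝ := fun t => f (polyLine q t) with hg
  have gc : ContinuousOn g (Icc 0 (l : ℝ)) := fc.comp (continuousOn_polyLine q l) hmap
  have q0 : polyLine q 0 = u := by
    have := polyLine_natCast q 0
    rwa [Nat.cast_zero, hq.start] at this
  have ql : polyLine q l = u := by rw [polyLine_natCast, hq.finish]
  have fu : f u = 0 := by rw [← h0, f1 0 ⟨le_rfl, hm.le⟩]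
  have g0 : g 0 = 0 := by rw [hg]; simp only [q0, fu]
  have gl : g l = 0 := by rw [hg]; simp only [ql, fu]
  have finj : ∀ s ∈ Icc 0 (l : ℝ), ∀ t ∈ Icc 0 (l : ℝ), g s = g t → polyLine q s = polyLine q t := by
    intro s hs t ht e
    rw [← (f2 _ (hmap hs)).2, ← (f2 _ (hmap ht)).2]
    exact congrArg γ e
  obtain ⟨M, hM, hmax⟩ := isCompact_Icc.exists_isMaxOn (nonempty_Icc.2 hl.le) gc
  have hpos : ∀ t ∈ Ioo 0 (l : ℝ), 0 < g t := by
    intro t ht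
    refine lt_of_le_of_ne (f2 _ (hmap ⟨ht.1.le, ht.2.le⟩)).1.1 fun e => ?_
    have := finj t ⟨ht.1.le, ht.2.le⟩ 0 ⟨le_rfl, hl.le⟩ (by rw [g0, ← e])
    have := hq.injOn_left ⟨ht.1.le, ht.2⟩ ⟨le_rfl, hl⟩ this
    linarith [ht.1]
  have hMpos : 0 < g M := (hpos (l / 2) ⟨by linarith, by linarith⟩).trans_le
    (hmax (show (l : ℝ) / 2 ∈ Icc 0 (l : ℝ) from ⟨by linarith, by linarith⟩))
  have hM0 : 0 < M := lt_of_le_of_ne hM.1 fun e => by rw [← e, g0] at hMpos; exact hMpos.false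
  have hMl : M < l := lt_of_le_of_ne hM.2 fun e => by rw [e, gl] at hMpos; exact hMpos.false
  obtain ⟨s, hs, es⟩ := intermediate_value_Icc hM0.le (gc.mono (Icc_subset_Icc_right hM.2))
    (show g M / 2 ∈ Icc (g 0) (g M) by rw [g0]; constructor <;> linarith)
  obtain ⟨t, ht, et⟩ := intermediate_value_Icc' hMl.le (gc.mono (Icc_subset_Icc_left hM.1))
    (show g M / 2 ∈ Icc (g l) (g M) by rw [gl]; constructor <;> linarith)
  have hsM : s ≠ M := fun e => by rw [e] at es; linarith
  have htM : t ≠ M := fun e => by rw [e] at et; linarith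
  have htl : t ≠ l := fun e => by rw [e, gl] at et; linarith
  have hsM' : s < M := lt_of_le_of_ne hs.2 hsM
  have htM' : M < t := lt_of_le_of_ne ht.1 htM.symm
  have htl' : t < l := lt_of_le_of_ne ht.2 htl
  have := hq.injOn_left ⟨hs.1, by linarith⟩ ⟨by linarith, htl'⟩
    (finj s ⟨hs.1, by linarith⟩ t ⟨by linarith, htl'.le⟩ (by rw [es, et]))
  linarith

/-- An arc which equals its mirror image and joins two different points of the midline is a segment
of the midline. -/
theorem IsArc.eq_segment_of_mirror {A : Set ℂ} {u v : ℂ} (h : IsArc A u v) (huv : u ≠ v)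
    (hA : _root_.mirror '' A = A) (hu : u.im = 0) (hv : v.im = 0) :
    A = Complex.ofReal '' uIcc u.re v.re := by
  obtain ⟨m, γ, hm, hc, hi, h0, h1, rfl⟩ := h.exists_param huv
  obtain ⟨f, fc, f1, f2⟩ := exists_lift_of_injOn hc hi
  have hmir : ∀ z : ℂ, z.im = 0 → _root_.mirror z = z := fun z hz => Complex.conj_eq_iff_im.2 hz
  have hmap : ∀ t ∈ Icc 0 m, _root_.mirror (γ t) ∈ γ '' Icc 0 m := fun t ht => by
    rw [← hA]
    exact mem_image_of_mem _ (mem_image_of_mem _ ht)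
  -- The reflection read in the parameter of the arc: a continuous injective involution fixing both
  -- ends, hence increasing, hence the identity. So all points of the arc are real.
  set φ : ℝ → ℝ := fun t => f (_root_.mirror (γ t)) with hφ
  have φc : ContinuousOn φ (Icc 0 m) := fc.comp (_root_.mirror.continuous.comp_continuousOn hc) hmap
  have φmem : ∀ t ∈ Icc 0 m, φ t ∈ Icc 0 m := fun t ht => (f2 _ (hmap t ht)).1
  have φeq : ∀ t ∈ Icc 0 m, γ (φ t) = _root_.mirror (γ t) := fun t ht => (f2 _ (hmap t ht)).2
  have φinj : InjOn φ (Icc 0 m) := by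
    intro s hs t ht e
    have := φeq s hs
    rw [e, φeq t ht] at this
    exact (hi ht hs (_root_.mirror.injective this)).symm
  have φ0 : φ 0 = 0 := by
    rw [hφ]
    simp only [h0, hmir u hu]
    rw [← h0, f1 0 ⟨le_rfl, hm.le⟩]
  have φm : φ m = m := by
    rw [hφ]
    simp only [h1, hmir v hv]
    rw [← h1, f1 m ⟨hm.le, le_rfl⟩]
  have φmono : StrictMonoOn φ (Icc 0 m) :=
    φc.strictMonoOn_of_injOn_Icc hm.le (by rw [φ0, φm]; exact hm.le) φinj
  have φφ : ∀ t ∈ Icc 0 m, φ (φ t) = t := by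
    intro t ht
    refine hi (φmem _ (φmem t ht)) ht ?_
    rw [φeq _ (φmem t ht), φeq t ht]
    exact Complex.conj_conj _
  have φid : ∀ t ∈ Icc 0 m, φ t = t := by
    intro t ht
    rcases lt_trichotomy (φ t) t with h2 | h2 | h2
    · have := φmono (φmem t ht) ht h2
      rw [φφ t ht] at this
      exact absurd this h2.not_gt
    · exact h2
    · have := φmono ht (φmem t ht) h2
      rw [φφ t ht] at this
      exact absurd this h2.not_gt
  have him : ∀ t ∈ Icc 0 m, (γ t).im = 0 := by
    intro t ht
    have := φeq t ht
    rw [φid t ht] at this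
    exact Complex.conj_eq_iff_im.1 this.symm
  have hre : ∀ t ∈ Icc 0 m, ((γ t).re : ℂ) = γ t := fun t ht => by
    apply Complex.ext <;> simp [him t ht]
  have rc : ContinuousOn (fun t => (γ t).re) (Icc 0 m) := Complex.continuous_re.comp_continuousOn hc
  have rinj : InjOn (fun t => (γ t).re) (Icc 0 m) := by
    intro s hs t ht e
    refine hi hs ht ?_
    rw [← hre s hs, ← hre t ht]
    exact congrArg _ e
  have key : (fun t => (γ t).re) '' Icc 0 m = uIcc u.re v.re := by
    apply Subset.antisymm
    · rintro _ ⟨t, ht, rfl⟩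
      rcases rc.strictMonoOn_of_injOn_Icc' hm.le rinj with h2 | h2
      · refine Icc_subset_uIcc ⟨?_, ?_⟩
        · simpa [h0] using h2.monotoneOn ⟨le_rfl, hm.le⟩ ht ht.1
        · simpa [h1] using h2.monotoneOn ht ⟨hm.le, le_rfl⟩ ht.2
      · refine Icc_subset_uIcc' ⟨?_, ?_⟩
        · simpa [h1] using h2.antitoneOn ht ⟨hm.le, le_rfl⟩ ht.2
        · simpa [h0] using h2.antitoneOn ⟨le_rfl, hm.le⟩ ht ht.1
    · have := intermediate_value_uIcc (f := fun t => (γ t).re) (a := 0) (b := m)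
        (by rwa [uIcc_of_le hm.le])
      rw [uIcc_of_le hm.le] at this
      simpa [h0, h1] using this
  rw [← key, ← image_comp]
  exact image_congr fun t ht => (hre t ht).symm

/-! ### Locally constant functions and the germs of a plane set on one side of a line -/

theorem IsPreconnected.eq_of_eventually_eq {X β : Type*} [TopologicalSpace X] {S : Set X}
    (hS : IsPreconnected S) {f : X → β} (hf : ∀ x ∈ S, ∀ᶠ y in 𝓝[S] x, f y = f x) {x y : X}
    (hx : x ∈ S) (hy : y ∈ S) : f x = f y := by
  -- For the discrete topology, local constancy is continuity.
  let _ : TopologicalSpace β := ⊥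
  have : DiscreteTopology β := ⟨rfl⟩
  refine hS.constant (fun z hz => ?_) hx hy
  refine Filter.Tendsto.congr' (f₁ := fun _ => f z) ?_ tendsto_const_nhds
  filter_upwards [hf z hz] with w hw using hw.symm

/-- A function of a real variable which is locally constant except for finitely many jumps changes
by the sum of its jumps. -/
theorem sub_eq_sum_jumps {κ : Type*} {H : Finset κ} {θ : κ → ℝ} (hθ : InjOn θ H) {c d : ℝ}
    (hcd : c ≤ d) (hH : ∀ h ∈ H, θ h ∈ Ioo c d) {g : ℝ → ℂ} {l r : κ → ℂ}
    (hg : ∀ t ∈ Icc c d, (∀ h ∈ H, θ h ≠ t) → ∀ᶠ s in 𝓝 t, g s = g t)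
    (hl : ∀ h ∈ H, ∀ᶠ s in 𝓝[<] (θ h), g s = l h)
    (hr : ∀ h ∈ H, ∀ᶠ s in 𝓝[>] (θ h), g s = r h) :
    g d - g c = ∑ h ∈ H, (r h - l h) := by
  classical
  -- `J` is the left-continuous step function with the given jumps, and `g'` is `g` with its values
  -- at the jumps replaced by the left limits. The difference `g' - J` is locally constant on the
  -- whole interval.
  set J : ℝ → ℂ := fun t => ∑ h ∈ H, if θ h < t then r h - l h else 0 with hJ
  set g' : ℝ → ℂ := fun t => if e : ∃ h ∈ H, θ h = t then l e.choose else g t with hg'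
  have g'1 : ∀ h ∈ H, g' (θ h) = l h := by
    intro h hh
    have e : ∃ h' ∈ H, θ h' = θ h := ⟨h, hh, rfl⟩
    rw [hg']
    simp only [dif_pos e]
    exact congrArg l (hθ e.choose_spec.1 hh e.choose_spec.2)
  have g'2 : ∀ t, (∀ h ∈ H, θ h ≠ t) → g' t = g t := by
    intro t ht
    rw [hg']
    refine dif_neg ?_
    rintro ⟨h, hh, e⟩
    exact ht h hh e
  have hfin : ∀ t, ∀ᶠ s in 𝓝 t, ∀ h ∈ H, θ h ≠ t → ((θ h < s ↔ θ h < t) ∧ θ h ≠ s) := by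
    intro t
    rw [Filter.eventually_all_finset]
    intro h _
    rcases lt_trichotomy (θ h) t with h1 | h1 | h1
    · filter_upwards [lt_mem_nhds h1] with s hs _ using ⟨iff_of_true hs h1, hs.ne⟩
    · exact Filter.Eventually.of_forall fun s hs => absurd h1 hs
    · filter_upwards [gt_mem_nhds h1] with s hs _ using
        ⟨iff_of_false hs.not_gt h1.not_gt, hs.ne'⟩
  have key : g' c - J c = g' d - J d := by
    refine isPreconnected_Icc.eq_of_eventually_eq (f := fun t => g' t - J t) ?_
      (left_mem_Icc.2 hcd) (right_mem_Icc.2 hcd)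
    intro t ht
    refine nhdsWithin_le_nhds ?_
    by_cases e : ∃ h ∈ H, θ h = t
    · obtain ⟨h, hh, rfl⟩ := e
      filter_upwards [hfin (θ h), eventually_nhdsWithin_iff.1 (hl h hh),
        eventually_nhdsWithin_iff.1 (hr h hh)] with s hs hls hrs
      have hs' : ∀ h' ∈ H, h' ≠ h → ((θ h' < s ↔ θ h' < θ h) ∧ θ h' ≠ s) := fun h' hh' hne =>
        hs h' hh' fun e => hne (hθ hh' hh e)
      rcases lt_trichotomy s (θ h) with h1 | h1 | h1
      · have e1 : g' s = l h := by
          rw [g'2 s, hls h1]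
          intro h' hh'
          by_cases e : h' = h
          · rw [e]; exact h1.ne'
          · exact (hs' h' hh' e).2
        have e2 : J s = J (θ h) := by
          refine Finset.sum_congr rfl fun h' hh' => ?_
          by_cases e : h' = h
          · rw [e, if_neg h1.not_gt, if_neg (lt_irrefl _)]
          · simp only [(hs' h' hh' e).1]
        rw [e1, e2, g'1 h hh]
      · rw [h1]
      · have e1 : g' s = r h := by
          rw [g'2 s, hrs h1]
          intro h' hh'
          by_cases e : h' = h
          · rw [e]; exact h1.ne
          · exact (hs' h' hh' e).2
        have e2 : J s = J (θ h) + (r h - l h) := by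
          have : (r h - l h) = ∑ h' ∈ H, if h' = h then r h - l h else 0 := by
            rw [Finset.sum_ite_eq' H h, if_pos hh]
          rw [hJ]
          simp only
          rw [this, ← Finset.sum_add_distrib]
          refine Finset.sum_congr rfl fun h' hh' => ?_
          by_cases e : h' = h
          · rw [e, if_pos h1, if_neg (lt_irrefl _), if_pos rfl, zero_add]
          · simp only [(hs' h' hh' e).1, if_neg e, add_zero]
        rw [e1, e2, g'1 h hh]
        ring
    · have e' : ∀ h ∈ H, θ h ≠ t := fun h hh e2 => e ⟨h, hh, e2⟩
      filter_upwards [hfin t, hg t ht e'] with s hs hgs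
      have e2 : J s = J t := Finset.sum_congr rfl fun h' hh' => by
        simp only [(hs h' hh' (e' h' hh')).1]
      rw [e2, g'2 s fun h hh => (hs h hh (e' h hh)).2, g'2 t e', hgs]
  rw [g'2 c fun h hh => (hH h hh).1.ne', g'2 d fun h hh => (hH h hh).2.ne] at key
  have Jc : J c = 0 := Finset.sum_eq_zero fun h hh => if_neg (hH h hh).1.not_gt
  have Jd : J d = ∑ h ∈ H, (r h - l h) := Finset.sum_congr rfl fun h hh => if_pos (hH h hh).2
  rw [Jc, Jd] at key
  linear_combination -key

/-- The filter of the neighbourhoods of `y` to the left of the line through `y` in the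
direction `d`. -/
noncomputable def leftGerm (y d : ℂ) : Filter ℂ :=
  𝓝 y ⊓ Filter.principal {z | 0 < ((starRingEnd ℂ) d * (z - y)).im}

theorem mem_leftGerm_iff {y d : ℂ} {F : Set ℂ} :
    F ∈ leftGerm y d ↔ ∀ᶠ z in 𝓝 y, 0 < ((starRingEnd ℂ) d * (z - y)).im → z ∈ F :=
  Filter.mem_inf_principal

/-- Links the points on the normal, by which `LiesLeft` and `LiesRight` are defined, with one-sided
neighbourhoods. -/
theorem tendsto_leftGerm_normal (y : ℂ) {d : ℂ} (hd : d ≠ 0) :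
    Filter.Tendsto (fun ε : ℝ => y + ε * (Complex.I * d)) (𝓝[>] 0) (leftGerm y d) := by
  refine Filter.tendsto_inf.2 ⟨?_, ?_⟩
  · have : Continuous fun ε : ℝ => y + ε * (Complex.I * d) := by fun_prop
    refine Filter.Tendsto.mono_left ?_ nhdsWithin_le_nhds
    simpa using this.tendsto 0
  · rw [Filter.tendsto_principal]
    filter_upwards [self_mem_nhdsWithin] with ε hε
    have : ((starRingEnd ℂ) d * (y + ε * (Complex.I * d) - y)).im = ε * Complex.normSq d := by
      simp [Complex.normSq_apply]
      ring
    rw [this]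
    exact mul_pos hε (Complex.normSq_pos.2 hd)

theorem leftGerm_neBot (y : ℂ) {d : ℂ} (hd : d ≠ 0) : (leftGerm y d).NeBot :=
  (tendsto_leftGerm_normal y hd).neBot

theorem leftGerm_ofReal_mul (y d : ℂ) {c : ℝ} (hc : 0 < c) : leftGerm y (c * d) = leftGerm y d := by
  have : ∀ z : ℂ, ((starRingEnd ℂ) (c * d) * (z - y)).im = c * ((starRingEnd ℂ) d * (z - y)).im := by
    intro z
    simp
    ring
  simp only [leftGerm, this, mul_pos_iff_of_pos_left hc]

/-- The sign of `sin (s - θ)` tells on which side of the ray of angle `θ` from `x` a point of a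
circle about `x` lies: left just after `θ`, right just before. -/
theorem circle_sub_im (ρ θ s : ℝ) (x : ℂ) :
    ((starRingEnd ℂ) (Complex.exp (θ * Complex.I)) * (x + ρ * Complex.exp (s * Complex.I) -
      (x + ρ * Complex.exp (θ * Complex.I)))).im = ρ * Real.sin (s - θ) := by
  rw [Real.sin_sub, Complex.exp_mul_I, Complex.exp_mul_I]
  simp [← Complex.ofReal_cos, ← Complex.ofReal_sin]
  ring

theorem tendsto_leftGerm_circle_right (x : ℂ) {ρ : ℝ} (hρ : 0 < ρ) (θ : ℝ) :
    Filter.Tendsto (fun s : ℝ => x + ρ * Complex.exp (s * Complex.I)) (𝓝[>] θ)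
      (leftGerm (x + ρ * Complex.exp (θ * Complex.I)) (Complex.exp (θ * Complex.I))) := by
  refine Filter.tendsto_inf.2 ⟨?_, ?_⟩
  · have : Continuous fun s : ℝ => x + ρ * Complex.exp (s * Complex.I) := by fun_prop
    exact (this.tendsto θ).mono_left nhdsWithin_le_nhds
  · rw [Filter.tendsto_principal]
    filter_upwards [self_mem_nhdsWithin,
      nhdsWithin_le_nhds (gt_mem_nhds (show θ < θ + Real.pi by linarith [Real.pi_pos]))] with s h1 h2
    rw [circle_sub_im]
    exact mul_pos hρ (Real.sin_pos_of_pos_of_lt_pi (sub_pos.2 h1) (by linarith))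

theorem tendsto_leftGerm_circle_left (x : ℂ) {ρ : ℝ} (hρ : 0 < ρ) (θ : ℝ) :
    Filter.Tendsto (fun s : ℝ => x + ρ * Complex.exp (s * Complex.I)) (𝓝[<] θ)
      (leftGerm (x + ρ * Complex.exp (θ * Complex.I)) (-Complex.exp (θ * Complex.I))) := by
  refine Filter.tendsto_inf.2 ⟨?_, ?_⟩
  · have : Continuous fun s : ℝ => x + ρ * Complex.exp (s * Complex.I) := by fun_prop
    exact (this.tendsto θ).mono_left nhdsWithin_le_nhds
  · rw [Filter.tendsto_principal]
    filter_upwards [self_mem_nhdsWithin,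
      nhdsWithin_le_nhds (lt_mem_nhds (show θ - Real.pi < θ by linarith [Real.pi_pos]))] with s h1 h2
    rw [map_neg, neg_mul, Complex.neg_im, circle_sub_im, ← mul_neg, ← Real.sin_neg]
    exact mul_pos hρ (Real.sin_pos_of_pos_of_lt_pi (by linarith [mem_Iio.1 h1]) (by linarith))

/-- The set `F` is, close to the point `x`, a union of sectors bounded by the rays from `x` in the
directions `dir h`, where the propositions `L h` and `R h` say whether the sectors to the left and
to the right of such a ray belong to `F`. -/
structure SectorSystem {κ : Type*} (x : ℂ) (H : Finset κ) (dir : κ → ℂ) (F : Set ℂ)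
    (L R : κ → Prop) : Prop where
  ne_zero : ∀ h ∈ H, dir h ≠ 0
  inj : ∀ h ∈ H, ∀ h' ∈ H, ∀ c : ℝ, 0 < c → dir h = c * dir h' → h = h'
  locally_const : ∀ᶠ z in 𝓝 x, z ≠ x → (∀ h ∈ H, ∀ t : ℝ, 0 < t → z ≠ x + t * dir h) →
    ∀ᶠ w in 𝓝 z, (w ∈ F ↔ z ∈ F)
  left : ∀ h ∈ H, ∀ᶠ t : ℝ in 𝓝[>] 0, ∀ᶠ w in leftGerm (x + t * dir h) (dir h), (w ∈ F ↔ L h)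
  right : ∀ h ∈ H, ∀ᶠ t : ℝ in 𝓝[>] 0, ∀ᶠ w in leftGerm (x + t * dir h) (-dir h), (w ∈ F ↔ R h)

/-! ### Counting the sectors at a point along a small circle. -/

namespace SectorSystem

variable {κ : Type*} {x : ℂ} {H : Finset κ} {dir : κ → ℂ} {F : Set ℂ} {L R : κ → Prop}

/-- `z` runs along a circle about `x` so small that membership in `F` can change only at the rays.
Crossing a ray counterclockwise leads from its right side to its left side. -/
theorem exists_circle (S : SectorSystem x H dir F L R) : ∃ z : ℝ → ℂ,
    (∀ θ, z (θ + 2 * Real.pi) = z θ) ∧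
    (∀ θ : ℝ, (∀ h ∈ H, Complex.exp (θ * Complex.I) ≠ dir h / ‖dir h‖) →
      ∀ᶠ s in 𝓝 θ, (z s ∈ F ↔ z θ ∈ F)) ∧
    (∀ h ∈ H, ∀ θ : ℝ, Complex.exp (θ * Complex.I) = dir h / ‖dir h‖ →
      (∀ᶠ s in 𝓝[>] θ, (z s ∈ F ↔ L h)) ∧ ∀ᶠ s in 𝓝[<] θ, (z s ∈ F ↔ R h)) := by
  have h1 : ∀ᶠ ρ : ℝ in 𝓝[>] 0, ∀ θ : ℝ,
      (x + ρ * Complex.exp (θ * Complex.I)) ≠ x →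
      (∀ h ∈ H, ∀ t : ℝ, 0 < t → x + ρ * Complex.exp (θ * Complex.I) ≠ x + t * dir h) →
      ∀ᶠ w in 𝓝 (x + ρ * Complex.exp (θ * Complex.I)),
        (w ∈ F ↔ x + ρ * Complex.exp (θ * Complex.I) ∈ F) := by
    obtain ⟨r, hr, hr'⟩ := Metric.eventually_nhds_iff.1 S.locally_const
    filter_upwards [self_mem_nhdsWithin, nhdsWithin_le_nhds (gt_mem_nhds hr)] with ρ h2 h3 θ
    refine hr' ?_
    rw [dist_eq_norm, add_sub_cancel_left, norm_mul, Complex.norm_exp_ofReal_mul_I, mul_one,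
      Complex.norm_real, Real.norm_of_nonneg (le_of_lt h2)]
    exact h3
  -- The circle of radius `ρ` meets the ray of `h` at the parameter `ρ / ‖dir h‖`.
  have tends : ∀ h ∈ H, Filter.Tendsto (fun ρ : ℝ => ρ / ‖dir h‖) (𝓝[>] 0) (𝓝[>] 0) := by
    intro h hh
    have hpos : 0 < ‖dir h‖ := norm_pos_iff.2 (S.ne_zero h hh)
    refine tendsto_nhdsWithin_iff.2 ⟨?_, ?_⟩
    · have : Continuous fun ρ : ℝ => ρ / ‖dir h‖ := by fun_prop
      refine Filter.Tendsto.mono_left ?_ nhdsWithin_le_nhds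
      simpa using this.tendsto 0
    · filter_upwards [self_mem_nhdsWithin] with ρ hρ using div_pos hρ hpos
  have h2 : ∀ᶠ ρ : ℝ in 𝓝[>] 0, ∀ h ∈ H,
      (∀ᶠ w in leftGerm (x + (ρ / ‖dir h‖ : ℝ) * dir h) (dir h), (w ∈ F ↔ L h)) ∧
      ∀ᶠ w in leftGerm (x + (ρ / ‖dir h‖ : ℝ) * dir h) (-dir h), (w ∈ F ↔ R h) := by
    rw [Filter.eventually_all_finset]
    intro h hh
    exact ((tends h hh).eventually (S.left h hh)).and ((tends h hh).eventually (S.right h hh))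
  obtain ⟨ρ, h3, h4, hρ⟩ := (h1.and (h2.and self_mem_nhdsWithin)).exists
  have hρ : 0 < ρ := hρ
  have hρ0 : (ρ : ℂ) ≠ 0 := by exact_mod_cast hρ.ne'
  refine ⟨fun θ => x + ρ * Complex.exp (θ * Complex.I), ?_, ?_, ?_⟩
  · intro θ
    have : ((θ + 2 * Real.pi : ℝ) : ℂ) * Complex.I =
        θ * Complex.I + 2 * Real.pi * Complex.I := by push_cast; ring
    simp only [this, Complex.exp_periodic (θ * Complex.I)]
  · intro θ hθ
    have hcont : Continuous fun s : ℝ => x + ρ * Complex.exp (s * Complex.I) := by fun_prop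
    refine (hcont.tendsto θ).eventually (h3 θ ?_ ?_)
    · simp [hρ0, Complex.exp_ne_zero]
    · intro h hh t ht e
      refine hθ h hh ?_
      have e' : ρ * Complex.exp (θ * Complex.I) = t * dir h := add_left_cancel e
      have en : ρ = t * ‖dir h‖ := by
        have := congrArg norm e'
        rwa [norm_mul, norm_mul, Complex.norm_exp_ofReal_mul_I, mul_one, Complex.norm_real,
          Complex.norm_real, Real.norm_of_nonneg hρ.le, Real.norm_of_nonneg ht.le] at this
      have hn : (‖dir h‖ : ℂ) ≠ 0 := by exact_mod_cast norm_ne_zero_iff.2 (S.ne_zero h hh)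
      rw [eq_div_iff hn]
      apply mul_left_cancel₀ (show (t : ℂ) ≠ 0 by exact_mod_cast ht.ne')
      rw [← e', en]
      push_cast
      ring
  · intro h hh θ e
    have hpos : 0 < ‖dir h‖ := norm_pos_iff.2 (S.ne_zero h hh)
    have hn : (‖dir h‖ : ℂ) ≠ 0 := by exact_mod_cast hpos.ne'
    have e1 : dir h = (‖dir h‖ : ℝ) * Complex.exp (θ * Complex.I) := by
      rw [e, mul_div_cancel₀ _ hn]
    have e2 : x + (ρ / ‖dir h‖ : ℝ) * dir h = x + ρ * Complex.exp (θ * Complex.I) := by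
      rw [e]
      push_cast
      ring
    obtain ⟨h5, h6⟩ := h4 h hh
    rw [e2] at h5 h6
    constructor
    · refine (tendsto_leftGerm_circle_right x hρ θ).eventually (p := fun w => w ∈ F ↔ L h) ?_
      rwa [e1, leftGerm_ofReal_mul _ _ hpos] at h5
    · refine (tendsto_leftGerm_circle_left x hρ θ).eventually (p := fun w => w ∈ F ↔ R h) ?_
      rwa [e1, ← mul_neg, leftGerm_ofReal_mul _ _ hpos] at h6

theorem unit_inj (S : SectorSystem x H dir F L R) {h h' : κ} (hh : h ∈ H) (hh' : h' ∈ H)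
    (e : dir h / ‖dir h‖ = dir h' / ‖dir h'‖) : h = h' := by
  have h1 := norm_pos_iff.2 (S.ne_zero h hh)
  have h2 := norm_pos_iff.2 (S.ne_zero h' hh')
  refine S.inj h hh h' hh' (‖dir h‖ / ‖dir h'‖) (div_pos h1 h2) ?_
  have hn : (‖dir h‖ : ℂ) ≠ 0 := by exact_mod_cast h1.ne'
  have hn' : (‖dir h'‖ : ℂ) ≠ 0 := by exact_mod_cast h2.ne'
  rw [div_eq_iff hn] at e
  push_cast
  linear_combination e

theorem exp_arg_mul_I {d : ℂ} (hd : d ≠ 0) : Complex.exp (d.arg * Complex.I) = d / ‖d‖ := by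
  have hn : (‖d‖ : ℂ) ≠ 0 := by exact_mod_cast norm_ne_zero_iff.2 hd
  rw [eq_div_iff hn, mul_comm]
  exact Complex.norm_mul_exp_arg_mul_I d

theorem eq_of_exp_eq {a b : ℝ} (h : |a - b| < 2 * Real.pi)
    (e : Complex.exp (a * Complex.I) = Complex.exp (b * Complex.I)) : a = b := by
  obtain ⟨n, hn⟩ := Complex.exp_eq_exp_iff_exists_int.1 e
  have h1 : a = b + n * (2 * Real.pi) := by
    have := congrArg Complex.im hn
    simpa using this
  have hpi := Real.pi_pos
  rw [h1, add_sub_cancel_left, abs_mul, abs_of_pos (by positivity : 0 < 2 * Real.pi)] at h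
  have h2 : |(n : ℝ)| < 1 := by
    by_contra hc
    nlinarith [not_lt.1 hc]
  have h3 : n = 0 := by
    rw [← Int.abs_lt_one_iff]
    exact_mod_cast h2
  rw [h1, h3]
  simp

open Classical in
/-- As many sectors of `F` are to the left of their right-hand ray as are to the right of their
left-hand ray. -/
theorem sum_left_eq_sum_right (S : SectorSystem x H dir F L R) :
    ∑ h ∈ H, (if L h then (1 : ℂ) else 0) = ∑ h ∈ H, if R h then (1 : ℂ) else 0 := by
  obtain ⟨z, z0, z1, z2⟩ := S.exists_circle
  have hpi := Real.pi_pos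
  -- The circle is cut open at an angle `α` of no ray, and the angles of the rays are moved into the
  -- interval from `α` to `α + 2π`.
  obtain ⟨α, hα, hα'⟩ : ∃ α ∈ Ioo (-Real.pi) Real.pi, α ∉ H.image fun h => (dir h).arg :=
    (Ioo_infinite (by linarith)).exists_notMem_finset _
  set θ : κ → ℝ := fun h => if α < (dir h).arg then (dir h).arg else (dir h).arg + 2 * Real.pi
    with hθ
  have harg : ∀ h ∈ H, (dir h).arg ≠ α := fun h hh e =>
    hα' (Finset.mem_image.2 ⟨h, hh, e⟩)
  have θmem : ∀ h ∈ H, θ h ∈ Ioo α (α + 2 * Real.pi) := by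
    intro h hh
    rw [hθ]
    simp only
    split_ifs with h1
    · exact ⟨h1, by linarith [Complex.arg_le_pi (dir h), hα.1]⟩
    · have := lt_of_le_of_ne (not_lt.1 h1) (harg h hh)
      exact ⟨by linarith [Complex.neg_pi_lt_arg (dir h), hα.2], by linarith⟩
  have θexp : ∀ h ∈ H, Complex.exp (θ h * Complex.I) = dir h / ‖dir h‖ := by
    intro h hh
    rw [← exp_arg_mul_I (S.ne_zero h hh), hθ]
    simp only
    split_ifs with h1
    · rfl
    · have : (((dir h).arg + 2 * Real.pi : ℝ) : ℂ) * Complex.I =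
        (dir h).arg * Complex.I + 2 * Real.pi * Complex.I := by push_cast; ring
      rw [this, Complex.exp_periodic]
  have θinj : InjOn θ H := by
    intro h hh h' hh' e
    refine S.unit_inj hh hh' ?_
    rw [← θexp h hh, e, θexp h' hh']
  -- After a full turn the indicator function of `F` has its initial value, so its jumps add up to
  -- zero.
  have := sub_eq_sum_jumps (g := fun t => if z t ∈ F then (1 : ℂ) else 0)
    (l := fun h => if R h then (1 : ℂ) else 0) (r := fun h => if L h then (1 : ℂ) else 0) θinj
    (by linarith : α ≤ α + 2 * Real.pi) θmem ?_ ?_ ?_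
  · rw [z0, sub_self, Finset.sum_sub_distrib] at this
    exact (sub_eq_zero.1 this.symm)
  · intro t ht hne
    have h1 : ∀ h ∈ H, Complex.exp (t * Complex.I) ≠ dir h / ‖dir h‖ := by
      intro h hh e
      have := θmem h hh
      refine hne h hh (eq_of_exp_eq ?_ (by rw [θexp h hh, e]))
      rw [abs_lt]
      constructor <;> linarith [this.1, this.2, ht.1, ht.2]
    filter_upwards [z1 t h1] with s hs
    simp only [hs]
  · intro h hh
    filter_upwards [(z2 h hh _ (θexp h hh)).2] with s hs
    simp only [hs]
  · intro h hh
    filter_upwards [(z2 h hh _ (θexp h hh)).1] with s hs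
    simp only [hs]

/-- If there are only two rays, then the left side of one is the right side of the other. -/
theorem left_iff_right (S : SectorSystem x H dir F L R) {h h' : κ} (hh : h ∈ H) (hh' : h' ∈ H)
    (hne : h ≠ h') (hH : ∀ k ∈ H, k = h ∨ k = h') : L h ↔ R h' := by
  obtain ⟨z, z0, z1, z2⟩ := S.exists_circle
  have hpi := Real.pi_pos
  set α := (dir h).arg
  have hα : Complex.exp (α * Complex.I) = dir h / ‖dir h‖ := exp_arg_mul_I (S.ne_zero h hh)
  have hne' : Complex.exp ((dir h').arg * Complex.I) ≠ Complex.exp (α * Complex.I) := by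
    rw [exp_arg_mul_I (S.ne_zero h' hh'), hα]
    exact fun e => hne (S.unit_inj hh hh' e.symm)
  -- `β` is the angle of the other ray, taken in the turn after `α`. No ray is met between the two,
  -- so the left side of the first ray and the right side of the second are in the same sector.
  obtain ⟨β, hβ, hβ1⟩ : ∃ β ∈ Ioo α (α + 2 * Real.pi),
      Complex.exp (β * Complex.I) = dir h' / ‖dir h'‖ := by
    have h1 := Complex.arg_le_pi (dir h')
    have h2 := Complex.neg_pi_lt_arg (dir h')
    have h3 : α ≤ Real.pi := Complex.arg_le_pi (dir h)
    have h4 : -Real.pi < α := Complex.neg_pi_lt_arg (dir h)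
    rcases lt_trichotomy α (dir h').arg with h5 | h5 | h5
    · exact ⟨_, ⟨h5, by linarith⟩, exp_arg_mul_I (S.ne_zero h' hh')⟩
    · exact absurd (by rw [h5]) hne'
    · refine ⟨(dir h').arg + 2 * Real.pi, ⟨by linarith, by linarith⟩, ?_⟩
      have : (((dir h').arg + 2 * Real.pi : ℝ) : ℂ) * Complex.I =
        (dir h').arg * Complex.I + 2 * Real.pi * Complex.I := by push_cast; ring
      rw [this, Complex.exp_periodic, exp_arg_mul_I (S.ne_zero h' hh')]
  have hconst : ∀ s ∈ Ioo α β, ∀ t ∈ Ioo α β, (z s ∈ F) = (z t ∈ F) := by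
    intro s hs t ht
    refine isPreconnected_Ioo.eq_of_eventually_eq (f := fun s => z s ∈ F) ?_ hs ht
    intro θ hθ
    refine nhdsWithin_le_nhds ?_
    have h1 : ∀ k ∈ H, Complex.exp (θ * Complex.I) ≠ dir k / ‖dir k‖ := by
      intro k hk e
      rcases hH k hk with rfl | rfl
      · have := eq_of_exp_eq (a := θ) (b := α)
          (by rw [abs_lt]; constructor <;> linarith [hθ.1, hθ.2, hβ.2]) (by rw [e, hα])
        exact hθ.1.ne' this
      · have := eq_of_exp_eq (a := θ) (b := β)
          (by rw [abs_lt]; constructor <;> linarith [hθ.1, hθ.2, hβ.2]) (by rw [e, hβ1])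
        exact hθ.2.ne this
    filter_upwards [z1 θ h1] with w hw using propext hw
  obtain ⟨s, hs, hs'⟩ := ((z2 h hh α hα).1.and (Ioo_mem_nhdsGT hβ.1)).exists
  obtain ⟨t, ht, ht'⟩ := ((z2 h' hh' β hβ1).2.and (Ioo_mem_nhdsLT hβ.1)).exists
  rw [← hs, ← ht, hconst s hs' t ht']

end SectorSystem

/-! ### Plane arcs close to a point -/

theorem lineMap_eq_add (a b : ℂ) (s : ℝ) :
    (AffineMap.lineMap a b s : ℂ) = a + s * (b - a) := by
  simp [AffineMap.lineMap_apply, add_comm]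

/-- As `x` is not an inner point, it is either off the segment, which is closed, or one of its ends,
where the segment looks like a ray. -/
theorem eventually_mem_segment_iff {a b x : ℂ} (hab : a ≠ b)
    (hx : ∀ s ∈ Ioo (0 : ℝ) 1, (AffineMap.lineMap a b s : ℂ) ≠ x) :
    ∀ᶠ z in 𝓝 x, z ≠ x → ((∃ s ∈ Icc (0 : ℝ) 1, (AffineMap.lineMap a b s : ℂ) = z) ↔
      (a = x ∧ ∃ t : ℝ, 0 < t ∧ z = x + t * (b - a)) ∨
      (b = x ∧ ∃ t : ℝ, 0 < t ∧ z = x + t * (a - b))) := by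
  have hpos : 0 < ‖b - a‖ := norm_pos_iff.2 (sub_ne_zero.2 hab.symm)
  by_cases hxa : a = x
  · subst hxa
    filter_upwards [Metric.ball_mem_nhds a hpos] with z hz hza
    constructor
    · rintro ⟨s, hs, rfl⟩
      refine Or.inl ⟨rfl, s, lt_of_le_of_ne hs.1 fun e => hza ?_, lineMap_eq_add a b s⟩
      simp [← e]
    · rintro (⟨-, t, ht, rfl⟩ | ⟨e, -⟩)
      · refine ⟨t, ⟨ht.le, ?_⟩, lineMap_eq_add a b t⟩
        rw [Metric.mem_ball, dist_eq_norm, add_sub_cancel_left, norm_mul, Complex.norm_real,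
          Real.norm_of_nonneg ht.le] at hz
        by_contra hc
        nlinarith [not_le.1 hc]
      · exact absurd e.symm hab
  · by_cases hxb : b = x
    · subst hxb
      filter_upwards [Metric.ball_mem_nhds b hpos] with z hz hzb
      constructor
      · rintro ⟨s, hs, rfl⟩
        refine Or.inr ⟨rfl, 1 - s, sub_pos.2 (lt_of_le_of_ne hs.2 fun e => hzb ?_), ?_⟩
        · simp [e]
        · rw [lineMap_eq_add]
          push_cast
          ring
      · rintro (⟨e, -⟩ | ⟨-, t, ht, rfl⟩)
        · exact absurd e hab
        · refine ⟨1 - t, ⟨?_, by linarith⟩, ?_⟩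
          · rw [Metric.mem_ball, dist_eq_norm, add_sub_cancel_left, norm_mul, Complex.norm_real,
              Real.norm_of_nonneg ht.le, norm_sub_rev] at hz
            by_contra hc
            nlinarith [not_le.1 hc]
          · rw [lineMap_eq_add]
            push_cast
            ring
    · have hcl : IsClosed ((fun s : ℝ => (AffineMap.lineMap a b s : ℂ)) '' Icc 0 1) :=
        (isCompact_Icc.image AffineMap.lineMap_continuous).isClosed
      have hnot : x ∉ (fun s : ℝ => (AffineMap.lineMap a b s : ℂ)) '' Icc 0 1 := by
        rintro ⟨s, hs, e⟩
        rcases hs.1.lt_or_eq with h1 | h1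
        · rcases hs.2.lt_or_eq with h2 | h2
          · exact hx s ⟨h1, h2⟩ e
          · exact hxb (by simpa [h2] using e)
        · exact hxa (by simpa [← h1] using e)
      filter_upwards [hcl.isOpen_compl.mem_nhds hnot] with z hz _
      refine iff_of_false hz ?_
      rintro (⟨e, -⟩ | ⟨e, -⟩)
      · exact hxa e
      · exact hxb e

namespace IsArcParam

variable {A : Set ℂ} {u v : ℂ} {m : ℕ} {p : ℕ → ℂ}

/-- Close to a point which is not in the interior of a segment, an arc consists of rays. -/
theorem eventually_mem_iff (h : IsArcParam A u v m p) {x : ℂ}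
    (hx : ∀ k < m, ∀ s ∈ Ioo (0 : ℝ) 1, (AffineMap.lineMap (p k) (p (k + 1)) s : ℂ) ≠ x) :
    ∀ᶠ z in 𝓝 x, z ≠ x → (z ∈ A ↔ ∃ k < m,
      (p k = x ∧ ∃ t : ℝ, 0 < t ∧ z = x + t * (p (k + 1) - p k)) ∨
      (p (k + 1) = x ∧ ∃ t : ℝ, 0 < t ∧ z = x + t * (p k - p (k + 1)))) := by
  have : ∀ᶠ z in 𝓝 x, ∀ k ∈ Finset.range m, z ≠ x →
      ((∃ s ∈ Icc (0 : ℝ) 1, (AffineMap.lineMap (p k) (p (k + 1)) s : ℂ) = z) ↔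
      (p k = x ∧ ∃ t : ℝ, 0 < t ∧ z = x + t * (p (k + 1) - p k)) ∨
      (p (k + 1) = x ∧ ∃ t : ℝ, 0 < t ∧ z = x + t * (p k - p (k + 1)))) := by
    rw [Filter.eventually_all_finset]
    intro k hk
    have hk := Finset.mem_range.1 hk
    exact eventually_mem_segment_iff (h.ne_succ hk) (hx k hk)
  filter_upwards [this] with z hz hzx
  rw [h.mem_iff]
  refine exists_congr fun k => and_congr_right fun hk => hz k (Finset.mem_range.2 hk) hzx

/-- Close to a point in the interior of a segment, an arc is contained in a line. -/
theorem eventually_mem_line (h : IsArcParam A u v m p) {k : ℕ} (hk : k < m) {s : ℝ}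
    (hs : s ∈ Ioo (0 : ℝ) 1) : ∀ᶠ z in 𝓝 (AffineMap.lineMap (p k) (p (k + 1)) s : ℂ), z ∈ A →
      ((starRingEnd ℂ) (p (k + 1) - p k) *
        (z - AffineMap.lineMap (p k) (p (k + 1)) s)).im = 0 := by
  have : ∀ᶠ z in 𝓝 (AffineMap.lineMap (p k) (p (k + 1)) s : ℂ), ∀ l ∈ Finset.range m, l ≠ k →
      z ∉ (fun s : ℝ => (AffineMap.lineMap (p l) (p (l + 1)) s : ℂ)) '' Icc 0 1 := by
    rw [Filter.eventually_all_finset]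
    intro l hl
    by_cases hlk : l = k
    · exact Filter.Eventually.of_forall fun z hne => absurd hlk hne
    have hcl : IsClosed ((fun s : ℝ => (AffineMap.lineMap (p l) (p (l + 1)) s : ℂ)) '' Icc 0 1) :=
      (isCompact_Icc.image AffineMap.lineMap_continuous).isClosed
    refine Filter.mem_of_superset (hcl.isOpen_compl.mem_nhds ?_) fun z hz _ => hz
    rintro ⟨t, ht, e⟩
    exact hlk (h.index_unique hk (Finset.mem_range.1 hl) hs ht e.symm).1.symm
  filter_upwards [this] with z hz hzA
  obtain ⟨l, hl, t, ht, rfl⟩ := h.mem_iff.1 hzA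
  by_cases hlk : l = k
  · subst hlk
    rw [lineMap_eq_add, lineMap_eq_add]
    simp
    ring
  · exact absurd ⟨t, ht, rfl⟩ (hz l (Finset.mem_range.2 hl) hlk)

theorem breakpoint_ne (h : IsArcParam A u v m p) {l : ℕ} (hl : l ≤ m) {k : ℕ} (hk : k < m)
    {s : ℝ} (hs : s ∈ Ioo (0 : ℝ) 1) : (AffineMap.lineMap (p k) (p (k + 1)) s : ℂ) ≠ p l := by
  intro e
  rcases hl.lt_or_eq with h1 | h1
  · have := h.index_unique hk h1 hs (t := 0) (by simp) (by simpa using e)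
    linarith [hs.1, this.2]
  · refine (h.lineMap_mem_sdiff hk hs).2 ?_
    rw [e, h1, h.finish]
    exact Or.inr rfl

end IsArcParam

/-! ### Faces of plabic graphs -/

theorem isOpen_openRect : IsOpen openRect := by
  have h1 : Continuous fun z : ℂ => |z.re| := by fun_prop
  have h2 : Continuous fun z : ℂ => |z.im| := by fun_prop
  exact (isOpen_lt h1 continuous_const).inter (isOpen_lt h2 continuous_const)

theorem openRect_subset_rect : openRect ⊆ rect := fun _ hz => ⟨hz.1.le, hz.2.le⟩

namespace PlabicGraph

variable {n : ℕ} {Γ : PlabicGraph n}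

theorem finite_vertices : Γ.vertices.Finite :=
  (Γ.finite_left.union Γ.finite_right).union (Γ.finite_white.union Γ.finite_black)

theorem isClosed_edge {A : Set ℂ} (hA : A ∈ Γ.edges) : IsClosed A := by
  obtain ⟨u, -, v, -, h, -⟩ := Γ.edge_arc A hA
  exact h.isCompact.isClosed

theorem isClosed_graph : IsClosed (Γ.vertices ∪ ⋃₀ Γ.edges) := by
  refine finite_vertices.isClosed.union ?_
  rw [sUnion_eq_biUnion]
  exact Γ.finite_edges.isClosed_biUnion fun A hA => isClosed_edge hA

theorem eventually_mem_complement {z : ℂ} (h : z ∈ openRect) (h' : z ∈ Γ.complement) :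
    ∀ᶠ w in 𝓝 z, w ∈ Γ.complement := by
  filter_upwards [isOpen_openRect.mem_nhds h, isClosed_graph.isOpen_compl.mem_nhds h'.2] with w h1 h2
  exact ⟨openRect_subset_rect h1, h2⟩

theorem face_subset_complement (i : Γ.Face) : i.1 ⊆ Γ.complement := by
  obtain ⟨F, z, hz, rfl⟩ := i
  exact connectedComponentIn_subset _ _

theorem face_nonempty (i : Γ.Face) : i.1.Nonempty := by
  obtain ⟨F, z, hz, rfl⟩ := i
  exact ⟨z, mem_connectedComponentIn hz⟩

theorem face_eq_component (i : Γ.Face) {z : ℂ} (hz : z ∈ i.1) :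
    i.1 = connectedComponentIn Γ.complement z := by
  obtain ⟨F, w, hw, rfl⟩ := i
  exact connectedComponentIn_eq hz

theorem face_eq_of_mem {i j : Γ.Face} {z : ℂ} (hi : z ∈ i.1) (hj : z ∈ j.1) : i = j :=
  Subtype.ext ((face_eq_component i hi).trans (face_eq_component j hj).symm)

theorem subset_face {C : Set ℂ} (hC : IsPreconnected C) (hC' : C ⊆ Γ.complement) {i : Γ.Face}
    {z : ℂ} (hz : z ∈ C) (hi : z ∈ i.1) : C ⊆ i.1 := by
  rw [face_eq_component i hi]
  exact hC.subset_connectedComponentIn hz hC'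

theorem exists_face {z : ℂ} (hz : z ∈ Γ.complement) : ∃ i : Γ.Face, z ∈ i.1 :=
  ⟨⟨_, z, hz, rfl⟩, mem_connectedComponentIn hz⟩

theorem eventually_mem_face_iff (i : Γ.Face) {z : ℂ} (h : z ∈ openRect) (h' : z ∈ Γ.complement) :
    ∀ᶠ w in 𝓝 z, (w ∈ i.1 ↔ z ∈ i.1) := by
  obtain ⟨r, hr, hr'⟩ := Metric.eventually_nhds_iff_ball.1 (eventually_mem_complement h h')
  filter_upwards [Metric.ball_mem_nhds z hr] with w hw
  have hc : IsPreconnected (Metric.ball z r) := (convex_ball z r).isPreconnected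
  exact ⟨fun hwi => subset_face hc hr' hw hwi (Metric.mem_ball_self hr),
    fun hzi => subset_face hc hr' (Metric.mem_ball_self hr) hzi hw⟩

theorem face_eq_of_mem_filter {i j : Γ.Face} {f : Filter ℂ} [f.NeBot] (hi : i.1 ∈ f)
    (hj : j.1 ∈ f) : i = j := by
  obtain ⟨z, hz⟩ := Filter.nonempty_of_mem (Filter.inter_mem hi hj)
  exact face_eq_of_mem hz.1 hz.2

end PlabicGraph

namespace PlabicGraph

variable {n : ℕ} {Γ : PlabicGraph n}

/-! ### The two sides of an edge -/

/-- The point set of an edge determines its ends: its only vertices are its ends, and an arc with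
distinct ends is not a loop. -/
theorem ends_of_isArc {A : Set ℂ} (hA : A ∈ Γ.edges) {u v : ℂ} (hu : u ∈ Γ.vertices)
    (hv : v ∈ Γ.vertices) (h : IsArc A u v) :
    A \ {u, v} ⊆ openRect ∧ ∀ z ∈ A, z ∈ Γ.vertices → z = u ∨ z = v := by
  obtain ⟨u₀, hu₀, v₀, hv₀, h₀, hsub, hdis⟩ := Γ.edge_arc A hA
  have hmem : ∀ z ∈ A, z ∈ Γ.vertices → z = u₀ ∨ z = v₀ := by
    intro z hz hz'
    by_contra hc
    exact disjoint_left.1 hdis ⟨hz, hc⟩ hz'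
  have key : ({u₀, v₀} : Set ℂ) = {u, v} := by
    rcases hmem u h.left_mem hu with e1 | e1 <;> rcases hmem v h.right_mem hv with e2 | e2 <;>
      rw [e1, e2] at h ⊢
    · by_cases e : u₀ = v₀
      · rw [← e]
      · exact absurd h (h₀.not_loop e)
    · exact pair_comm _ _
    · by_cases e : v₀ = u₀
      · rw [← e]
      · exact absurd h (h₀.symm.not_loop e)
  rw [key] at hsub
  refine ⟨hsub, fun z hz hz' => ?_⟩
  have : z ∈ ({u₀, v₀} : Set ℂ) := hmem z hz hz'
  rwa [key] at this

theorem eventually_graph_of_mem_edge {A : Set ℂ} (hA : A ∈ Γ.edges) {u v : ℂ}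
    (hu : u ∈ Γ.vertices) (hv : v ∈ Γ.vertices) (h : IsArc A u v) {x : ℂ} (hx : x ∈ A \ {u, v}) :
    x ∈ openRect ∧ x ∉ Γ.vertices ∧
      ∀ᶠ z in 𝓝 x, z ∈ Γ.vertices ∪ ⋃₀ Γ.edges → z ∈ A := by
  have h1 := ends_of_isArc hA hu hv h
  have hxv : x ∉ Γ.vertices := fun hc => hx.2 (h1.2 x hx.1 hc)
  refine ⟨h1.1 hx, hxv, ?_⟩
  have : ∀ᶠ z in 𝓝 x, ∀ B ∈ Γ.finite_edges.toFinset, B ≠ A → z ∉ B := by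
    rw [Filter.eventually_all_finset]
    intro B hB
    have hB := Γ.finite_edges.mem_toFinset.1 hB
    by_cases e : B = A
    · exact Filter.Eventually.of_forall fun z hne => absurd e hne
    · refine Filter.mem_of_superset ((isClosed_edge hB).isOpen_compl.mem_nhds ?_) fun z hz _ => hz
      exact fun hxB => hxv (Γ.edge_inter B hB A hA e ⟨hxB, hx.1⟩)
  filter_upwards [this, finite_vertices.isClosed.isOpen_compl.mem_nhds hxv] with z hz hz'
  rintro (h2 | ⟨B, hB, h2⟩)
  · exact absurd h2 hz'
  · by_contra hc
    exact hz B (Γ.finite_edges.mem_toFinset.2 hB) (fun e => hc (e ▸ h2)) h2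

/-- Close to a point where the graph is contained in a line, there is a face on each side. -/
theorem exists_side {y d : ℂ} (hd : d ≠ 0) (hy : y ∈ openRect)
    (h : ∀ᶠ z in 𝓝 y, z ∈ Γ.vertices ∪ ⋃₀ Γ.edges → ((starRingEnd ℂ) d * (z - y)).im = 0) :
    ∃ i : Γ.Face, ∀ᶠ x in 𝓝 y, ((starRingEnd ℂ) d * (x - y)).im = 0 → i.1 ∈ leftGerm x d := by
  obtain ⟨r, hr, hr'⟩ := Metric.eventually_nhds_iff_ball.1 (h.and (isOpen_openRect.mem_nhds hy))
  -- This half-disc is convex and misses the graph, so it lies in one face. It is also a one-sided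
  -- neighbourhood of the other points `x` on its diameter.
  set C : Set ℂ := Metric.ball y r ∩ {z | 0 < ((starRingEnd ℂ) d * (z - y)).im} with hC
  have hCc : C ⊆ Γ.complement := by
    rintro z ⟨hz1, hz2⟩
    refine ⟨openRect_subset_rect (hr' z hz1).2, fun hz => ?_⟩
    exact hz2.ne' ((hr' z hz1).1 hz)
  have hCg : C ∈ leftGerm y d :=
    Filter.inter_mem (Filter.mem_inf_of_left (Metric.ball_mem_nhds y hr))
      (Filter.mem_inf_of_right (Filter.mem_principal_self _))
  have hCp : IsPreconnected C := by
    refine ((convex_ball y r).inter ?_).isPreconnected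
    intro z hz w hw a b ha hb hab
    have e : (starRingEnd ℂ) d * (a • z + b • w - y) =
        a • ((starRingEnd ℂ) d * (z - y)) + b • ((starRingEnd ℂ) d * (w - y)) := by
      have : (y : ℂ) = (a + b) • y := by rw [hab, one_smul]
      simp only [Complex.real_smul, add_smul] at this ⊢
      linear_combination -(starRingEnd ℂ) d * this
    change 0 < ((starRingEnd ℂ) d * (a • z + b • w - y)).im
    rw [e]
    exact (convex_halfSpace_im_gt 0) hz hw ha hb hab
  have := leftGerm_neBot y hd
  obtain ⟨z, hz⟩ := Filter.nonempty_of_mem hCg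
  obtain ⟨i, hi⟩ := exists_face (hCc hz)
  have hCi := subset_face hCp hCc hz hi
  refine ⟨i, ?_⟩
  filter_upwards [Metric.ball_mem_nhds y hr] with x hx hxd
  rw [mem_leftGerm_iff]
  filter_upwards [Metric.isOpen_ball.mem_nhds hx] with w hw hw'
  refine hCi ⟨hw, ?_⟩
  have e : (starRingEnd ℂ) d * (w - y) =
    (starRingEnd ℂ) d * (w - x) + (starRingEnd ℂ) d * (x - y) := by ring
  change 0 < ((starRingEnd ℂ) d * (w - y)).im
  rw [e, Complex.add_im, hxd, add_zero]
  exact hw'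

/-- Faces are disjoint, so next to a ray a point belongs to the face `i` exactly if `i` is the face
on that side. -/
theorem sectorSystem {κ : Type*} {x : ℂ} (hx : x ∈ openRect) {H : Finset κ} {dir : κ → ℂ}
    (ne_zero : ∀ h ∈ H, dir h ≠ 0)
    (inj : ∀ h ∈ H, ∀ h' ∈ H, ∀ c : ℝ, 0 < c → dir h = c * dir h' → h = h')
    (hg : ∀ᶠ z in 𝓝 x, z ≠ x → z ∈ Γ.vertices ∪ ⋃₀ Γ.edges →
      ∃ h ∈ H, ∃ t : ℝ, 0 < t ∧ z = x + t * dir h)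
    {L R : κ → Γ.Face}
    (hL : ∀ h ∈ H, ∀ᶠ t : ℝ in 𝓝[>] 0, (L h).1 ∈ leftGerm (x + t * dir h) (dir h))
    (hR : ∀ h ∈ H, ∀ᶠ t : ℝ in 𝓝[>] 0, (R h).1 ∈ leftGerm (x + t * dir h) (-dir h))
    (i : Γ.Face) : SectorSystem x H dir i.1 (fun h => L h = i) (fun h => R h = i) where
  ne_zero := ne_zero
  inj := inj
  locally_const := by
    filter_upwards [hg, isOpen_openRect.mem_nhds hx] with z hz hzo hzx hzr
    refine eventually_mem_face_iff i hzo ⟨openRect_subset_rect hzo, fun hc => ?_⟩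
    obtain ⟨h, hh, t, ht, e⟩ := hz hzx hc
    exact hzr h hh t ht e
  left h hh := by
    filter_upwards [hL h hh] with t ht
    filter_upwards [ht] with w hw
    exact ⟨fun hi => face_eq_of_mem hw hi, fun e => e ▸ hw⟩
  right h hh := by
    filter_upwards [hR h hh] with t ht
    filter_upwards [ht] with w hw
    exact ⟨fun hi => face_eq_of_mem hw hi, fun e => e ▸ hw⟩

theorem eventually_graph_line {A : Set ℂ} (hA : A ∈ Γ.edges) {u v : ℂ} (hu : u ∈ Γ.vertices)
    (hv : v ∈ Γ.vertices) {m : ℕ} {p : ℕ → ℂ} (h : IsArcParam A u v m p) {k : ℕ} (hk : k < m)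
    {s : ℝ} (hs : s ∈ Ioo (0 : ℝ) 1) :
    ∀ᶠ z in 𝓝 (AffineMap.lineMap (p k) (p (k + 1)) s : ℂ), z ∈ Γ.vertices ∪ ⋃₀ Γ.edges →
      ((starRingEnd ℂ) (p (k + 1) - p k) *
        (z - AffineMap.lineMap (p k) (p (k + 1)) s)).im = 0 := by
  filter_upwards [h.eventually_mem_line hk hs,
    (eventually_graph_of_mem_edge hA hu hv ⟨m, p, h⟩ (h.lineMap_mem_sdiff hk hs)).2.2] with z h1 h2
  exact fun hz => h1 (h2 hz)

/-- The face on one side is locally constant along the open segment, which is connected. The factor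
`c` selects the side: it is applied with `c = 1` for the left and `c = -1` for the right. -/
theorem exists_segment_side {a d : ℂ} {c : ℝ} (hc : c ≠ 0) (hd : d ≠ 0)
    (hy : ∀ s ∈ Ioo (0 : ℝ) 1, a + s * d ∈ openRect)
    (h : ∀ s ∈ Ioo (0 : ℝ) 1, ∀ᶠ z in 𝓝 (a + s * d), z ∈ Γ.vertices ∪ ⋃₀ Γ.edges →
      ((starRingEnd ℂ) d * (z - (a + s * d))).im = 0) :
    ∃ i : Γ.Face, ∀ s ∈ Ioo (0 : ℝ) 1, i.1 ∈ leftGerm (a + s * d) (c * d) := by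
  have hcd : (c : ℂ) * d ≠ 0 := mul_ne_zero (by exact_mod_cast hc) hd
  have him : ∀ w : ℂ, ((starRingEnd ℂ) (c * d) * w).im = c * ((starRingEnd ℂ) d * w).im := by
    intro w
    simp
    ring
  have h1 : ∀ s ∈ Ioo (0 : ℝ) 1, ∃ i : Γ.Face, ∀ᶠ t : ℝ in 𝓝 s,
      i.1 ∈ leftGerm (a + t * d) (c * d) := by
    intro s hs
    obtain ⟨i, hi⟩ := exists_side hcd (hy s hs) (by
      filter_upwards [h s hs] with z hz hz'
      rw [him, hz hz', mul_zero])
    refine ⟨i, ?_⟩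
    have hcont : Continuous fun t : ℝ => a + t * d := by fun_prop
    filter_upwards [(hcont.tendsto s).eventually hi] with t ht
    refine ht ?_
    rw [him, add_sub_add_left_eq_sub, ← sub_mul]
    simp
    ring_nf
    simp
  have : Nonempty Γ.Face := (h1 (1 / 2) (by norm_num)).nonempty
  choose! f hf using h1
  refine ⟨f (1 / 2), fun s hs => ?_⟩
  have hs2 : (1 / 2 : ℝ) ∈ Ioo (0 : ℝ) 1 := by norm_num
  have : f (1 / 2) = f s := by
    refine isPreconnected_Ioo.eq_of_eventually_eq (f := f) (fun t ht => ?_) hs2 hs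
    rw [eventually_nhdsWithin_iff]
    filter_upwards [hf t ht] with t' h2 h3
    have := leftGerm_neBot (a + t' * d) hcd
    exact face_eq_of_mem_filter (hf t' h3).self_of_nhds h2
  rw [this]
  exact (hf s hs).self_of_nhds

theorem eventually_Ioo_zero_one : ∀ᶠ t : ℝ in 𝓝[>] 0, t ∈ Ioo (0 : ℝ) 1 :=
  Ioo_mem_nhdsGT one_pos

/-- Along an edge, there is always the same face on the left and the same face on the right. -/
theorem exists_edge_sides {A : Set ℂ} (hA : A ∈ Γ.edges) {u v : ℂ} (hu : u ∈ Γ.vertices)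
    (hv : v ∈ Γ.vertices) {m : ℕ} {p : ℕ → ℂ} (h : IsArcParam A u v m p) :
    ∃ i j : Γ.Face, ∀ k < m, ∀ s ∈ Ioo (0 : ℝ) 1,
      i.1 ∈ leftGerm (AffineMap.lineMap (p k) (p (k + 1)) s) (p (k + 1) - p k) ∧
      j.1 ∈ leftGerm (AffineMap.lineMap (p k) (p (k + 1)) s) (-(p (k + 1) - p k)) := by
  have hne : ∀ k < m, p (k + 1) - p k ≠ 0 := fun k hk => sub_ne_zero.2 (h.ne_succ hk).symm
  have h1 : ∀ k < m, ∃ i : Γ.Face, ∀ s ∈ Ioo (0 : ℝ) 1,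
      i.1 ∈ leftGerm (p k + s * (p (k + 1) - p k)) (p (k + 1) - p k) := by
    intro k hk
    have := exists_segment_side (Γ := Γ) (a := p k) one_ne_zero (hne k hk) ?_ ?_
    · simpa using this
    · intro s hs
      rw [← lineMap_eq_add]
      exact (eventually_graph_of_mem_edge hA hu hv ⟨m, p, h⟩ (h.lineMap_mem_sdiff hk hs)).1
    · intro s hs
      rw [← lineMap_eq_add]
      exact eventually_graph_line hA hu hv h hk hs
  have h2 : ∀ k < m, ∃ i : Γ.Face, ∀ s ∈ Ioo (0 : ℝ) 1,
      i.1 ∈ leftGerm (p k + s * (p (k + 1) - p k)) (-(p (k + 1) - p k)) := by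
    intro k hk
    have := exists_segment_side (Γ := Γ) (a := p k) (neg_ne_zero.2 one_ne_zero) (hne k hk) ?_ ?_
    · simpa using this
    · intro s hs
      rw [← lineMap_eq_add]
      exact (eventually_graph_of_mem_edge hA hu hv ⟨m, p, h⟩ (h.lineMap_mem_sdiff hk hs)).1
    · intro s hs
      rw [← lineMap_eq_add]
      exact eventually_graph_line hA hu hv h hk hs
  have : Nonempty Γ.Face := (h1 0 h.pos).nonempty
  choose! i hi using h1
  choose! j hj using h2
  -- At an inner break point the graph consists of two rays, so `left_iff_right` compares the sides
  -- of consecutive segments. The ray `true` is the next segment; `false` is the previous one run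
  -- backwards, which interchanges its sides.
  have step : ∀ k, k + 1 < m → i (k + 1) = i k ∧ j (k + 1) = j k := by
    intro k hk
    have hk' : k < m := (Nat.lt_succ_self k).trans hk
    have hxm := h.breakpoint_mem_sdiff (Nat.succ_pos k) hk
    obtain ⟨hxo, hxv, hxg⟩ := eventually_graph_of_mem_edge hA hu hv ⟨m, p, h⟩ hxm
    set dir : Bool → ℂ := fun b => bif b then p (k + 2) - p (k + 1) else p k - p (k + 1) with hdir
    have S := sectorSystem hxo (H := Finset.univ) (dir := dir)
      (L := fun b => bif b then i (k + 1) else j k) (R := fun b => bif b then j (k + 1) else i k)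
      ?_ ?_ ?_ ?_ ?_
    · have e1 := (S (i k)).left_iff_right (h := true) (h' := false) (Finset.mem_univ _)
        (Finset.mem_univ _) (by simp) (by simp)
      have e2 := (S (j k)).left_iff_right (h := false) (h' := true) (Finset.mem_univ _)
        (Finset.mem_univ _) (by simp) (by simp)
      simp only [cond_true, cond_false, iff_true, true_iff] at e1 e2
      exact ⟨e1, e2⟩
    · rintro (_ | _) -
      · exact sub_ne_zero.2 (h.ne_succ hk')
      · exact hne (k + 1) hk
    · have key : ∀ c : ℝ, 0 < c → p (k + 2) - p (k + 1) = c * (p k - p (k + 1)) → False := by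
        intro c hc e
        -- If the two rays agreed, the segments would overlap near the break point. This `ε` is
        -- small enough for both `ε` and `1 - ε * c` to be parameters inside the segments.
        set ε : ℝ := 1 / (c + 1) / 2 with hε
        have hc1 : (0 : ℝ) < c + 1 := by linarith
        have hε0 : 0 < ε := by positivity
        have hε1 : ε * (c + 1) = 1 / 2 := by
          rw [hε]
          field_simp
        have := h.index_unique hk hk' (s := ε) (t := 1 - ε * c) ⟨hε0, by nlinarith⟩
          ⟨by nlinarith, by nlinarith⟩ (by
            rw [lineMap_eq_add, lineMap_eq_add, e]
            push_cast
            ring)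
        omega
      rintro (_ | _) - (_ | _) - c hc e
      · rfl
      · refine absurd ?_ (key c⁻¹ (inv_pos.2 hc))
        simp only [hdir, cond_true, cond_false] at e
        rw [e]
        push_cast
        rw [inv_mul_cancel_left₀ (by exact_mod_cast hc.ne')]
      · exact absurd e (key c hc)
      · rfl
    · filter_upwards [hxg, h.eventually_mem_iff (x := p (k + 1)) fun l hl s hs =>
        h.breakpoint_ne hk.le hl hs] with z hz1 hz2 hzx hz3
      obtain ⟨l, hl, ⟨e, t, ht, ht'⟩ | ⟨e, t, ht, ht'⟩⟩ := (hz2 hzx).1 (hz1 hz3)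
      · have hlk : l = k + 1 := by
          by_contra hc
          rcases Nat.lt_or_ge l (k + 1) with h5 | h5
          all_goals
            have := h.injOn_left (x₁ := l) (x₂ := (k + 1 : ℕ))
              ⟨Nat.cast_nonneg _, by exact_mod_cast hl⟩ ⟨Nat.cast_nonneg _, by exact_mod_cast hk⟩
              (by rw [polyLine_natCast, polyLine_natCast, e])
            exact hc (by exact_mod_cast this)
        subst hlk
        exact ⟨true, Finset.mem_univ _, t, ht, ht'⟩
      · have hlk : l = k := by
          have := h.injOn_right (x₁ := (l + 1 : ℕ)) (x₂ := (k + 1 : ℕ))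
            ⟨by positivity, by exact_mod_cast hl⟩ ⟨by positivity, by exact_mod_cast hk.le⟩
            (by rw [polyLine_natCast, polyLine_natCast, e])
          have : l + 1 = k + 1 := by exact_mod_cast this
          omega
        subst hlk
        exact ⟨false, Finset.mem_univ _, t, ht, ht'⟩
    · rintro (_ | _) -
      · filter_upwards [eventually_Ioo_zero_one] with t ht
        have := hj k hk' (1 - t) ⟨by linarith [ht.2], by linarith [ht.1]⟩
        simp only [hdir, cond_false]
        convert this using 2
        · push_cast
          ring
        · ring
      · filter_upwards [eventually_Ioo_zero_one] with t ht
        exact hi (k + 1) hk t ht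
    · rintro (_ | _) -
      · filter_upwards [eventually_Ioo_zero_one] with t ht
        have := hi k hk' (1 - t) ⟨by linarith [ht.2], by linarith [ht.1]⟩
        simp only [hdir, cond_false]
        convert this using 2
        · push_cast
          ring
        · ring
      · filter_upwards [eventually_Ioo_zero_one] with t ht
        exact hj (k + 1) hk t ht
  have hconst : ∀ k < m, i k = i 0 ∧ j k = j 0 := by
    intro k
    induction k with
    | zero => exact fun _ => ⟨rfl, rfl⟩
    | succ k ih =>
      intro hk
      have h3 := ih (by omega)
      have h4 := step k hk
      exact ⟨h4.1.trans h3.1, h4.2.trans h3.2⟩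
  refine ⟨i 0, j 0, fun k hk s hs => ?_⟩
  rw [← (hconst k hk).1, ← (hconst k hk).2, lineMap_eq_add]
  exact ⟨hi k hk s hs, hj k hk s hs⟩

/-- The two sides of an edge do not depend on its parametrization. -/
theorem liesLeft_iff {A : Set ℂ} (hA : A ∈ Γ.edges) {u v : ℂ} (hu : u ∈ Γ.vertices)
    (hv : v ∈ Γ.vertices) (huv : u ≠ v) {m : ℕ} {p : ℕ → ℂ} (h : IsArcParam A u v m p)
    {i j : Γ.Face} (hij : ∀ k < m, ∀ s ∈ Ioo (0 : ℝ) 1,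
      i.1 ∈ leftGerm (AffineMap.lineMap (p k) (p (k + 1)) s) (p (k + 1) - p k) ∧
      j.1 ∈ leftGerm (AffineMap.lineMap (p k) (p (k + 1)) s) (-(p (k + 1) - p k)))
    (f : Γ.Face) : (LiesLeft A u v f.1 ↔ f = i) ∧ (LiesRight A u v f.1 ↔ f = j) := by
  have hd : p 1 - p 0 ≠ 0 := sub_ne_zero.2 (h.ne_succ h.pos).symm
  have hhalf : (1 / 2 : ℝ) ∈ Ioo (0 : ℝ) 1 := by norm_num
  have key : ∀ m' p' (h' : IsArcParam A u v m' p'), ∀ k < m', ∀ s ∈ Ioo (0 : ℝ) 1,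
      i.1 ∈ leftGerm (AffineMap.lineMap (p' k) (p' (k + 1)) s) (p' (k + 1) - p' k) ∧
      j.1 ∈ leftGerm (AffineMap.lineMap (p' k) (p' (k + 1)) s) (-(p' (k + 1) - p' k)) := by
    intro m' p' h'
    obtain ⟨i', j', hij'⟩ := exists_edge_sides hA hu hv h'
    suffices e : i = i' ∧ j = j' by
      rw [e.1, e.2]
      exact hij'
    have h1 := h'.eventually_mem_iff (x := p' 0) fun l hl s hs =>
      h'.breakpoint_ne (Nat.zero_le _) hl hs
    rw [h'.start] at h1
    have hcont : Continuous fun t : ℝ => u + t * (p 1 - p 0) := by fun_prop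
    have h2 := (hcont.tendsto 0)
    simp only [Complex.ofReal_zero, zero_mul, add_zero] at h2
    have small : ∀ c : ℝ, 0 < c → ∀ᶠ t : ℝ in 𝓝[>] 0, t * c < 1 := by
      intro c hc
      have hcc : Continuous fun t : ℝ => t * c := by fun_prop
      have := hcc.tendsto 0
      rw [zero_mul] at this
      exact nhdsWithin_le_nhds (this.eventually (gt_mem_nhds one_pos))
    -- Since `u ≠ v`, only the first segment of either parametrization comes near `u`; both trace
    -- the same ray there.
    have h3 : ∃ c : ℝ, 0 < c ∧ p 1 - p 0 = c * (p' 1 - p' 0) := by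
      obtain ⟨t, ht1, ht2⟩ :=
        (((h2.mono_left (nhdsWithin_le_nhds (s := Ioi 0))).eventually h1).and
          eventually_Ioo_zero_one).exists
      have htne : (t : ℂ) ≠ 0 := by exact_mod_cast ht2.1.ne'
      have hmem : u + t * (p 1 - p 0) ∈ A := h.mem_iff.2
        ⟨0, h.pos, t, ⟨ht2.1.le, ht2.2.le⟩, by rw [lineMap_eq_add, h.start]⟩
      obtain ⟨k, hk, ⟨e, s, hs, e'⟩ | ⟨e, -⟩⟩ := (ht1 (by simp [htne, hd])).1 hmem
      · have hk0 : k = 0 := by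
          by_contra hc
          exact (h'.breakpoint_mem_sdiff (Nat.pos_of_ne_zero hc) hk).2 (Or.inl e)
        subst hk0
        refine ⟨s / t, div_pos hs ht2.1, ?_⟩
        have := add_left_cancel e'
        push_cast
        rw [div_mul_eq_mul_div, eq_div_iff htne, mul_comm]
        exact this
      · rcases (Nat.succ_le_of_lt hk).lt_or_eq with h5 | h5
        · exact absurd (Or.inl e) (h'.breakpoint_mem_sdiff (Nat.succ_pos k) h5).2
        · exact absurd (by rw [← e, ← h'.finish, ← h5]) huv
    obtain ⟨c, hc, e⟩ := h3
    obtain ⟨t, ht1, ht2⟩ := ((small c hc).and eventually_Ioo_zero_one).exists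
    have h4 := hij 0 h.pos t ht2
    have h5 := hij' 0 h'.pos (t * c) ⟨mul_pos ht2.1 hc, ht1⟩
    have e1 : (AffineMap.lineMap (p 0) (p (0 + 1)) t : ℂ) =
        AffineMap.lineMap (p' 0) (p' (0 + 1)) (t * c) := by
      rw [lineMap_eq_add, lineMap_eq_add, zero_add, e, h.start, h'.start]
      push_cast
      ring
    rw [e1, zero_add, e, ← mul_neg, leftGerm_ofReal_mul _ _ hc, leftGerm_ofReal_mul _ _ hc] at h4
    rw [zero_add] at h5
    have hd' : p' 1 - p' 0 ≠ 0 := sub_ne_zero.2 (h'.ne_succ h'.pos).symm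
    have := leftGerm_neBot (AffineMap.lineMap (p' 0) (p' 1) (t * c) : ℂ) hd'
    have := leftGerm_neBot (AffineMap.lineMap (p' 0) (p' 1) (t * c) : ℂ) (neg_ne_zero.2 hd')
    exact ⟨face_eq_of_mem_filter h4.1 h5.1, face_eq_of_mem_filter h4.2 h5.2⟩
  constructor
  · constructor
    · rintro ⟨m', p', h', k, hk, s, hs, hev⟩
      have hd' : p' (k + 1) - p' k ≠ 0 := sub_ne_zero.2 (h'.ne_succ hk).symm
      have h1 := (tendsto_leftGerm_normal _ hd').eventually_mem (key m' p' h' k hk s hs).1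
      obtain ⟨ε, h2, h3⟩ := (hev.and h1).exists
      exact face_eq_of_mem h2 h3
    · rintro rfl
      exact ⟨m, p, h, 0, h.pos, 1 / 2, hhalf,
        (tendsto_leftGerm_normal _ hd).eventually_mem (hij 0 h.pos _ hhalf).1⟩
  · constructor
    · rintro ⟨m', p', h', k, hk, s, hs, hev⟩
      have hd' : -(p' (k + 1) - p' k) ≠ 0 := neg_ne_zero.2 (sub_ne_zero.2 (h'.ne_succ hk).symm)
      have h1 := (tendsto_leftGerm_normal _ hd').eventually_mem (key m' p' h' k hk s hs).2
      obtain ⟨ε, h2, h3⟩ := (hev.and h1).exists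
      rw [mul_neg, mul_neg, ← sub_eq_add_neg] at h3
      exact face_eq_of_mem h2 h3
    · rintro rfl
      refine ⟨m, p, h, 0, h.pos, 1 / 2, hhalf, ?_⟩
      have := (tendsto_leftGerm_normal _ (neg_ne_zero.2 hd)).eventually_mem (hij 0 h.pos _ hhalf).2
      simpa only [mul_neg, ← sub_eq_add_neg] using this

end PlabicGraph

namespace PlabicGraph

variable {n : ℕ} {Γ : PlabicGraph n}

/-! ### Parametrizations of all edges, and counting around vertices -/

/-- Parametrizations of all edges, and the faces on the two sides of each edge. -/
structure EdgeParams (Γ : PlabicGraph n) where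
  /-- number of segments -/
  m : Γ.edges → ℕ
  /-- break points -/
  p : Γ.edges → ℕ → ℂ
  /-- face on the left -/
  left : Γ.edges → Γ.Face
  /-- face on the right -/
  right : Γ.edges → Γ.Face
  start_mem : ∀ A, p A 0 ∈ Γ.vertices
  finish_mem : ∀ A, p A (m A) ∈ Γ.vertices
  isArcParam : ∀ A : Γ.edges, IsArcParam A (p A 0) (p A (m A)) (m A) (p A)
  sides : ∀ A, ∀ k < m A, ∀ s ∈ Ioo (0 : ℝ) 1,
    (left A).1 ∈ leftGerm (AffineMap.lineMap (p A k) (p A (k + 1)) s) (p A (k + 1) - p A k) ∧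
    (right A).1 ∈ leftGerm (AffineMap.lineMap (p A k) (p A (k + 1)) s) (-(p A (k + 1) - p A k))

theorem nonempty_edgeParams : Nonempty (EdgeParams Γ) := by
  have h1 : ∀ A : Γ.edges, ∃ (m : ℕ) (p : ℕ → ℂ), p 0 ∈ Γ.vertices ∧ p m ∈ Γ.vertices ∧
      IsArcParam A (p 0) (p m) m p := by
    rintro ⟨A, hA⟩
    obtain ⟨u, hu, v, hv, ⟨m, p, h⟩, -⟩ := Γ.edge_arc A hA
    refine ⟨m, p, ?_, ?_, ?_⟩
    · rw [h.start]; exact hu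
    · rw [h.finish]; exact hv
    · rw [h.start, h.finish]; exact h
  choose m p h2 h3 h4 using h1
  choose i j h5 using fun A : Γ.edges => exists_edge_sides A.2 (h2 A) (h3 A) (h4 A)
  exact ⟨⟨m, p, i, j, h2, h3, h4, h5⟩⟩

namespace EdgeParams

variable (E : EdgeParams Γ)

/-- The oriented segments of the graph. -/
abbrev Seg : Type := Σ A : Γ.edges, Fin (E.m A) × Bool

/-- The initial point of an oriented segment. -/
def src (h : E.Seg) : ℂ := bif h.2.2 then E.p h.1 h.2.1 else E.p h.1 (h.2.1 + 1)

/-- The final point of an oriented segment. -/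
def tgt (h : E.Seg) : ℂ := bif h.2.2 then E.p h.1 (h.2.1 + 1) else E.p h.1 h.2.1

/-- The face to the left of an oriented segment. -/
def segLeft (h : E.Seg) : Γ.Face := bif h.2.2 then E.left h.1 else E.right h.1

/-- The face to the right of an oriented segment. -/
def segRight (h : E.Seg) : Γ.Face := bif h.2.2 then E.right h.1 else E.left h.1

theorem src_ne_tgt (h : E.Seg) : E.src h ≠ E.tgt h := by
  obtain ⟨A, k, _ | _⟩ := h
  · exact ((E.isArcParam A).ne_succ k.2).symm
  · exact (E.isArcParam A).ne_succ k.2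

theorem notMem_vertices (A : Γ.edges) {k : ℕ} (hk : k < E.m A) {s : ℝ} (hs : s ∈ Ioo (0 : ℝ) 1) :
    (AffineMap.lineMap (E.p A k) (E.p A (k + 1)) s : ℂ) ∉ Γ.vertices :=
  (eventually_graph_of_mem_edge A.2 (E.start_mem A) (E.finish_mem A) ⟨_, _, E.isArcParam A⟩
    ((E.isArcParam A).lineMap_mem_sdiff hk hs)).2.1

theorem seg_point (h : E.Seg) {s : ℝ} (hs : s ∈ Ioo (0 : ℝ) 1) : ∃ t ∈ Ioo (0 : ℝ) 1,
    E.src h + s * (E.tgt h - E.src h) =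
      AffineMap.lineMap (E.p h.1 h.2.1) (E.p h.1 (h.2.1 + 1)) t := by
  obtain ⟨A, k, _ | _⟩ := h
  · refine ⟨1 - s, ⟨by linarith [hs.2], by linarith [hs.1]⟩, ?_⟩
    rw [lineMap_eq_add]
    simp only [src, tgt, cond_false]
    push_cast
    ring
  · exact ⟨s, hs, (lineMap_eq_add _ _ _).symm⟩

theorem seg_sides (h : E.Seg) {s : ℝ} (hs : s ∈ Ioo (0 : ℝ) 1) :
    (E.segLeft h).1 ∈ leftGerm (E.src h + s * (E.tgt h - E.src h)) (E.tgt h - E.src h) ∧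
    (E.segRight h).1 ∈ leftGerm (E.src h + s * (E.tgt h - E.src h)) (-(E.tgt h - E.src h)) := by
  obtain ⟨A, k, _ | _⟩ := h
  · have := E.sides A k k.2 (1 - s) ⟨by linarith [hs.2], by linarith [hs.1]⟩
    have e : (AffineMap.lineMap (E.p A k) (E.p A (k + 1)) (1 - s) : ℂ) =
        E.p A (k + 1) + s * (E.p A k - E.p A (k + 1)) := by
      rw [lineMap_eq_add]
      push_cast
      ring
    rw [e, neg_sub] at this
    simp only [src, tgt, segLeft, segRight, cond_false, neg_sub]
    exact this.symm
  · have := E.sides A k k.2 s hs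
    rw [lineMap_eq_add] at this
    exact this

/-- Oriented segments with the same source and direction overlap in a point which is no vertex, so
they belong to one edge, and injectivity of its parametrization identifies them. -/
theorem seg_inj {h h' : E.Seg} (hs : E.src h = E.src h') {c : ℝ} (hc : 0 < c)
    (e : E.tgt h - E.src h = c * (E.tgt h' - E.src h')) : h = h' := by
  set ε : ℝ := 1 / (c + 1) / 2 with hε
  have hc1 : (0 : ℝ) < c + 1 := by linarith
  have hε0 : 0 < ε := by positivity
  have hε1 : ε * (c + 1) = 1 / 2 := by
    rw [hε]
    field_simp
  obtain ⟨t, ht, h1⟩ := E.seg_point h (s := ε) ⟨hε0, by nlinarith⟩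
  obtain ⟨t', ht', h2⟩ := E.seg_point h' (s := ε * c) ⟨by positivity, by nlinarith⟩
  have h3 : E.src h + ε * (E.tgt h - E.src h) =
      E.src h' + (ε * c : ℝ) * (E.tgt h' - E.src h') := by
    rw [e, hs]
    push_cast
    ring
  rw [h1, h2] at h3
  obtain ⟨A, k, b⟩ := h
  obtain ⟨A', k', b'⟩ := h'
  have hA : A = A' := by
    by_contra hne
    refine E.notMem_vertices A k.2 ht (Γ.edge_inter A A.2 A' A'.2
      (fun e => hne (Subtype.ext e)) ⟨?_, ?_⟩)
    · exact ((E.isArcParam A).lineMap_mem_sdiff k.2 ht).1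
    · rw [h3]
      exact ((E.isArcParam A').lineMap_mem_sdiff k'.2 ht').1
  subst hA
  obtain ⟨hk, -⟩ := (E.isArcParam A).index_unique k.2 k'.2 ht ⟨ht'.1.le, ht'.2.le⟩ h3
  have hk := Fin.ext hk
  subst hk
  have hne := (E.isArcParam A).ne_succ k.2
  cases b <;> cases b'
  · rfl
  · exact absurd hs.symm hne
  · exact absurd hs hne
  · rfl

theorem eventually_graph {x : ℂ} (hx : x ∈ Γ.vertices) : ∀ᶠ z in 𝓝 x, z ≠ x →
    z ∈ Γ.vertices ∪ ⋃₀ Γ.edges →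
      ∃ h : E.Seg, E.src h = x ∧ ∃ t : ℝ, 0 < t ∧ z = x + t * (E.tgt h - E.src h) := by
  have h1 : ∀ᶠ z in 𝓝 x, ∀ A ∈ Γ.finite_edges.toFinset, z ≠ x → z ∈ A →
      ∃ h : E.Seg, E.src h = x ∧ ∃ t : ℝ, 0 < t ∧ z = x + t * (E.tgt h - E.src h) := by
    rw [Filter.eventually_all_finset]
    intro A hA
    have hA := Γ.finite_edges.mem_toFinset.1 hA
    filter_upwards [(E.isArcParam ⟨A, hA⟩).eventually_mem_iff (x := x) fun k hk s hs e =>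
      E.notMem_vertices ⟨A, hA⟩ hk hs (e ▸ hx)] with z hz hzx hzA
    obtain ⟨k, hk, ⟨e, t, ht, ht'⟩ | ⟨e, t, ht, ht'⟩⟩ := (hz hzx).1 hzA
    · exact ⟨⟨⟨A, hA⟩, ⟨k, hk⟩, true⟩, e, t, ht, ht'⟩
    · exact ⟨⟨⟨A, hA⟩, ⟨k, hk⟩, false⟩, e, t, ht, ht'⟩
  have h2 : ∀ᶠ z in 𝓝 x, z ∉ Γ.vertices \ {x} :=
    (finite_vertices.subset sdiff_subset).isClosed.isOpen_compl.mem_nhds fun h => h.2 rfl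
  filter_upwards [h1, h2] with z hz1 hz2 hzx hz
  rcases hz with hz | ⟨A, hA, hz⟩
  · exact absurd ⟨hz, hzx⟩ hz2
  · exact hz1 A (Γ.finite_edges.mem_toFinset.2 hA) hzx hz

theorem openRect_of_color {x : ℂ} (hx : x ∈ Γ.white ∪ Γ.black) : x ∈ openRect :=
  hx.elim (fun h => Γ.white_subset h) (fun h => Γ.black_subset h)

noncomputable instance : Fintype Γ.edges := Γ.finite_edges.fintype

open Classical in
theorem sum_around_vertex {x : ℂ} (hx : x ∈ Γ.white ∪ Γ.black) (i : Γ.Face) :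
    ∑ h : E.Seg with E.src h = x, (if E.segLeft h = i then (1 : ℂ) else 0) =
      ∑ h : E.Seg with E.src h = x, if E.segRight h = i then (1 : ℂ) else 0 := by
  refine SectorSystem.sum_left_eq_sum_right (sectorSystem (Γ := Γ) (openRect_of_color hx)
    (dir := fun h => E.tgt h - E.src h) ?_ ?_ ?_ ?_ ?_ i)
  · exact fun h _ => sub_ne_zero.2 (E.src_ne_tgt h).symm
  · intro h hh h' hh' c hc e
    exact E.seg_inj ((Finset.mem_filter.1 hh).2.trans (Finset.mem_filter.1 hh').2.symm) hc e
  · filter_upwards [E.eventually_graph (Or.inr hx)] with z hz hzx hzg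
    obtain ⟨h, h1, h2⟩ := hz hzx hzg
    exact ⟨h, Finset.mem_filter.2 ⟨Finset.mem_univ _, h1⟩, h2⟩
  · intro h hh
    filter_upwards [eventually_Ioo_zero_one] with t ht
    rw [← (Finset.mem_filter.1 hh).2]
    exact (E.seg_sides h ht).1
  · intro h hh
    filter_upwards [eventually_Ioo_zero_one] with t ht
    rw [← (Finset.mem_filter.1 hh).2]
    exact (E.seg_sides h ht).2

open Classical in
/-- The colour of a point, as a number. -/
noncomputable def sign (Γ : PlabicGraph n) (z : ℂ) : ℂ :=
  if z ∈ Γ.white then 1 else if z ∈ Γ.black then -1 else 0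

-- Weight the identity `sum_around_vertex` by the colour of the vertex and add over all coloured
-- vertices. Each segment occurs in both orientations, with the signs of both its ends, so the sum
-- along an edge telescopes to the difference of the signs of its ends.
open Classical in
theorem sum_edges (i : Γ.Face) : ∑ A : Γ.edges, (sign Γ (E.p A 0) - sign Γ (E.p A (E.m A))) *
    ((if E.left A = i then 1 else 0) - if E.right A = i then 1 else 0) = 0 := by
  set V := (Γ.finite_white.union Γ.finite_black).toFinset with hV
  obtain ⟨χ, hχ⟩ : ∃ χ : Γ.Face → ℂ, ∀ f, χ f = if f = i then 1 else 0 := ⟨_, fun _ => rfl⟩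
  simp only [← hχ]
  have h1 : ∑ h : E.Seg, sign Γ (E.src h) * (χ (E.segLeft h) - χ (E.segRight h)) = 0 := by
    simp only [hχ]
    have h2 : ∀ z, sign Γ z = ∑ x ∈ V, if z = x then sign Γ x else 0 := by
      intro z
      rw [Finset.sum_ite_eq]
      split_ifs with h
      · rfl
      · rw [hV, Set.Finite.mem_toFinset, mem_union, not_or] at h
        rw [sign, if_neg h.1, if_neg h.2]
    calc _ = ∑ h : E.Seg, ∑ x ∈ V, (if E.src h = x then sign Γ x *
          ((if E.segLeft h = i then 1 else 0) - if E.segRight h = i then 1 else 0) else 0) := by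
          refine Finset.sum_congr rfl fun h _ => ?_
          rw [h2, Finset.sum_mul]
          refine Finset.sum_congr rfl fun x _ => ?_
          rw [ite_mul, zero_mul]
      _ = 0 := by
          rw [Finset.sum_comm]
          refine Finset.sum_eq_zero fun x hx => ?_
          rw [← Finset.sum_filter, ← Finset.mul_sum, Finset.sum_sub_distrib,
            E.sum_around_vertex ((Set.Finite.mem_toFinset _).1 hx), sub_self, mul_zero]
  refine Eq.trans ?_ h1
  rw [Fintype.sum_sigma]
  refine Finset.sum_congr rfl fun A _ => ?_
  rw [Fintype.sum_prod_type]
  simp only [Fintype.sum_bool, src, segLeft, segRight, cond_true, cond_false]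
  rw [Fin.sum_univ_eq_sum_range (fun k => sign Γ (E.p A k) * (χ (E.left A) - χ (E.right A)) +
    sign Γ (E.p A (k + 1)) * (χ (E.right A) - χ (E.left A))) (E.m A),
    ← Finset.sum_range_sub' (fun k => sign Γ (E.p A k)), Finset.sum_mul]
  refine Finset.sum_congr rfl fun k _ => ?_
  ring

theorem reverse_sides (A : Γ.edges) : ∀ k < E.m A, ∀ s ∈ Ioo (0 : ℝ) 1,
    (E.right A).1 ∈ leftGerm (AffineMap.lineMap (E.p A (E.m A - k)) (E.p A (E.m A - (k + 1))) s)
      (E.p A (E.m A - (k + 1)) - E.p A (E.m A - k)) ∧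
    (E.left A).1 ∈ leftGerm (AffineMap.lineMap (E.p A (E.m A - k)) (E.p A (E.m A - (k + 1))) s)
      (-(E.p A (E.m A - (k + 1)) - E.p A (E.m A - k))) := by
  intro k hk s hs
  have h1 := E.sides A (E.m A - (k + 1)) (by omega) (1 - s)
    ⟨by linarith [hs.2], by linarith [hs.1]⟩
  have e : E.m A - (k + 1) + 1 = E.m A - k := by omega
  rw [e, AffineMap.lineMap_apply_one_sub, neg_sub] at h1
  rw [neg_sub]
  exact h1.symm

theorem isArc_sides_iff (A : Γ.edges) {u v : ℂ} (hu : u ∈ Γ.vertices) (hv : v ∈ Γ.vertices)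
    (huv : u ≠ v) (i j : Γ.Face) : (IsArc A u v ∧ LiesRight A u v i.1 ∧ LiesLeft A u v j.1) ↔
      (u = E.p A 0 ∧ v = E.p A (E.m A) ∧ E.right A = i ∧ E.left A = j) ∨
      (u = E.p A (E.m A) ∧ v = E.p A 0 ∧ E.left A = i ∧ E.right A = j) := by
  have h0 := E.isArcParam A
  have h1 : ∀ h : E.p A 0 ≠ E.p A (E.m A), _ := fun h =>
    liesLeft_iff A.2 (E.start_mem A) (E.finish_mem A) h h0 (E.sides A)
  have h2 : ∀ h : E.p A (E.m A) ≠ E.p A 0, _ := fun h =>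
    liesLeft_iff A.2 (E.finish_mem A) (E.start_mem A) h h0.reverse (E.reverse_sides A)
  constructor
  · rintro ⟨ha, hr, hl⟩
    have h3 := (ends_of_isArc A.2 (E.start_mem A) (E.finish_mem A) ⟨_, _, h0⟩).2
    rcases h3 u ha.left_mem hu with e1 | e1 <;> rcases h3 v ha.right_mem hv with e2 | e2
    · exact absurd (e1.trans e2.symm) huv
    · subst e1 e2
      exact Or.inl ⟨rfl, rfl, ((h1 huv i).2.1 hr).symm, ((h1 huv j).1.1 hl).symm⟩
    · subst e1 e2
      exact Or.inr ⟨rfl, rfl, ((h2 huv i).2.1 hr).symm, ((h2 huv j).1.1 hl).symm⟩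
    · exact absurd (e1.trans e2.symm) huv
  · rintro (⟨rfl, rfl, rfl, rfl⟩ | ⟨rfl, rfl, rfl, rfl⟩)
    · exact ⟨⟨_, _, h0⟩, (h1 huv _).2.2 rfl, (h1 huv _).1.2 rfl⟩
    · exact ⟨⟨_, _, h0.reverse⟩, (h2 huv _).2.2 rfl, (h2 huv _).1.2 rfl⟩

theorem white_ne_black {u v : ℂ} (hu : u ∈ Γ.white) (hv : v ∈ Γ.black) : u ≠ v := by
  rintro rfl
  exact disjoint_left.1 Γ.disjoint_colors hu hv

theorem color_notMem_boundary {u : ℂ} (hu : u ∈ Γ.white ∪ Γ.black) : u ∉ Γ.boundary := by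
  have h := openRect_of_color hu
  rintro (hb | hb)
  · have := (Γ.left_side u hb).1
    have h1 := h.1
    rw [this] at h1
    simp at h1
  · have := (Γ.right_side u hb).1
    have h1 := h.1
    rw [this] at h1
    simp at h1

theorem wholeArrows_iff (A : Γ.edges) (i j : Γ.Face) :
    (∃ u ∈ Γ.white, ∃ v ∈ Γ.black, IsArc A u v ∧ LiesRight A u v i.1 ∧ LiesLeft A u v j.1) ↔
    (E.p A 0 ∈ Γ.white ∧ E.p A (E.m A) ∈ Γ.black ∧ E.right A = i ∧ E.left A = j) ∨
    (E.p A 0 ∈ Γ.black ∧ E.p A (E.m A) ∈ Γ.white ∧ E.left A = i ∧ E.right A = j) := by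
  constructor
  · rintro ⟨u, hu, v, hv, h⟩
    rcases (E.isArc_sides_iff A (Or.inr (Or.inl hu)) (Or.inr (Or.inr hv))
      (white_ne_black hu hv) i j).1 h with ⟨rfl, rfl, h'⟩ | ⟨rfl, rfl, h'⟩
    · exact Or.inl ⟨hu, hv, h'⟩
    · exact Or.inr ⟨hv, hu, h'⟩
  · rintro (⟨hu, hv, h⟩ | ⟨hv, hu, h⟩)
    · exact ⟨_, hu, _, hv, (E.isArc_sides_iff A (Or.inr (Or.inl hu)) (Or.inr (Or.inr hv))
        (white_ne_black hu hv) i j).2 (Or.inl ⟨rfl, rfl, h⟩)⟩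
    · exact ⟨_, hu, _, hv, (E.isArc_sides_iff A (Or.inr (Or.inl hu)) (Or.inr (Or.inr hv))
        (white_ne_black hu hv) i j).2 (Or.inr ⟨rfl, rfl, h⟩)⟩

theorem halfArrows_iff (A : Γ.edges) (i j : Γ.Face) :
    (∃ b ∈ Γ.boundary,
      (∃ u ∈ Γ.white, IsArc A u b ∧ LiesRight A u b i.1 ∧ LiesLeft A u b j.1) ∨
      (∃ u ∈ Γ.black, IsArc A b u ∧ LiesRight A b u i.1 ∧ LiesLeft A b u j.1)) ↔
    ((E.p A 0 ∈ Γ.white ∧ E.p A (E.m A) ∈ Γ.boundary ∨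
      E.p A 0 ∈ Γ.boundary ∧ E.p A (E.m A) ∈ Γ.black) ∧ E.right A = i ∧ E.left A = j) ∨
    ((E.p A 0 ∈ Γ.boundary ∧ E.p A (E.m A) ∈ Γ.white ∨
      E.p A 0 ∈ Γ.black ∧ E.p A (E.m A) ∈ Γ.boundary) ∧ E.left A = i ∧ E.right A = j) := by
  have hw : ∀ {u b : ℂ}, u ∈ Γ.white → b ∈ Γ.boundary → u ≠ b := fun hu hb e =>
    color_notMem_boundary (Or.inl hu) (e ▸ hb)
  have hb : ∀ {b u : ℂ}, b ∈ Γ.boundary → u ∈ Γ.black → b ≠ u := fun hb hu e =>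
    color_notMem_boundary (Or.inr hu) (e ▸ hb)
  constructor
  · rintro ⟨b, hbb, ⟨u, hu, h⟩ | ⟨u, hu, h⟩⟩
    · rcases (E.isArc_sides_iff A (Or.inr (Or.inl hu)) (Or.inl hbb)
        (hw hu hbb) i j).1 h with ⟨rfl, rfl, h'⟩ | ⟨rfl, rfl, h'⟩
      · exact Or.inl ⟨Or.inl ⟨hu, hbb⟩, h'⟩
      · exact Or.inr ⟨Or.inl ⟨hbb, hu⟩, h'⟩
    · rcases (E.isArc_sides_iff A (Or.inl hbb) (Or.inr (Or.inr hu))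
        (hb hbb hu) i j).1 h with ⟨rfl, rfl, h'⟩ | ⟨rfl, rfl, h'⟩
      · exact Or.inl ⟨Or.inr ⟨hbb, hu⟩, h'⟩
      · exact Or.inr ⟨Or.inr ⟨hu, hbb⟩, h'⟩
  · rintro (⟨⟨hu, hbb⟩ | ⟨hbb, hu⟩, h⟩ | ⟨⟨hbb, hu⟩ | ⟨hu, hbb⟩, h⟩)
    · exact ⟨_, hbb, Or.inl ⟨_, hu, (E.isArc_sides_iff A (Or.inr (Or.inl hu)) (Or.inl hbb)
        (hw hu hbb) i j).2 (Or.inl ⟨rfl, rfl, h⟩)⟩⟩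
    · exact ⟨_, hbb, Or.inr ⟨_, hu, (E.isArc_sides_iff A (Or.inl hbb) (Or.inr (Or.inr hu))
        (hb hbb hu) i j).2 (Or.inl ⟨rfl, rfl, h⟩)⟩⟩
    · exact ⟨_, hbb, Or.inl ⟨_, hu, (E.isArc_sides_iff A (Or.inr (Or.inl hu)) (Or.inl hbb)
        (hw hu hbb) i j).2 (Or.inr ⟨rfl, rfl, h⟩)⟩⟩
    · exact ⟨_, hbb, Or.inr ⟨_, hu, (E.isArc_sides_iff A (Or.inl hbb) (Or.inr (Or.inr hu))
        (hb hbb hu) i j).2 (Or.inr ⟨rfl, rfl, h⟩)⟩⟩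

open Classical in
theorem ncard_edges (P : Set ℂ → Prop) :
    (({A ∈ Γ.edges | P A}.ncard : ℕ) : ℂ) = ∑ A : Γ.edges, if P A then 1 else 0 := by
  have : {A ∈ Γ.edges | P A} = Subtype.val '' ((Finset.univ.filter fun A : Γ.edges => P A :
      Finset Γ.edges) : Set Γ.edges) := by
    ext A
    simp
    tauto
  rw [this, ncard_image_of_injective _ Subtype.val_injective, ncard_coe_finset,
    Finset.card_filter]
  push_cast
  rfl

open Classical in
/-- The adjacency matrix of the dual quiver as a sum over the edges. -/
theorem q_eq_sum (i j : Γ.Face) : Γ.q i j = ∑ A : Γ.edges,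
    (sign Γ (E.p A 0) - sign Γ (E.p A (E.m A))) / 2 *
      ((if E.right A = i then 1 else 0) * (if E.left A = j then 1 else 0) -
        (if E.left A = i then 1 else 0) * (if E.right A = j then 1 else 0)) := by
  have hd : ∀ z, z ∈ Γ.white → z ∉ Γ.black := fun z h => disjoint_left.1 Γ.disjoint_colors h
  rw [q, wholeArrows, wholeArrows, halfArrows, halfArrows, ncard_edges, ncard_edges, ncard_edges,
    ncard_edges, Finset.sum_div, Finset.sum_div, ← Finset.sum_add_distrib,
    ← Finset.sum_add_distrib, ← Finset.sum_sub_distrib]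
  refine Finset.sum_congr rfl fun A _ => ?_
  simp only [E.wholeArrows_iff, E.halfArrows_iff]
  -- Half the difference of the signs of the ends is `±1` for edges between opposite colours, `±1/2`
  -- for edges from an internal vertex to the boundary, and `0` otherwise: exactly the weights of
  -- arrows and half-arrows.
  have cases : ∀ z ∈ Γ.vertices,
      (z ∈ Γ.white ∧ z ∉ Γ.black ∧ z ∉ Γ.boundary ∧ sign Γ z = 1) ∨
      (z ∉ Γ.white ∧ z ∈ Γ.black ∧ z ∉ Γ.boundary ∧ sign Γ z = -1) ∨
      (z ∉ Γ.white ∧ z ∉ Γ.black ∧ z ∈ Γ.boundary ∧ sign Γ z = 0) := by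
    rintro z (hz | hz | hz)
    · have h1 : z ∉ Γ.white := fun h => color_notMem_boundary (Or.inl h) hz
      have h2 : z ∉ Γ.black := fun h => color_notMem_boundary (Or.inr h) hz
      exact Or.inr (Or.inr ⟨h1, h2, hz, by rw [sign, if_neg h1, if_neg h2]⟩)
    · exact Or.inl ⟨hz, hd z hz, color_notMem_boundary (Or.inl hz), by rw [sign, if_pos hz]⟩
    · have h1 : z ∉ Γ.white := fun h => hd z h hz
      exact Or.inr (Or.inl ⟨h1, hz, color_notMem_boundary (Or.inr hz),
        by rw [sign, if_neg h1, if_pos hz]⟩)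
  rcases cases _ (E.start_mem A) with ⟨a1, a2, a3, a4⟩ | ⟨a1, a2, a3, a4⟩ | ⟨a1, a2, a3, a4⟩ <;>
  rcases cases _ (E.finish_mem A) with ⟨b1, b2, b3, b4⟩ | ⟨b1, b2, b3, b4⟩ | ⟨b1, b2, b3, b4⟩ <;>
  simp only [a1, a2, a3, a4, b1, b2, b3, b4, true_and, false_and, and_true, and_false, or_false,
    false_or, if_false, ite_and] <;>
  split_ifs <;> norm_num

end EdgeParams

/-- Summing over `j` removes one indicator from each term of `q_eq_sum` and leaves minus one half of
`sum_edges`. Boundary vertices have sign zero, so nothing has to be counted around them. This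
identity makes the bracket compatible with the relation that the product of the weights is `1`. -/
theorem sum_q [Fintype Γ.Face] (i : Γ.Face) : ∑ j, Γ.q i j = 0 := by
  classical
  obtain ⟨E⟩ := nonempty_edgeParams (Γ := Γ)
  simp only [E.q_eq_sum]
  rw [Finset.sum_comm, ← neg_eq_zero]
  have := congrArg (fun x => x / 2) (E.sum_edges i)
  rw [zero_div] at this
  refine Eq.trans ?_ this
  rw [Finset.sum_div, ← Finset.sum_neg_distrib]
  refine Finset.sum_congr rfl fun A _ => ?_
  rw [← Finset.mul_sum, Finset.sum_sub_distrib, ← Finset.mul_sum, ← Finset.mul_sum]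
  simp
  ring

theorem q_skew (i j : Γ.Face) : Γ.q i j = -Γ.q j i := by
  rw [q, q]
  ring

end PlabicGraph

namespace PlabicGraph

variable {n : ℕ} {Γ : PlabicGraph n}

/-! ### There are finitely many faces -/

/-- A face contains a small relative ball of the rectangle about any of its points, which may be on
the boundary; shrinking the point slightly towards the centre stays in that ball. -/
theorem exists_mem_face_openRect (i : Γ.Face) : ∃ z ∈ i.1, z ∈ openRect := by
  obtain ⟨z, hz⟩ := face_nonempty i
  have hzc := face_subset_complement i hz
  obtain ⟨r, hr, hr'⟩ := Metric.mem_nhds_iff.1 (isClosed_graph.isOpen_compl.mem_nhds hzc.2)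
  have hrect : Convex ℝ rect := by
    have h1 : rect = Complex.reLm ⁻¹' Icc (-1) 1 ∩ Complex.imLm ⁻¹' Icc (-1) 1 := by
      ext w
      simp [rect, abs_le]
    rw [h1]
    exact ((convex_Icc _ _).linear_preimage _).inter ((convex_Icc _ _).linear_preimage _)
  have hsub : Metric.ball z r ∩ rect ⊆ i.1 :=
    subset_face ((convex_ball z r).inter hrect).isPreconnected (fun w hw => ⟨hw.2, hr' hw.1⟩)
      ⟨Metric.mem_ball_self hr, hzc.1⟩ hz
  have hcont : Continuous fun t : ℝ => ((1 - t : ℝ) : ℂ) * z := by fun_prop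
  have h1 := hcont.tendsto 0
  simp only [sub_zero, Complex.ofReal_one, one_mul] at h1
  obtain ⟨t, ht, ht'⟩ := (((h1.mono_left (nhdsWithin_le_nhds (s := Ioi 0))).eventually
    (Metric.isOpen_ball.mem_nhds (Metric.mem_ball_self hr))).and eventually_Ioo_zero_one).exists
  have ho : ((1 - t : ℝ) : ℂ) * z ∈ openRect := by
    have h2 : 0 < 1 - t := by linarith [ht'.2]
    refine ⟨?_, ?_⟩
    · rw [Complex.re_ofReal_mul, abs_mul, abs_of_pos h2]
      nlinarith [hzc.1.1, ht'.1, abs_nonneg z.re]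
    · rw [Complex.im_ofReal_mul, abs_mul, abs_of_pos h2]
      nlinarith [hzc.1.2, ht'.1, abs_nonneg z.im]
  exact ⟨_, hsub ⟨ht, openRect_subset_rect ho⟩, ho⟩

/-- The complement of a finite union of lines is dense, and its cells are convex. -/
theorem dense_compl_lines {ι : Type*} [Finite ι] (a d : ι → ℂ) (hd : ∀ k, d k ≠ 0) :
    Dense {z : ℂ | ∀ k, ((starRingEnd ℂ) (d k) * (z - a k)).im ≠ 0} := by
  have : {z : ℂ | ∀ k, ((starRingEnd ℂ) (d k) * (z - a k)).im ≠ 0} =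
      ⋂ k, {z : ℂ | ((starRingEnd ℂ) (d k) * (z - a k)).im ≠ 0} := by
    ext z
    simp
  rw [this]
  refine dense_iInter_of_isOpen (fun k => ?_) fun k => ?_
  · have : Continuous fun z : ℂ => ((starRingEnd ℂ) (d k) * (z - a k)).im := by fun_prop
    exact isOpen_ne_fun this continuous_const
  · intro z
    by_cases hz : ((starRingEnd ℂ) (d k) * (z - a k)).im = 0
    · refine mem_closure_of_tendsto (((tendsto_leftGerm_normal z (hd k)).mono_right inf_le_left)) ?_
      have := (tendsto_leftGerm_normal z (hd k)).mono_right inf_le_right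
      filter_upwards [Filter.tendsto_principal.1 this] with ε hε
      have e : (starRingEnd ℂ) (d k) * (z + ε * (Complex.I * d k) - a k) =
        (starRingEnd ℂ) (d k) * (z + ε * (Complex.I * d k) - z) +
          (starRingEnd ℂ) (d k) * (z - a k) := by ring
      change ((starRingEnd ℂ) (d k) * (z + ε * (Complex.I * d k) - a k)).im ≠ 0
      rw [e, Complex.add_im, hz, add_zero]
      exact ne_of_gt hε
    · exact subset_closure hz

/-- Extend all segments to lines and draw a horizontal line through each vertex. Every face contains
a point off these lines, and two such points with the same sides of all lines are joined by a
segment that misses the graph. There are finitely many patterns of sides. -/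
instance finite_face : Finite Γ.Face := by
  obtain ⟨E⟩ := nonempty_edgeParams (Γ := Γ)
  have : Finite Γ.vertices := finite_vertices
  set a : E.Seg ⊕ Γ.vertices → ℂ := Sum.elim E.src Subtype.val with ha
  set d : E.Seg ⊕ Γ.vertices → ℂ := Sum.elim (fun h => E.tgt h - E.src h) 1 with hd
  have hd0 : ∀ k, d k ≠ 0 := by
    rintro (h | v)
    · exact sub_ne_zero.2 (E.src_ne_tgt h).symm
    · exact one_ne_zero
  have hgraph : ∀ z ∈ Γ.vertices ∪ ⋃₀ Γ.edges, ∃ k, ((starRingEnd ℂ) (d k) * (z - a k)).im = 0 := by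
    rintro z (hz | ⟨A, hA, hz⟩)
    · exact ⟨Sum.inr ⟨z, hz⟩, by simp [ha, hd]⟩
    · obtain ⟨k, hk, s, hs, rfl⟩ := (E.isArcParam ⟨A, hA⟩).mem_iff.1 hz
      refine ⟨Sum.inl ⟨⟨A, hA⟩, ⟨k, hk⟩, true⟩, ?_⟩
      rw [lineMap_eq_add]
      simp [ha, hd, EdgeParams.src, EdgeParams.tgt]
      ring
  have h1 : ∀ i : Γ.Face, ∃ z ∈ i.1, z ∈ openRect ∧
      ∀ k, ((starRingEnd ℂ) (d k) * (z - a k)).im ≠ 0 := by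
    intro i
    obtain ⟨z, hz, hzo⟩ := exists_mem_face_openRect i
    have h2 := eventually_mem_face_iff i hzo (face_subset_complement i hz)
    obtain ⟨U, hU, hUo, hzU⟩ := mem_nhds_iff.1 (h2.and (isOpen_openRect.mem_nhds hzo))
    obtain ⟨w, hw, hwU⟩ := (dense_compl_lines a d hd0).exists_mem_open hUo ⟨z, hzU⟩
    exact ⟨w, (hU hwU).1.2 hz, (hU hwU).2, hw⟩
  choose z hz hzo hzd using h1
  refine Finite.of_injective
    (fun (i : Γ.Face) (k : E.Seg ⊕ Γ.vertices) =>
      (0 < ((starRingEnd ℂ) (d k) * (z i - a k)).im : Prop)) fun i j hij => ?_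
  have hcell : segment ℝ (z i) (z j) ⊆ Γ.complement := by
    rintro w ⟨s, t, hs, ht, hst, rfl⟩
    refine ⟨?_, fun hc => ?_⟩
    · have hr : ∀ x y : ℝ, |x| < 1 → |y| < 1 → |s * x + t * y| ≤ 1 := by
        intro x y hx hy
        rw [abs_lt] at hx hy
        rw [abs_le]
        constructor <;> nlinarith
      refine ⟨?_, ?_⟩
      · simpa using hr _ _ (hzo i).1 (hzo j).1
      · simpa using hr _ _ (hzo i).2 (hzo j).2
    · obtain ⟨k, hk⟩ := hgraph _ hc
      have e : (starRingEnd ℂ) (d k) * (s • z i + t • z j - a k) =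
          s * ((starRingEnd ℂ) (d k) * (z i - a k)) +
          t * ((starRingEnd ℂ) (d k) * (z j - a k)) := by
        have : (a k : ℂ) = (s + t : ℝ) * a k := by rw [hst]; simp
        push_cast at this
        simp only [Complex.real_smul]
        linear_combination -(starRingEnd ℂ) (d k) * this
      rw [e, Complex.add_im, Complex.im_ofReal_mul, Complex.im_ofReal_mul] at hk
      have h2 := congrFun hij k
      simp only [eq_iff_iff] at h2
      rcases lt_or_gt_of_ne (hzd i k) with h3 | h3
      · have h4 := lt_of_le_of_ne (not_lt.1 (h2.not.1 h3.not_gt)) (hzd j k)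
        rcases hs.lt_or_eq with h5 | h5
        · nlinarith
        · rw [← h5] at hst
          nlinarith
      · have h4 := h2.1 h3
        rcases hs.lt_or_eq with h5 | h5
        · nlinarith
        · rw [← h5] at hst
          nlinarith
  exact face_eq_of_mem (subset_face (convex_segment _ _).isPreconnected hcell
    (left_mem_segment ℝ _ _) (hz i) (right_mem_segment ℝ _ _)) (hz j)

end PlabicGraph

/-! ### Reflection in the midline -/

theorem mirror_eq_iff {z : ℂ} : mirror z = z ↔ z.im = 0 := Complex.conj_eq_iff_im

theorem mirror_mirror (z : ℂ) : mirror (mirror z) = z := Complex.conj_conj z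

theorem mirror_image_image (S : Set ℂ) : mirror '' (mirror '' S) = S := by
  rw [← image_comp]
  exact (image_congr fun z _ => mirror_mirror z).trans (image_id S)

theorem mem_mirror_image {S : Set ℂ} {z : ℂ} : z ∈ mirror '' S ↔ mirror z ∈ S :=
  ⟨by rintro ⟨w, hw, rfl⟩; rwa [mirror_mirror], fun h => ⟨_, h, mirror_mirror z⟩⟩

theorem even_ncard_of_involution {α : Type*} {S : Set α} (hS : S.Finite) (f : α → α)
    (hf : ∀ x ∈ S, f x ∈ S ∧ f x ≠ x ∧ f (f x) = x) : Even S.ncard := by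
  have h1 : ∑ x ∈ hS.toFinset, (1 : ZMod 2) = 0 := by
    refine Finset.sum_involution (fun x _ => f x) ?_ ?_ ?_ ?_
    · intro x hx
      decide
    · intro x hx _
      exact (hf x (hS.mem_toFinset.1 hx)).2.1
    · intro x hx
      exact hS.mem_toFinset.2 (hf x (hS.mem_toFinset.1 hx)).1
    · intro x hx
      exact (hf x (hS.mem_toFinset.1 hx)).2.2
  rw [Finset.sum_const, nsmul_eq_mul, mul_one, ZMod.natCast_eq_zero_iff] at h1
  rw [ncard_eq_toFinset_card S hS]
  exact even_iff_two_dvd.2 h1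

/-- A vertical line meets the midline in one point. If it belonged to `S`, the reflection would pair
off the other points, and `S` would be odd. -/
theorem im_ne_zero_of_side {S : Set ℂ} (hS : S.Finite) (he : Even S.ncard)
    (hm : mirror '' S = S) {c : ℝ} (hc : ∀ z ∈ S, z.re = c) : ∀ z ∈ S, z.im ≠ 0 := by
  intro z hz h0
  have h1 : Even (S \ {z}).ncard := by
    refine even_ncard_of_involution (hS.subset sdiff_subset) mirror ?_
    rintro x ⟨hx, hxz⟩
    refine ⟨⟨hm ▸ mem_image_of_mem _ hx, fun e => hxz ?_⟩, fun e => hxz ?_, mirror_mirror x⟩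
    · rw [mem_singleton_iff] at e
      rw [← mirror_mirror x, e, mirror_eq_iff.2 h0]
      rfl
    · rw [mirror_eq_iff] at e
      exact Complex.ext ((hc x hx).trans (hc z hz).symm) (e.trans h0.symm)
  have h2 := ncard_sdiff_singleton_add_one hz hS
  rw [← h2] at he
  exact (Nat.even_add_one.1 he) h1

/-! ### Edges at the vertices on the midline, and squares with an edge on it. -/

namespace PlabicGraph

variable {n : ℕ} {Γ : PlabicGraph n}

theorem edge_eq_of_mem {A B : Set ℂ} (hA : A ∈ Γ.edges) (hB : B ∈ Γ.edges) {z : ℂ} (hzA : z ∈ A)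
    (hzB : z ∈ B) (hz : z ∉ Γ.vertices) : A = B := by
  by_contra hne
  exact hz (Γ.edge_inter A hA B hB hne ⟨hzA, hzB⟩)

theorem exists_mem_edge_notMem_vertices {A : Set ℂ} (hA : A ∈ Γ.edges) :
    ∃ z ∈ A, z ∉ Γ.vertices := by
  obtain ⟨E⟩ := nonempty_edgeParams (Γ := Γ)
  have h := E.isArcParam ⟨A, hA⟩
  have hs : (1 / 2 : ℝ) ∈ Ioo (0 : ℝ) 1 := by norm_num
  exact ⟨_, (h.lineMap_mem_sdiff h.pos hs).1, E.notMem_vertices ⟨A, hA⟩ h.pos hs⟩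

/-- An edge which is not a loop at its end `z` joins `z` to another vertex. -/
theorem exists_other_end {A : Set ℂ} (hA : A ∈ Γ.edges) {z : ℂ} (hz : z ∈ Γ.vertices) (hzA : z ∈ A)
    (hl : ¬ IsArc A z z) : ∃ x ∈ Γ.vertices, x ≠ z ∧ IsArc A z x := by
  obtain ⟨u, hu, v, hv, h, -⟩ := Γ.edge_arc A hA
  rcases (ends_of_isArc hA hu hv h).2 z hzA hz with rfl | rfl
  · exact ⟨v, hv, fun e => hl (by rwa [e] at h), h⟩
  · exact ⟨u, hu, fun e => hl (by rwa [e] at h), h.symm⟩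

/-- Two edges on the midline which leave a vertex in the same direction are equal. -/
theorem fixed_edge_eq {z : ℂ} (hz : z ∈ Γ.vertices) {A B : Set ℂ} (hA : A ∈ Γ.edges)
    (hB : B ∈ Γ.edges) {x y : ℂ} (hx : x ∈ Γ.vertices) (hxA : IsArc A z x)
    (hA' : A = Complex.ofReal '' uIcc z.re x.re) (hB' : B = Complex.ofReal '' uIcc z.re y.re)
    (hxy : 0 < (x.re - z.re) * (y.re - z.re)) : A = B := by
  rcases pos_and_pos_or_neg_and_neg_of_mul_pos hxy with ⟨h1, h2⟩ | ⟨h1, h2⟩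
  · set t : ℝ := (z.re + min x.re y.re) / 2 with ht
    have h3 : z.re < min x.re y.re := lt_min (by linarith) (by linarith)
    have h4 := min_le_left x.re y.re
    have h5 := min_le_right x.re y.re
    have h6 : z.re < t := by rw [ht]; linarith
    have h7 : t < min x.re y.re := by rw [ht]; linarith
    have htA : (t : ℂ) ∈ A := hA' ▸ mem_image_of_mem _ (Icc_subset_uIcc ⟨h6.le, by linarith⟩)
    refine edge_eq_of_mem hA hB htA
      (hB' ▸ mem_image_of_mem _ (Icc_subset_uIcc ⟨h6.le, by linarith⟩)) fun hc => ?_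
    rcases (ends_of_isArc hA hz hx hxA).2 _ htA hc with e | e
    · exact h6.ne' (by rw [← e, Complex.ofReal_re])
    · have : t = x.re := by rw [← e, Complex.ofReal_re]
      linarith
  · set t : ℝ := (z.re + max x.re y.re) / 2 with ht
    have h3 : max x.re y.re < z.re := max_lt (by linarith) (by linarith)
    have h4 := le_max_left x.re y.re
    have h5 := le_max_right x.re y.re
    have h6 : t < z.re := by rw [ht]; linarith
    have h7 : max x.re y.re < t := by rw [ht]; linarith
    have htA : (t : ℂ) ∈ A := hA' ▸ mem_image_of_mem _ (Icc_subset_uIcc' ⟨by linarith, h6.le⟩)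
    refine edge_eq_of_mem hA hB htA
      (hB' ▸ mem_image_of_mem _ (Icc_subset_uIcc' ⟨by linarith, h6.le⟩)) fun hc => ?_
    rcases (ends_of_isArc hA hz hx hxA).2 _ htA hc with e | e
    · exact h6.ne (by rw [← e, Complex.ofReal_re])
    · have : t = x.re := by rw [← e, Complex.ofReal_re]
      linarith

namespace IsMoveSymmetric

variable (h : Γ.IsMoveSymmetric)
include h

theorem mirror_edge {A : Set ℂ} (hA : A ∈ Γ.edges) : mirror '' A ∈ Γ.edges := by
  rw [← h.edges]
  exact ⟨A, hA, rfl⟩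

theorem mirror_vertices : mirror '' Γ.vertices = Γ.vertices := by
  rw [vertices, image_union, image_union, h.left, h.right, ← moved_union, image_union, h.white,
    h.black, moved_union, union_comm Γ.black]

theorem boundary_im_ne_zero (hn : Even n) {z : ℂ} (hz : z ∈ Γ.boundary) : z.im ≠ 0 := by
  rcases hz with hz | hz
  · exact im_ne_zero_of_side Γ.finite_left (by rwa [Γ.card_left]) h.left
      (fun z hz => (Γ.left_side z hz).1) z hz
  · exact im_ne_zero_of_side Γ.finite_right (by rwa [Γ.card_right]) h.right
      (fun z hz => (Γ.right_side z hz).1) z hz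

/-- The reflection fixes `z`, but has to give it the opposite colour; without a change of colour by
the moves, `z` would be both white and black. -/
theorem mem_recolored {z : ℂ} (hz : z ∈ Γ.white ∪ Γ.black) (h0 : z.im = 0) : z ∈ Γ.recolored := by
  have hm := mirror_eq_iff.2 h0
  by_contra hc
  rcases hz with hz | hz
  · have h1 : z ∈ Γ.black := by
      rw [← h.white]
      exact ⟨z, Or.inl ⟨hz, hc⟩, hm⟩
    exact disjoint_left.1 Γ.disjoint_colors hz h1
  · have h1 : z ∈ Γ.white := by
      rw [← h.black]
      exact ⟨z, Or.inl ⟨hz, hc⟩, hm⟩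
    exact disjoint_left.1 Γ.disjoint_colors h1 hz

/-- The reflection permutes the two ends of `A` and fixes `z`, so it fixes the other end as well,
and `IsArc.eq_segment_of_mirror` applies. -/
theorem mirror_fixed_edge {A : Set ℂ} (hA : A ∈ Γ.edges) (hm : mirror '' A = A) {z : ℂ}
    (hz : z ∈ Γ.vertices) (hzA : z ∈ A) (hl : ¬ IsArc A z z) (h0 : z.im = 0) :
    ∃ x ∈ Γ.vertices, x ≠ z ∧ IsArc A z x ∧ x.im = 0 ∧
      A = Complex.ofReal '' uIcc z.re x.re := by
  obtain ⟨x, hx, hxz, harc⟩ := exists_other_end hA hz hzA hl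
  have hx' : mirror x = z ∨ mirror x = x := by
    refine (ends_of_isArc hA hz hx harc).2 _ ?_ ?_
    · rw [← hm]
      exact mem_image_of_mem _ harc.right_mem
    · rw [← h.mirror_vertices]
      exact mem_image_of_mem _ hx
  have hx0 : x.im = 0 := by
    rcases hx' with e | e
    · refine absurd ?_ hxz
      rw [← mirror_mirror x, e, mirror_eq_iff.2 h0]
    · exact mirror_eq_iff.1 e
  exact ⟨x, hx, hxz, harc, hx0, harc.eq_segment_of_mirror hxz.symm hm h0 hx0⟩

end IsMoveSymmetric

/-- The vertex `z` is trivalent, and there are no loops at `z`. -/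
def IsTrivalent (Γ : PlabicGraph n) (z : ℂ) : Prop :=
  {A ∈ Γ.edges | z ∈ A}.ncard = 3 ∧ ∀ A ∈ Γ.edges, ¬ IsArc A z z

theorem finite_edges_at (z : ℂ) : {A ∈ Γ.edges | z ∈ A}.Finite :=
  Γ.finite_edges.subset fun _ hA => hA.1

section Square

variable {i : Γ.Face} {v : Fin 4 → ℂ} {A : Fin 4 → Set ℂ}

theorem IsMidlineSquareWith.mem_vertices (hs : Γ.IsMidlineSquareWith i v) (k : Fin 4) :
    v k ∈ Γ.white ∪ Γ.black := by
  rcases hs.2.1 with ⟨h0, h1, h2, h3⟩ | ⟨h0, h1, h2, h3⟩ <;> fin_cases k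
  exacts [Or.inl h0, Or.inr h1, Or.inl h2, Or.inr h3, Or.inr h0, Or.inl h1, Or.inr h2, Or.inl h3]

theorem IsMidlineSquareWith.vertex_of_mem (hs : Γ.IsMidlineSquareWith i v)
    (hA : ∀ k, A k ∈ Γ.edges ∧ IsArc (A k) (v k) (v (k + 1))) {x : ℂ} (hx : x ∈ Γ.vertices)
    {k : Fin 4} (hxk : x ∈ A k) : x = v k ∨ x = v (k + 1) :=
  (ends_of_isArc (hA k).1 (Or.inr (hs.mem_vertices k)) (Or.inr (hs.mem_vertices (k + 1)))
    (hA k).2).2 x hxk hx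

theorem IsMidlineSquareWith.mem_edge_iff (hs : Γ.IsMidlineSquareWith i v)
    (hA : ∀ k, A k ∈ Γ.edges ∧ IsArc (A k) (v k) (v (k + 1))) {k l : Fin 4} :
    v l ∈ A k ↔ l = k ∨ l = k + 1 := by
  constructor
  · intro hl
    exact (hs.vertex_of_mem hA (Or.inr (hs.mem_vertices l)) hl).imp (fun e => hs.1 e)
      fun e => hs.1 e
  · rintro (rfl | rfl)
    · exact (hA l).2.left_mem
    · exact (hA k).2.right_mem

theorem IsMidlineSquareWith.edge_injective (hs : Γ.IsMidlineSquareWith i v)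
    (hA : ∀ k, A k ∈ Γ.edges ∧ IsArc (A k) (v k) (v (k + 1))) : Function.Injective A := by
  intro k l e
  have h1 : v k ∈ A l := e ▸ (hA k).2.left_mem
  have h2 : v (k + 1) ∈ A l := e ▸ (hA k).2.right_mem
  rw [hs.mem_edge_iff hA] at h1 h2
  exact (by decide : ∀ k l : Fin 4, k = l ∨ k = l + 1 → k + 1 = l ∨ k + 1 = l + 1 → k = l) k l h1 h2

/-- In `degree` a loop counts twice. Two non-loops at the vertex already come from the square, and
degree three leaves no room for a loop. -/
theorem IsMidlineSquareWith.isTrivalent (hs : Γ.IsMidlineSquareWith i v) (k : Fin 4) :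
    IsTrivalent Γ (v k) := by
  obtain ⟨A, hA, -⟩ := hs.2.2.2.1
  have hdeg := hs.2.2.1 k
  rw [degree] at hdeg
  have hne : A k ≠ A (k - 1) := fun e =>
    (by decide : ∀ k : Fin 4, k ≠ k - 1) k (hs.edge_injective hA e)
  have harc : IsArc (A (k - 1)) (v k) (v (k - 1)) := by
    have := (hA (k - 1)).2.symm
    rwa [sub_add_cancel] at this
  have hl1 : ¬ IsArc (A k) (v k) (v k) := (hA k).2.not_loop fun e =>
    (by decide : ∀ k : Fin 4, k ≠ k + 1) k (hs.1 e)
  have hl2 : ¬ IsArc (A (k - 1)) (v k) (v k) := harc.not_loop fun e =>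
    (by decide : ∀ k : Fin 4, k ≠ k - 1) k (hs.1 e)
  have hsub : {B ∈ Γ.edges | IsArc B (v k) (v k)} ⊆
      {B ∈ Γ.edges | v k ∈ B} \ {A k, A (k - 1)} := by
    rintro B ⟨hB, hB'⟩
    refine ⟨⟨hB, hB'.left_mem⟩, ?_⟩
    rintro (rfl | rfl)
    · exact hl1 hB'
    · exact hl2 hB'
  have hpair : ({A k, A (k - 1)} : Set (Set ℂ)) ⊆ {B ∈ Γ.edges | v k ∈ B} := by
    rintro B (rfl | rfl)
    · exact ⟨(hA k).1, (hA k).2.left_mem⟩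
    · exact ⟨(hA (k - 1)).1, harc.left_mem⟩
  have h1 := ncard_le_ncard hsub ((finite_edges_at (v k)).subset sdiff_subset)
  have h2 := ncard_sdiff_add_ncard_of_subset hpair (finite_edges_at (v k))
  rw [ncard_pair hne] at h2
  have h3 : {B ∈ Γ.edges | IsArc B (v k) (v k)}.ncard = 0 := by omega
  refine ⟨by omega, fun B hB hB' => ?_⟩
  rw [ncard_eq_zero (Γ.finite_edges.subset fun _ hA => hA.1)] at h3
  exact notMem_empty B (h3 ▸ ⟨hB, hB'⟩)

end Square

namespace IsMoveSymmetric

variable (h : Γ.IsMoveSymmetric)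
include h

/-- An odd number of midline squares at `z` means that there is at least one. -/
theorem isTrivalent {z : ℂ} (hz : z ∈ Γ.white ∪ Γ.black) (h0 : z.im = 0) : IsTrivalent Γ z := by
  obtain ⟨i, v, hs, k, rfl⟩ :
      {i : Γ.Face | ∃ v, Γ.IsMidlineSquareWith i v ∧ z ∈ range v}.Nonempty := by
    by_contra hc
    have := h.mem_recolored hz h0
    rw [recolored, mem_ofPred_eq, not_nonempty_iff_eq_empty.1 hc] at this
    simp at this
  exact hs.isTrivalent k

theorem mirror_mem_edges_at {z : ℂ} (h0 : z.im = 0) {A : Set ℂ}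
    (hA : A ∈ {A ∈ Γ.edges | z ∈ A}) : mirror '' A ∈ {A ∈ Γ.edges | z ∈ A} :=
  ⟨h.mirror_edge hA.1, z, hA.2, mirror_eq_iff.2 h0⟩

/-- At a trivalent vertex on the midline, one edge is on the midline and the two others are
exchanged by the reflection. -/
theorem edges_at {z : ℂ} (hz : z ∈ Γ.white ∪ Γ.black) (h0 : z.im = 0) : ∃ e a : Set ℂ,
    {A ∈ Γ.edges | z ∈ A} = {e, a, mirror '' a} ∧ mirror '' e = e ∧ mirror '' a ≠ a ∧
      e ≠ a ∧ e ≠ mirror '' a := by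
  obtain ⟨h3, hl⟩ := h.isTrivalent hz h0
  have hzv : z ∈ Γ.vertices := Or.inr hz
  -- Three is odd, so the reflection cannot move all edges at `z`.
  obtain ⟨e, he, hme⟩ : ∃ e ∈ {A ∈ Γ.edges | z ∈ A}, mirror '' e = e := by
    by_contra! hc
    have := even_ncard_of_involution (finite_edges_at z) (fun A => mirror '' A) fun A hA =>
      ⟨h.mirror_mem_edges_at h0 hA, hc A hA, mirror_image_image A⟩
    rw [h3] at this
    exact absurd this (by decide)
  have h2 : ({A ∈ Γ.edges | z ∈ A} \ {e}).ncard = 2 := by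
    have := ncard_sdiff_singleton_add_one he (finite_edges_at z)
    omega
  obtain ⟨a, b, hab, hE⟩ := ncard_eq_two.1 h2
  have ha : a ∈ {A ∈ Γ.edges | z ∈ A} \ {e} := hE ▸ Or.inl rfl
  have hb : b ∈ {A ∈ Γ.edges | z ∈ A} \ {e} := hE ▸ Or.inr rfl
  have hmem : ∀ c ∈ {A ∈ Γ.edges | z ∈ A} \ {e},
      mirror '' c ∈ {A ∈ Γ.edges | z ∈ A} \ {e} := fun c hc =>
    ⟨h.mirror_mem_edges_at h0 hc.1, fun e' => hc.2 (by
      rw [mem_singleton_iff] at e'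
      rw [← mirror_image_image c, e', hme]
      rfl)⟩
  -- Otherwise all three edges would be segments of the midline, and two of them would leave `z` in
  -- the same direction.
  have hma : mirror '' a ≠ a := by
    intro hma
    have hmb : mirror '' b = b := by
      have hb' := hmem b hb
      rw [hE] at hb'
      rcases hb' with e' | e'
      · refine absurd ?_ hab
        rw [← mirror_image_image b, e', hma]
      · exact e'
    obtain ⟨x, hx, hxz, hxe, hx0, hxE⟩ :=
      h.mirror_fixed_edge he.1 hme hzv he.2 (hl e he.1) h0
    obtain ⟨y, hy, hyz, hya, hy0, hyE⟩ :=
      h.mirror_fixed_edge ha.1.1 hma hzv ha.1.2 (hl a ha.1.1) h0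
    obtain ⟨w, hw, hwz, hwb, hw0, hwE⟩ :=
      h.mirror_fixed_edge hb.1.1 hmb hzv hb.1.2 (hl b hb.1.1) h0
    have k1 : ∀ x : ℂ, x ≠ z → x.im = 0 → x.re - z.re ≠ 0 := fun x hxz hx0 hc =>
      hxz (Complex.ext (by linarith) (hx0.trans h0.symm))
    have n1 : ¬ 0 < (x.re - z.re) * (y.re - z.re) := fun hp =>
      ha.2 (fixed_edge_eq hzv he.1 ha.1.1 hx hxe hxE hyE hp).symm
    have n2 : ¬ 0 < (x.re - z.re) * (w.re - z.re) := fun hp =>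
      hb.2 (fixed_edge_eq hzv he.1 hb.1.1 hx hxe hxE hwE hp).symm
    have n3 : ¬ 0 < (y.re - z.re) * (w.re - z.re) := fun hp =>
      hab (fixed_edge_eq hzv ha.1.1 hb.1.1 hy hya hyE hwE hp)
    rcases lt_or_gt_of_ne (k1 x hxz hx0) with s1 | s1 <;>
    rcases lt_or_gt_of_ne (k1 y hyz hy0) with s2 | s2 <;>
    rcases lt_or_gt_of_ne (k1 w hwz hw0) with s3 | s3
    · exact n1 (mul_pos_of_neg_of_neg s1 s2)
    · exact n1 (mul_pos_of_neg_of_neg s1 s2)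
    · exact n2 (mul_pos_of_neg_of_neg s1 s3)
    · exact n3 (mul_pos s2 s3)
    · exact n3 (mul_pos_of_neg_of_neg s2 s3)
    · exact n2 (mul_pos s1 s3)
    · exact n1 (mul_pos s1 s2)
    · exact n1 (mul_pos s1 s2)
  have hb' : b = mirror '' a := by
    have ha' := hmem a ha
    rw [hE] at ha'
    rcases ha' with e' | e'
    · exact absurd e' hma
    · exact e'.symm
  refine ⟨e, a, ?_, hme, hma, fun e' => ha.2 e'.symm, fun e' => (hmem a ha).2 e'.symm⟩
  rw [← hb', ← hE, insert_sdiff_singleton, insert_eq_of_mem he]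

theorem fixed_unique {z : ℂ} (hz : z ∈ Γ.white ∪ Γ.black) (h0 : z.im = 0) {A B : Set ℂ}
    (hA : A ∈ Γ.edges) (hzA : z ∈ A) (hB : B ∈ Γ.edges) (hzB : z ∈ B) (hmA : mirror '' A = A)
    (hmB : mirror '' B = B) : A = B := by
  obtain ⟨e, a, hE, hme, hma, -⟩ := h.edges_at hz h0
  have hma' : mirror '' (mirror '' a) ≠ mirror '' a := by
    rw [mirror_image_image]
    exact hma.symm
  have key : ∀ C, C ∈ Γ.edges → z ∈ C → mirror '' C = C → C = e := by
    intro C hC hzC hmC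
    have : C ∈ ({e, a, mirror '' a} : Set (Set ℂ)) := hE ▸ ⟨hC, hzC⟩
    rcases this with rfl | rfl | rfl
    · rfl
    · exact absurd hmC hma
    · exact absurd hmC hma'
  rw [key A hA hzA hmA, key B hB hzB hmB]

theorem fixed_or_mirror {z : ℂ} (hz : z ∈ Γ.white ∪ Γ.black) (h0 : z.im = 0) {A B : Set ℂ}
    (hA : A ∈ Γ.edges) (hzA : z ∈ A) (hB : B ∈ Γ.edges) (hzB : z ∈ B) (hAB : A ≠ B)
    (hmA : mirror '' A ≠ A) : mirror '' B = B ∨ B = mirror '' A := by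
  obtain ⟨e, a, hE, hme, hma, -⟩ := h.edges_at hz h0
  have h1 : A ∈ ({e, a, mirror '' a} : Set (Set ℂ)) := hE ▸ ⟨hA, hzA⟩
  have h2 : B ∈ ({e, a, mirror '' a} : Set (Set ℂ)) := hE ▸ ⟨hB, hzB⟩
  rcases h1 with rfl | rfl | rfl <;> rcases h2 with rfl | rfl | rfl
  · exact absurd rfl hAB
  · exact absurd hme hmA
  · exact absurd hme hmA
  · exact Or.inl hme
  · exact absurd rfl hAB
  · exact Or.inr rfl
  · exact Or.inl hme
  · exact Or.inr (mirror_image_image _).symm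
  · exact absurd rfl hAB

/-- If an edge of a midline square is on the midline, then all its vertices are. -/
theorem square_real {i : Γ.Face} {v : Fin 4 → ℂ} (hs : Γ.IsMidlineSquareWith i v)
    {A : Fin 4 → Set ℂ} (hA : ∀ k, A k ∈ Γ.edges ∧ IsArc (A k) (v k) (v (k + 1))) {j : Fin 4}
    (hj : mirror '' A j = A j) (hr : (v j).im = 0 ∨ (v (j + 1)).im = 0) (k : Fin 4) :
    (v k).im = 0 := by
  have hV : ∀ k, v k ∈ Γ.vertices := fun k => Or.inr (hs.mem_vertices k)
  have hmir : ∀ l k, v l ∈ A k → (v l).im = 0 → v l ∈ mirror '' A k := fun l k hl h0 =>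
    ⟨v l, hl, mirror_eq_iff.2 h0⟩
  have other : ∀ l, mirror '' A l = A l → ((v l).im = 0 ↔ (v (l + 1)).im = 0) := by
    intro l hl
    have hne : l ≠ l + 1 := (by decide : ∀ l : Fin 4, l ≠ l + 1) l
    have key : ∀ a b : ℂ, a ≠ b → a ∈ Γ.vertices → b ∈ Γ.vertices → IsArc (A l) a b →
        a.im = 0 → b.im = 0 := by
      intro a b hab ha hb harc h0
      obtain ⟨x, hx, hxa, hax, hx0, -⟩ :=
        h.mirror_fixed_edge (hA l).1 hl ha harc.left_mem (harc.not_loop hab) h0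
      rcases (ends_of_isArc (hA l).1 ha hx hax).2 b harc.right_mem hb with e | e
      · exact absurd e.symm hab
      · rwa [e]
    have hv : v l ≠ v (l + 1) := fun e => hne (hs.1 e)
    exact ⟨key _ _ hv (hV _) (hV _) (hA l).2, key _ _ hv.symm (hV _) (hV _) (hA l).2.symm⟩
  have hinj := hs.edge_injective hA
  have r0 : (v j).im = 0 := hr.elim id (other j hj).2
  have r1 : (v (j + 1)).im = 0 := (other j hj).1 r0
  have ne1 : j ≠ j + 1 := (by decide : ∀ j : Fin 4, j ≠ j + 1) j
  have ne2 : j ≠ j + 3 := (by decide : ∀ j : Fin 4, j ≠ j + 3) j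
  have ne3 : j + 1 ≠ j + 2 := (by decide : ∀ j : Fin 4, j + 1 ≠ j + 2) j
  have ne4 : j + 3 ≠ j + 2 := (by decide : ∀ j : Fin 4, j + 3 ≠ j + 2) j
  have e4 : j + 3 + 1 = j := (by decide : ∀ j : Fin 4, j + 3 + 1 = j) j
  have e3 : j + 2 + 1 = j + 3 := (by decide : ∀ j : Fin 4, j + 2 + 1 = j + 3) j
  have e2 : j + 1 + 1 = j + 2 := (by decide : ∀ j : Fin 4, j + 1 + 1 = j + 2) j
  have ne5 : j + 1 ≠ j + 3 := (by decide : ∀ j : Fin 4, j + 1 ≠ j + 3) j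
  have ne6 : j ≠ j + 2 := (by decide : ∀ j : Fin 4, j ≠ j + 2) j
  -- One of the two remaining vertices is real by definition. The edge joining it to `A j` is not
  -- fixed by the reflection, since it shares a real vertex with the fixed edge `A j`. So the edge
  -- opposite to `A j` is either fixed, which makes the last vertex real, or the mirror image of the
  -- joining edge; the latter would make it contain a vertex of `A j`.
  have all : (v (j + 2)).im = 0 ∧ (v (j + 3)).im = 0 := by
    have h23 : (v (j + 2)).im = 0 ∨ (v (j + 3)).im = 0 := by
      have h4 := hs.2.2.2.2
      fin_cases j
      · exact Or.inl h4.2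
      · exact Or.inr h4.1
      · exact Or.inl h4.1
      · exact Or.inr h4.2
    rcases h23 with r2 | r3
    · refine ⟨r2, ?_⟩
      have m1 : v (j + 1) ∈ A (j + 1) := (hs.mem_edge_iff hA).2 (Or.inl rfl)
      have m2 : v (j + 2) ∈ A (j + 1) := (hs.mem_edge_iff hA).2 (Or.inr e2.symm)
      have m3 : v (j + 2) ∈ A (j + 2) := (hs.mem_edge_iff hA).2 (Or.inl rfl)
      have nf : mirror '' A (j + 1) ≠ A (j + 1) := fun hc => ne1 (hinj
        (h.fixed_unique (hs.mem_vertices (j + 1)) r1 (hA j).1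
          ((hs.mem_edge_iff hA).2 (Or.inr rfl)) (hA (j + 1)).1 m1 hj hc))
      rcases h.fixed_or_mirror (hs.mem_vertices (j + 2)) r2 (hA (j + 1)).1 m2 (hA (j + 2)).1 m3
        (fun e => ne3 (hinj e)) nf with hf | hf
      · rw [← e3]
        exact (other (j + 2) hf).1 r2
      · have := hmir _ _ m1 r1
        rw [← hf, hs.mem_edge_iff hA, e3] at this
        exact (this.elim ne3 ne5).elim
    · refine ⟨?_, r3⟩
      have m1 : v j ∈ A (j + 3) := (hs.mem_edge_iff hA).2 (Or.inr e4.symm)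
      have m2 : v (j + 3) ∈ A (j + 3) := (hs.mem_edge_iff hA).2 (Or.inl rfl)
      have m3 : v (j + 3) ∈ A (j + 2) := (hs.mem_edge_iff hA).2 (Or.inr e3.symm)
      have nf : mirror '' A (j + 3) ≠ A (j + 3) := fun hc => ne2 (hinj
        (h.fixed_unique (hs.mem_vertices j) r0 (hA j).1
          ((hs.mem_edge_iff hA).2 (Or.inl rfl)) (hA (j + 3)).1 m1 hj hc))
      rcases h.fixed_or_mirror (hs.mem_vertices (j + 3)) r3 (hA (j + 3)).1 m2 (hA (j + 2)).1 m3
        (fun e => ne4 (hinj e)) nf with hf | hf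
      · rw [other (j + 2) hf, e3]
        exact r3
      · have := hmir _ _ m1 r0
        rw [← hf, hs.mem_edge_iff hA, e3] at this
        exact (this.elim ne6 ne2).elim
  have hk := (by decide : ∀ k j : Fin 4, k = j ∨ k = j + 1 ∨ k = j + 2 ∨ k = j + 3) k j
  rcases hk with rfl | rfl | rfl | rfl
  exacts [r0, r1, all.1, all.2]

end IsMoveSymmetric

end PlabicGraph

theorem IsArcParam.eventually_mem_start {A : Set ℂ} {u v : ℂ} {m : ℕ} {p : ℕ → ℂ}
    (h : IsArcParam A u v m p) (huv : u ≠ v) :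
    ∀ᶠ z in 𝓝 u, z ≠ u → (z ∈ A ↔ ∃ t : ℝ, 0 < t ∧ z = u + t * (p 1 - p 0)) := by
  have h1 := h.eventually_mem_iff (x := p 0) fun l hl s hs => h.breakpoint_ne (Nat.zero_le _) hl hs
  rw [h.start] at h1
  filter_upwards [h1] with z hz hzu
  rw [hz hzu]
  constructor
  · rintro ⟨k, hk, ⟨e, h2⟩ | ⟨e, h2⟩⟩
    · have hk0 : k = 0 := by
        by_contra hc
        exact (h.breakpoint_mem_sdiff (Nat.pos_of_ne_zero hc) hk).2 (Or.inl e)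
      subst hk0
      exact h2
    · rcases (Nat.succ_le_of_lt hk).lt_or_eq with h5 | h5
      · exact absurd (Or.inl e) (h.breakpoint_mem_sdiff (Nat.succ_pos k) h5).2
      · exact absurd (by rw [← e, ← h.finish, ← h5]) huv
  · exact fun h2 => ⟨0, h.pos, Or.inl ⟨h.start, h2⟩⟩

/-! ### There are no vertices on the midline. -/

namespace PlabicGraph

variable {n : ℕ} {Γ : PlabicGraph n}

/-- If close to the point `w` of the midline, the graph has above the midline only one ray, and the
midline (apart from `w`) does not meet the closure of a face, then this face does not come close
to `w` from above. -/
theorem eventually_notMem_face_above (i : Γ.Face) {w d : ℂ} (hd : 0 < d.im) (hw : w ∈ openRect)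
    (h0 : w.im = 0)
    (h1 : ∀ᶠ z in 𝓝 w, 0 < z.im → z ∈ Γ.vertices ∪ ⋃₀ Γ.edges →
      ((starRingEnd ℂ) d * (z - w)).im = 0)
    (h2 : ∀ᶠ z in 𝓝 w, 0 < z.im → ((starRingEnd ℂ) d * (z - w)).im = 0 →
      z ∈ Γ.vertices ∪ ⋃₀ Γ.edges)
    (h3 : ∀ᶠ z in 𝓝 w, z.im = 0 → z ≠ w → z ∉ closure i.1) :
    ∀ᶠ z in 𝓝 w, 0 < z.im → z ∉ i.1 := by
  obtain ⟨r, hr, hr'⟩ := Metric.eventually_nhds_iff_ball.1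
    ((h1.and h2).and (h3.and (isOpen_openRect.mem_nhds hw)))
  filter_upwards [Metric.ball_mem_nhds w hr] with z hz hz0 hzi
  set f : ℂ → ℝ := fun x => ((starRingEnd ℂ) d * (x - w)).im with hf
  have hfz : f z ≠ 0 := fun hc => (face_subset_complement i hzi).2 ((hr' z hz).1.2 hz0 hc)
  have hff : ∀ x : ℂ, f x = d.re * x.im - d.im * (x.re - w.re) := by
    intro x
    simp [hf, h0]
    ring
  -- `U` is the one of the two sectors above the midline that contains `z`. It is convex and misses
  -- the graph, so it lies in the face. As `0 < d.im`, it borders on the midline at the point `w - δ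
  -- * f z`, which therefore is in the closure of the face.
  set U : Set ℂ := Metric.ball w r ∩ {x | 0 < x.im ∧ 0 < f x * f z} with hU
  have hUc : Convex ℝ U := by
    refine (convex_ball w r).inter ?_
    intro x hx y hy s t hs ht hst
    have e1 : (s • x + t • y).im = s * x.im + t * y.im := by simp
    have e2 : f (s • x + t • y) * f z = s * (f x * f z) + t * (f y * f z) := by
      have : w.re = (s + t) * w.re := by rw [hst, one_mul]
      rw [hff, hff x, hff y, e1]
      simp only [Complex.add_re, Complex.real_smul, Complex.re_ofReal_mul]
      linear_combination d.im * f z * this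
    change 0 < (s • x + t • y).im ∧ 0 < f (s • x + t • y) * f z
    rw [e1, e2]
    rcases hs.lt_or_eq with h5 | h5
    · constructor
      · have := mul_pos h5 hx.1
        have := mul_nonneg ht hy.1.le
        linarith
      · have := mul_pos h5 hx.2
        have := mul_nonneg ht hy.2.le
        linarith
    · rw [← h5, zero_add] at hst
      rw [← h5, hst, zero_mul, one_mul, zero_mul, one_mul, zero_add, zero_add]
      exact hy
  have hUG : U ⊆ Γ.complement := by
    rintro x ⟨hx, hx0, hx1⟩
    refine ⟨openRect_subset_rect (hr' x hx).2.2, fun hc => ?_⟩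
    have : f x = 0 := (hr' x hx).1.1 hx0 hc
    rw [this, zero_mul] at hx1
    exact hx1.false
  have hUi : U ⊆ i.1 := subset_face hUc.isPreconnected hUG
    ⟨hz, hz0, mul_self_pos.2 hfz⟩ hzi
  have hc1 : Continuous fun t : ℝ => w - t * f z := by fun_prop
  have hc1' := hc1.tendsto 0
  simp only [Complex.ofReal_zero, zero_mul, sub_zero] at hc1'
  obtain ⟨δ, hδ, hδ0⟩ := (((hc1'.mono_left (nhdsWithin_le_nhds (s := Ioi 0))).eventually
    (Metric.ball_mem_nhds w hr)).and self_mem_nhdsWithin).exists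
  have hδ0 : 0 < δ := hδ0
  refine (hr' _ hδ).2.1 (by simp [h0]) ?_ ?_
  · intro hc
    have h6 : (δ * f z : ℂ) = 0 := by linear_combination -hc
    have h7 : δ * f z = 0 := by exact_mod_cast h6
    exact (mul_ne_zero hδ0.ne' hfz) h7
  · have hc2 : Continuous fun ε : ℝ => w - δ * f z + ε * Complex.I := by fun_prop
    have hc2' := hc2.tendsto 0
    simp only [Complex.ofReal_zero, zero_mul, add_zero] at hc2'
    have hc2'' := hc2'.mono_left (nhdsWithin_le_nhds (s := Ioi 0))
    refine mem_closure_of_tendsto hc2'' ?_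
    have hc3 : Continuous fun ε : ℝ => (d.re * ε + d.im * (δ * f z)) * f z := by fun_prop
    have hpos : 0 < (d.re * 0 + d.im * (δ * f z)) * f z := by
      have := mul_pos (mul_pos hd hδ0) (mul_self_pos.2 hfz)
      linarith
    filter_upwards [hc2''.eventually (Metric.isOpen_ball.mem_nhds hδ), self_mem_nhdsWithin,
      nhdsWithin_le_nhds ((hc3.tendsto 0).eventually (lt_mem_nhds hpos))] with ε h6 h7 h8
    refine hUi ⟨h6, ?_, ?_⟩
    · simpa [h0] using h7
    · rw [hff]
      simpa [h0] using h8

theorem eventually_graph_at (Γ : PlabicGraph n) (w : ℂ) : ∀ᶠ z in 𝓝 w, z ≠ w →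
    z ∈ Γ.vertices ∪ ⋃₀ Γ.edges → z ∉ Γ.vertices ∧ ∃ A ∈ Γ.edges, w ∈ A ∧ z ∈ A := by
  have h1 : ∀ᶠ z in 𝓝 w, ∀ B ∈ Γ.finite_edges.toFinset, w ∉ B → z ∉ B := by
    rw [Filter.eventually_all_finset]
    intro B hB
    have hB := Γ.finite_edges.mem_toFinset.1 hB
    by_cases e : w ∈ B
    · exact Filter.Eventually.of_forall fun z hne => absurd e hne
    · exact Filter.mem_of_superset ((isClosed_edge hB).isOpen_compl.mem_nhds e) fun z hz _ => hz
  have h2 : ∀ᶠ z in 𝓝 w, z ∉ Γ.vertices \ {w} :=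
    (finite_vertices.subset sdiff_subset).isClosed.isOpen_compl.mem_nhds fun h => h.2 rfl
  filter_upwards [h1, h2] with z h1 h2 hzw hz
  have hzv : z ∉ Γ.vertices := fun hc => h2 ⟨hc, hzw⟩
  refine ⟨hzv, ?_⟩
  obtain ⟨A, hA, hzA⟩ := hz.resolve_left hzv
  refine ⟨A, hA, ?_, hzA⟩
  by_contra hc
  exact h1 A (Γ.finite_edges.mem_toFinset.2 hA) hc hzA

namespace IsMoveSymmetric

variable (h : Γ.IsMoveSymmetric)
include h

/-- Of the two mirror edges, `a` is the one that starts upwards. Neither starts horizontally,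
because it would then share points other than vertices with its mirror image. -/
theorem edges_at_upper {w : ℂ} (hw : w ∈ Γ.white ∪ Γ.black) (h0 : w.im = 0) :
    ∃ (e a : Set ℂ) (d : ℂ), {A ∈ Γ.edges | w ∈ A} = {e, a, mirror '' a} ∧ mirror '' e = e ∧
      mirror '' a ≠ a ∧ 0 < d.im ∧
      ∀ᶠ z in 𝓝 w, z ≠ w → (z ∈ a ↔ ∃ t : ℝ, 0 < t ∧ z = w + t * d) := by
  obtain ⟨e, a, hE, hme, hma, -⟩ := h.edges_at hw h0
  have hwv : w ∈ Γ.vertices := Or.inr hw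
  have ha : a ∈ {A ∈ Γ.edges | w ∈ A} := hE ▸ Or.inr (Or.inl rfl)
  obtain ⟨x, hx, hxw, m, p, hp⟩ :=
    exists_other_end ha.1 hwv ha.2 ((h.isTrivalent hw h0).2 a ha.1)
  have hstart := hp.eventually_mem_start hxw.symm
  have hd : (p 1 - p 0).im ≠ 0 := by
    intro hc
    have hs : (1 / 2 : ℝ) ∈ Ioo (0 : ℝ) 1 := by norm_num
    have h1 := hp.lineMap_mem_sdiff hp.pos hs
    have h2 := (eventually_graph_of_mem_edge ha.1 hwv hx ⟨m, p, hp⟩ h1).2.1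
    refine hma (edge_eq_of_mem (h.mirror_edge ha.1) ha.1 ?_ h1.1 h2)
    refine mem_mirror_image.2 ?_
    rw [mirror_eq_iff.2]
    · exact h1.1
    · have h3 : (p 1 - w).im = 0 := by rw [← hp.start]; exact hc
      rw [lineMap_eq_add, hp.start, Complex.add_im, Complex.im_ofReal_mul, zero_add, h3, h0]
      simp
  rcases lt_or_gt_of_ne hd with h1 | h1
  · refine ⟨e, mirror '' a, mirror (p 1 - p 0), ?_, hme, ?_, ?_, ?_⟩
    · rw [hE, mirror_image_image, pair_comm]
    · rw [mirror_image_image]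
      exact hma.symm
    · exact neg_pos.2 h1
    · have hcont := mirror.continuous.tendsto w
      rw [mirror_eq_iff.2 h0] at hcont
      filter_upwards [hcont.eventually hstart] with z hz hzw
      have hzw' : mirror z ≠ w := fun e => hzw (by
        rw [← mirror_mirror z, e, mirror_eq_iff.2 h0])
      rw [mem_mirror_image, hz hzw']
      refine exists_congr fun t => and_congr_right fun ht => ?_
      rw [← mirror.injective.eq_iff, mirror_mirror]
      have : mirror (w + t * (p 1 - p 0)) = w + t * mirror (p 1 - p 0) := by
        have e1 : (starRingEnd ℂ) w = w := mirror_eq_iff.2 h0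
        change (starRingEnd ℂ) (w + t * (p 1 - p 0)) = w + t * (starRingEnd ℂ) (p 1 - p 0)
        rw [map_add, map_mul, Complex.conj_ofReal, e1]
      rw [this]
  · exact ⟨e, a, p 1 - p 0, hE, hme, hma, h1, hstart⟩

/-- There is no vertex on the midline. -/
theorem im_ne_zero (hn : Even n) {z : ℂ} (hz : z ∈ Γ.vertices) : z.im ≠ 0 := by
  rcases hz with hz | hz
  · exact h.boundary_im_ne_zero hn hz
  intro hz0
  -- `w` is a leftmost vertex on the midline; the contradiction comes from the number of midline
  -- squares at `w`.
  obtain ⟨w, ⟨hw, hw0⟩, hmin⟩ := exists_min_image {z ∈ Γ.white ∪ Γ.black | z.im = 0} Complex.re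
    ((Γ.finite_white.union Γ.finite_black).subset fun _ hz => hz.1) ⟨z, hz, hz0⟩
  clear hz0 hz z
  have hmin' : ∀ z ∈ Γ.vertices, z.im = 0 → w.re ≤ z.re := by
    rintro z (hz | hz) hz0
    · exact absurd hz0 (h.boundary_im_ne_zero hn hz)
    · exact hmin z ⟨hz, hz0⟩
  have hwv : w ∈ Γ.vertices := Or.inr hw
  have hwo : w ∈ openRect := EdgeParams.openRect_of_color hw
  have hwre : -1 < w.re := (abs_lt.1 hwo.1).1
  -- Every edge of a midline square has a real end. If such an edge contained a midline point left
  -- of `w`, it would equal its mirror image and thus be a midline segment between vertices, none of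
  -- which is left of `w`. So the midline left of `w` misses the frontier of the face, and by
  -- connectedness also its closure, since the face does not surround the point `-1` on the side of
  -- the rectangle.
  have hleft : ∀ (i : Γ.Face) (v : Fin 4 → ℂ), Γ.IsMidlineSquareWith i v → ∀ z : ℂ, z.im = 0 →
      -1 ≤ z.re → z.re < w.re → z ∉ closure i.1 := by
    intro i v hs
    obtain ⟨A, hA, hfr⟩ := hs.2.2.2.1
    set L : Set ℂ := Complex.ofReal '' Ico (-1) w.re with hL
    have hLA : ∀ z ∈ L, z ∉ frontier i.1 := by
      rintro _ ⟨t, ht, rfl⟩ hc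
      rw [hfr, mem_iUnion] at hc
      obtain ⟨k, hk⟩ := hc
      have htv : (t : ℂ) ∉ Γ.vertices := fun hv => by
        have := hmin' _ hv (Complex.ofReal_im t)
        rw [Complex.ofReal_re] at this
        exact this.not_gt ht.2
      have hm : mirror '' A k = A k := by
        refine edge_eq_of_mem (h.mirror_edge (hA k).1) (hA k).1 (mem_mirror_image.2 ?_) hk htv
        rwa [mirror_eq_iff.2 (Complex.ofReal_im t)]
      obtain ⟨l, hl, hl0⟩ : ∃ l, v l ∈ A k ∧ (v l).im = 0 := by
        have h4 := hs.2.2.2.2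
        fin_cases k
        · exact ⟨0, (hA 0).2.left_mem, h4.1⟩
        · exact ⟨2, (hA 1).2.right_mem, h4.2⟩
        · exact ⟨2, (hA 2).2.left_mem, h4.2⟩
        · exact ⟨0, (hA 3).2.right_mem, h4.1⟩
      have hlv : v l ∈ Γ.vertices := Or.inr (hs.mem_vertices l)
      obtain ⟨x, hx, -, -, hx0, hE⟩ := h.mirror_fixed_edge (hA k).1 hm hlv hl
        ((hs.isTrivalent l).2 _ (hA k).1) hl0
      rw [hE] at hk
      obtain ⟨t', ht', e⟩ := hk
      have e := Complex.ofReal_injective e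
      subst e
      have h5 := (le_min (hmin' _ hlv hl0) (hmin' _ hx hx0)).trans ht'.1
      exact h5.not_gt ht.2
    have hLc : IsPreconnected L :=
      isPreconnected_Ico.image _ Complex.continuous_ofReal.continuousOn
    have hLm : ((-1 : ℝ) : ℂ) ∈ L := mem_image_of_mem _ ⟨le_rfl, hwre⟩
    have hint : ((-1 : ℝ) : ℂ) ∉ interior i.1 := by
      intro hc
      have hcont : Continuous fun t : ℝ => (((-1 : ℝ) - t : ℝ) : ℂ) := by fun_prop
      have h5 := hcont.tendsto 0
      rw [sub_zero] at h5
      obtain ⟨t, ht, ht0⟩ := (((h5.mono_left (nhdsWithin_le_nhds (s := Ioi 0))).eventually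
        (mem_interior_iff_mem_nhds.1 hc)).and self_mem_nhdsWithin).exists
      have ht0 : 0 < t := ht0
      have h6 := (face_subset_complement i ht).1.1
      rw [Complex.ofReal_re, abs_le] at h6
      linarith [h6.1]
    have hsub : L ⊆ (closure i.1)ᶜ := by
      refine hLc.subset_left_of_subset_union isClosed_closure.isOpen_compl
        (isOpen_interior (s := i.1)) ?_ ?_ ⟨_, hLm, ?_⟩
      · exact disjoint_left.2 fun x hx hx' => hx (interior_subset_closure hx')
      · intro x hx
        by_contra hc
        rw [mem_union, not_or] at hc
        exact hLA x hx ⟨not_not.1 hc.1, hc.2⟩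
      · exact fun hc => hLA _ hLm ⟨hc, hint⟩
    intro z hz0 h1 h2
    refine hsub ⟨z.re, ⟨h1, h2⟩, ?_⟩
    apply Complex.ext <;> simp [hz0]
  obtain ⟨e, a, d, hE, hme, hma, hd, hray⟩ := h.edges_at_upper hw hw0
  have he : e ∈ {A ∈ Γ.edges | w ∈ A} := hE ▸ Or.inl rfl
  have ha : a ∈ {A ∈ Γ.edges | w ∈ A} := hE ▸ Or.inr (Or.inl rfl)
  obtain ⟨x, hx, hxw, harc, hx0, heq⟩ :=
    h.mirror_fixed_edge he.1 hme hwv he.2 ((h.isTrivalent hw hw0).2 e he.1) hw0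
  have hxre : w.re < x.re := lt_of_le_of_ne (hmin' x hx hx0) fun e' =>
    hxw (Complex.ext e'.symm (hx0.trans hw0.symm))
  have hcm := mirror.continuous.tendsto w
  rw [mirror_eq_iff.2 hw0] at hcm
  have hmw : ∀ z, z ≠ w → mirror z ≠ w := fun z hzw e' => hzw (by
    rw [← mirror_mirror z, e', mirror_eq_iff.2 hw0])
  have himd : ∀ t : ℝ, (w + t * d).im = t * d.im := fun t => by simp [hw0]
  have g1 : ∀ᶠ z in 𝓝 w, 0 < z.im → z ∈ Γ.vertices ∪ ⋃₀ Γ.edges →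
      ((starRingEnd ℂ) d * (z - w)).im = 0 := by
    filter_upwards [eventually_graph_at Γ w, hray, hcm.eventually hray] with z h1 h2 h3 hz0 hzG
    have hzw : z ≠ w := fun e' => by rw [e', hw0] at hz0; exact hz0.false
    obtain ⟨-, A, hA, hwA, hzA⟩ := h1 hzw hzG
    have : A ∈ ({e, a, mirror '' a} : Set (Set ℂ)) := hE ▸ ⟨hA, hwA⟩
    rcases this with rfl | rfl | rfl
    · rw [heq] at hzA
      obtain ⟨t, -, rfl⟩ := hzA
      simp at hz0
    · obtain ⟨t, ht, rfl⟩ := (h2 hzw).1 hzA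
      rw [add_sub_cancel_left]
      simp
      ring
    · obtain ⟨t, ht, e'⟩ := (h3 (hmw z hzw)).1 (mem_mirror_image.1 hzA)
      have h4 := congrArg Complex.im e'
      rw [himd] at h4
      have h5 : (mirror z).im = -z.im := Complex.conj_im z
      have := mul_pos ht hd
      linarith
  have g2 : ∀ᶠ z in 𝓝 w, 0 < z.im → ((starRingEnd ℂ) d * (z - w)).im = 0 →
      z ∈ Γ.vertices ∪ ⋃₀ Γ.edges := by
    filter_upwards [hray] with z h2 hz0 hz1
    have hzw : z ≠ w := fun e' => by rw [e', hw0] at hz0; exact hz0.false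
    refine Or.inr ⟨a, ha.1, (h2 hzw).2 ⟨z.im / d.im, div_pos hz0 hd, ?_⟩⟩
    simp [hw0] at hz1
    apply Complex.ext
    · simp
      field_simp
      linarith
    · rw [himd]
      field_simp
  -- If `e` were not an edge of the square, the midline near `w` would avoid the closure of the face
  -- on both sides of `w`. Then neither the face nor its reflection comes near `w` from above, so
  -- the face does not come near `w` at all.
  have hmem : ∀ (i : Γ.Face) (v : Fin 4 → ℂ) (A : Fin 4 → Set ℂ), Γ.IsMidlineSquareWith i v →
      (∀ k, A k ∈ Γ.edges ∧ IsArc (A k) (v k) (v (k + 1))) → frontier i.1 = ⋃ k, A k →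
      w ∈ frontier i.1 → ∃ j, A j = e := by
    intro i v A hs hA hfr hwi
    by_contra! hne
    have g3 : ∀ᶠ z in 𝓝 w, z.im = 0 → z ≠ w → z ∉ closure i.1 := by
      filter_upwards [eventually_graph_at Γ w,
        (Complex.continuous_re.tendsto w).eventually (gt_mem_nhds hxre),
        (Complex.continuous_re.tendsto w).eventually (lt_mem_nhds hwre)] with z h1 h2 h3 hz0 hzw
      have hre : (z.re : ℂ) = z := by apply Complex.ext <;> simp [hz0]
      rcases lt_or_ge z.re w.re with h4 | h4
      · exact hleft i v hs z hz0 h3.le h4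
      · intro hc
        have hze : z ∈ e := by
          rw [heq, ← hre]
          exact mem_image_of_mem _ (Icc_subset_uIcc ⟨h4, h2.le⟩)
        have hzG : z ∈ Γ.vertices ∪ ⋃₀ Γ.edges := Or.inr ⟨e, he.1, hze⟩
        have hfz : z ∈ frontier i.1 :=
          ⟨hc, fun hi => (face_subset_complement i (interior_subset hi)).2 hzG⟩
        rw [hfr, mem_iUnion] at hfz
        obtain ⟨j, hj⟩ := hfz
        exact hne j (edge_eq_of_mem (hA j).1 he.1 hj hze (h1 hzw hzG).1)
    have g4 : ∀ᶠ z in 𝓝 w, z.im = 0 → z ≠ w → z ∉ closure (reflect h i).1 := by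
      filter_upwards [hcm.eventually g3] with z hz hz0 hzw hc
      rw [mirror_eq_iff.2 hz0] at hz
      refine hz hz0 hzw ?_
      change z ∈ closure (mirror '' i.1) at hc
      rwa [← mirror.image_closure, mem_mirror_image, mirror_eq_iff.2 hz0] at hc
    have g5 := eventually_notMem_face_above i hd hwo hw0 g1 g2 g3
    have g6 := eventually_notMem_face_above (reflect h i) hd hwo hw0 g1 g2 g4
    have g7 : ∀ᶠ z in 𝓝 w, z ∉ i.1 := by
      filter_upwards [g3, g5, hcm.eventually g6] with z h3 h5 h6 hzi
      rcases lt_trichotomy z.im 0 with h7 | h7 | h7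
      · refine h6 ?_ (mem_image_of_mem _ hzi)
        have : (mirror z).im = -z.im := Complex.conj_im z
        linarith
      · by_cases hzw : z = w
        · exact (face_subset_complement i hzi).2 (Or.inl (hzw ▸ hwv))
        · exact h3 h7 hzw (subset_closure hzi)
      · exact h5 h7 hzi
    exact (mem_closure_iff_frequently.1 hwi.1) g7
  -- Every midline square at `w` has `e` as an edge, hence only real vertices, so its reflection is
  -- a midline square with the same vertices. This pairs off an odd number of squares.
  have hodd := h.mem_recolored hw hw0
  refine Nat.not_even_iff_odd.2 hodd (even_ncard_of_involution (toFinite _) (reflect h) ?_)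
  rintro i ⟨v, hs, k, rfl⟩
  obtain ⟨A, hA, hfr⟩ := hs.2.2.2.1
  have hwi : v k ∈ frontier i.1 := hfr ▸ mem_iUnion.2 ⟨k, (hA k).2.left_mem⟩
  obtain ⟨j, rfl⟩ := hmem i v A hs hA hfr hwi
  have hjk := (hs.mem_edge_iff hA).1 he.2
  have hreal : ∀ l, mirror (v l) = v l := fun l => mirror_eq_iff.2 (h.square_real hs hA hme (by
    rcases hjk with rfl | rfl
    · exact Or.inl hw0
    · exact Or.inr hw0) l)
  have hfr' : frontier (reflect h i).1 = ⋃ l, mirror '' A l := by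
    change frontier (mirror '' i.1) = _
    rw [← mirror.image_frontier, hfr, image_iUnion]
  refine ⟨⟨v, ⟨hs.1, hs.2.1, hs.2.2.1, ⟨fun l => mirror '' A l, fun l =>
    ⟨h.mirror_edge (hA l).1, ?_⟩, hfr'⟩, hs.2.2.2.2⟩, k, rfl⟩, ?_, ?_⟩
  · have := (hA l).2.mirror
    rwa [hreal, hreal] at this
  -- A square equal to its reflection is impossible: besides `e` it has another edge at `w`, which
  -- is not fixed by the reflection, and the mirror image of that edge would be a third edge of the
  -- square at `w`.
  · intro hri
    obtain ⟨l, hl, hlj⟩ : ∃ l, v k ∈ A l ∧ A l ≠ A j := by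
      have hne1 := (by decide : ∀ k : Fin 4, k ≠ k + 1) j
      have hne2 := (by decide : ∀ k : Fin 4, k - 1 ≠ k) j
      rcases hjk with rfl | rfl
      · exact ⟨k - 1, (hs.mem_edge_iff hA).2 (Or.inr (sub_add_cancel _ _).symm),
          fun e' => hne2 (hs.edge_injective hA e')⟩
      · exact ⟨j + 1, (hs.mem_edge_iff hA).2 (Or.inl rfl),
          fun e' => hne1 (hs.edge_injective hA e').symm⟩
    have hlm : mirror '' A l ≠ A l := fun hc =>
      hlj (h.fixed_unique hw hw0 (hA l).1 hl he.1 he.2 hc hme)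
    obtain ⟨y, hy, hyv⟩ := exists_mem_edge_notMem_vertices (h.mirror_edge (hA l).1)
    have hyf : y ∈ frontier i.1 := by
      rw [← hri, hfr']
      exact mem_iUnion.2 ⟨l, hy⟩
    rw [hfr, mem_iUnion] at hyf
    obtain ⟨l', hl'⟩ := hyf
    have e1 := edge_eq_of_mem (hA l').1 (h.mirror_edge (hA l).1) hl' hy hyv
    have hk' : v k ∈ A l' := by
      rw [e1]
      exact ⟨v k, hl, hreal k⟩
    have h1 : l' ≠ j := fun e' => hlj (by
      rw [e'] at e1
      rw [← mirror_image_image (A l), ← e1, hme])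
    have h2 : l' ≠ l := fun e' => hlm (by rw [← e1, e'])
    have h3 : l ≠ j := fun e' => hlj (by rw [e'])
    rw [hs.mem_edge_iff hA] at hl hk'
    exact (by decide : ∀ k j l m : Fin 4, (k = j ∨ k = j + 1) → (k = l ∨ k = l + 1) →
      (k = m ∨ k = m + 1) → m ≠ j → m ≠ l → l ≠ j → False) k j l l' hjk hl hk' h1 h2 h3
  · exact Subtype.ext (mirror_image_image i.1)

end IsMoveSymmetric

end PlabicGraph

/-! ### The reflection of faces, weights and the quiver. -/

theorem LiesLeft.mirror {A : Set ℂ} {u v : ℂ} {F : Set ℂ} (h : LiesLeft A u v F) :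
    LiesRight (mirror '' A) (mirror u) (mirror v) (mirror '' F) := by
  obtain ⟨m, p, hp, k, hk, s, hs, hev⟩ := h
  refine ⟨m, _, hp.map, k, hk, s, hs, ?_⟩
  filter_upwards [hev] with ε hε
  refine ⟨_, hε, ?_⟩
  simp [_root_.mirror, lineMap_eq_add]
  ring

theorem LiesRight.mirror {A : Set ℂ} {u v : ℂ} {F : Set ℂ} (h : LiesRight A u v F) :
    LiesLeft (mirror '' A) (mirror u) (mirror v) (mirror '' F) := by
  obtain ⟨m, p, hp, k, hk, s, hs, hev⟩ := h
  refine ⟨m, _, hp.map, k, hk, s, hs, ?_⟩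
  filter_upwards [hev] with ε hε
  refine ⟨_, hε, ?_⟩
  simp [_root_.mirror, lineMap_eq_add]

theorem LiesLeft.reverse {A : Set ℂ} {u v : ℂ} {F : Set ℂ} (h : LiesLeft A u v F) :
    LiesRight A v u F := by
  obtain ⟨m, p, hp, k, hk, s, hs, hev⟩ := h
  refine ⟨m, _, hp.reverse, m - (k + 1), by omega, 1 - s,
    ⟨by linarith [hs.2], by linarith [hs.1]⟩, ?_⟩
  filter_upwards [hev] with ε hε
  have e1 : m - (m - (k + 1)) = k + 1 := by omega
  have e2 : m - (m - (k + 1) + 1) = k := by omega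
  simp only [e1, e2, AffineMap.lineMap_apply_one_sub]
  convert hε using 1
  ring

theorem LiesRight.reverse {A : Set ℂ} {u v : ℂ} {F : Set ℂ} (h : LiesRight A u v F) :
    LiesLeft A v u F := by
  obtain ⟨m, p, hp, k, hk, s, hs, hev⟩ := h
  refine ⟨m, _, hp.reverse, m - (k + 1), by omega, 1 - s,
    ⟨by linarith [hs.2], by linarith [hs.1]⟩, ?_⟩
  filter_upwards [hev] with ε hε
  have e1 : m - (m - (k + 1)) = k + 1 := by omega
  have e2 : m - (m - (k + 1) + 1) = k := by omega
  simp only [e1, e2, AffineMap.lineMap_apply_one_sub]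
  convert hε using 1
  ring

namespace PlabicGraph

variable {n : ℕ} {Γ : PlabicGraph n}

theorem reflect_reflect (h : Γ.IsMoveSymmetric) (i : Γ.Face) : reflect h (reflect h i) = i :=
  Subtype.ext (mirror_image_image i.1)

theorem reflect_of_onMidline (h : Γ.IsMoveSymmetric) {i : Γ.Face} (hi : Γ.OnMidline i) :
    reflect h i = i := by
  obtain ⟨z, hz, hz0⟩ := hi
  have hz := interior_subset hz
  exact face_eq_of_mem (mem_mirror_image.2 (by rwa [mirror_eq_iff.2 hz0])) hz

theorem reflect_ne_of_above (h : Γ.IsMoveSymmetric) {i : Γ.Face} (hi : Γ.Above i) :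
    reflect h i ≠ i := by
  intro e
  obtain ⟨z, hz⟩ := face_nonempty i
  have h1 : mirror z ∈ (reflect h i).1 := mem_image_of_mem _ hz
  rw [e] at h1
  have h2 := hi _ h1
  have h3 : (mirror z).im = -z.im := Complex.conj_im z
  linarith [hi z hz]

theorem not_isMidlineSquare (hn : Even n) (h : Γ.IsMoveSymmetric) (i : Γ.Face) :
    ¬ Γ.IsMidlineSquare i := by
  rintro ⟨v, hs⟩
  exact h.im_ne_zero hn (Or.inr (hs.mem_vertices 0)) hs.2.2.2.2.1

theorem recolored_eq_empty (hn : Even n) (h : Γ.IsMoveSymmetric) : Γ.recolored = ∅ := by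
  ext z
  have : {i : Γ.Face | ∃ v, Γ.IsMidlineSquareWith i v ∧ z ∈ range v} = ∅ := by
    ext i
    refine iff_of_false ?_ (notMem_empty i)
    rintro ⟨v, hs, -⟩
    exact not_isMidlineSquare hn h i ⟨v, hs⟩
  rw [recolored, mem_ofPred_eq, this]
  simp

theorem mirror_white (hn : Even n) (h : Γ.IsMoveSymmetric) : mirror '' Γ.white = Γ.black := by
  have := h.white
  rwa [movedWhite, recolored_eq_empty hn h, sdiff_empty, inter_empty, union_empty] at this

theorem mirror_black (hn : Even n) (h : Γ.IsMoveSymmetric) : mirror '' Γ.black = Γ.white := by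
  rw [← mirror_white hn h, mirror_image_image]

theorem mirror_boundary (h : Γ.IsMoveSymmetric) : mirror '' Γ.boundary = Γ.boundary := by
  rw [boundary, image_union, h.left, h.right]

theorem sigma_eq (hn : Even n) (h : Γ.IsMoveSymmetric) (Y : Γ.Face → ℂ) (i : Γ.Face) :
    sigma h Y i = Y (reflect h i) := by
  have : IsEmpty {s : Γ.Face // Γ.IsMidlineSquare s} :=
    ⟨fun s => not_isMidlineSquare hn h s.1 s.2⟩
  rw [sigma, movedWeight, if_neg (not_isMidlineSquare hn h _), finprod_of_isEmpty, mul_one]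

theorem ncard_eq_of_mirror (h : Γ.IsMoveSymmetric) {P : Γ.Face → Γ.Face → Set ℂ → Prop}
    (hP : ∀ i j A, P i j A → P (reflect h i) (reflect h j) (mirror '' A)) (i j : Γ.Face) :
    {A ∈ Γ.edges | P (reflect h i) (reflect h j) A}.ncard = {A ∈ Γ.edges | P i j A}.ncard := by
  have : {A ∈ Γ.edges | P (reflect h i) (reflect h j) A} =
      (fun A => mirror '' A) '' {A ∈ Γ.edges | P i j A} := by
    ext A
    constructor
    · rintro ⟨hA, hPA⟩
      refine ⟨mirror '' A, ⟨h.mirror_edge hA, ?_⟩, mirror_image_image A⟩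
      have := hP _ _ _ hPA
      rwa [reflect_reflect, reflect_reflect] at this
    · rintro ⟨B, ⟨hB, hPB⟩, rfl⟩
      exact ⟨h.mirror_edge hB, hP _ _ _ hPB⟩
  rw [this, ncard_image_of_injective _ mirror.injective.image_injective]

/-- The reflection exchanges white and black and reverses the orientation of the plane. Running
through the mirror edge backwards undoes both changes. -/
theorem q_reflect (hn : Even n) (h : Γ.IsMoveSymmetric) (i j : Γ.Face) :
    Γ.q (reflect h i) (reflect h j) = Γ.q i j := by
  have hw : ∀ u ∈ Γ.white, mirror u ∈ Γ.black := fun u hu =>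
    mirror_white hn h ▸ mem_image_of_mem _ hu
  have hb : ∀ u ∈ Γ.black, mirror u ∈ Γ.white := fun u hu =>
    mirror_black hn h ▸ mem_image_of_mem _ hu
  have hbd : ∀ u ∈ Γ.boundary, mirror u ∈ Γ.boundary := fun u hu =>
    mirror_boundary h ▸ mem_image_of_mem _ hu
  have h1 : ∀ i j, Γ.wholeArrows (reflect h i) (reflect h j) = Γ.wholeArrows i j := by
    refine ncard_eq_of_mirror h (P := fun i j A => ∃ u ∈ Γ.white, ∃ v ∈ Γ.black, IsArc A u v ∧
      LiesRight A u v i.1 ∧ LiesLeft A u v j.1) ?_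
    rintro i j A ⟨u, hu, v, hv, harc, hr, hl⟩
    exact ⟨_, hb v hv, _, hw u hu, harc.mirror.symm, hr.mirror.reverse, hl.mirror.reverse⟩
  have h2 : ∀ i j, Γ.halfArrows (reflect h i) (reflect h j) = Γ.halfArrows i j := by
    refine ncard_eq_of_mirror h (P := fun i j A => ∃ b ∈ Γ.boundary,
      (∃ u ∈ Γ.white, IsArc A u b ∧ LiesRight A u b i.1 ∧ LiesLeft A u b j.1) ∨
      (∃ u ∈ Γ.black, IsArc A b u ∧ LiesRight A b u i.1 ∧ LiesLeft A b u j.1)) ?_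
    rintro i j A ⟨b, hbb, ⟨u, hu, harc, hr, hl⟩ | ⟨u, hu, harc, hr, hl⟩⟩
    · exact ⟨_, hbd b hbb, Or.inr
        ⟨_, hw u hu, harc.mirror.symm, hr.mirror.reverse, hl.mirror.reverse⟩⟩
    · exact ⟨_, hbd b hbb, Or.inl
        ⟨_, hb u hu, harc.mirror.symm, hr.mirror.reverse, hl.mirror.reverse⟩⟩
  rw [q, q, h1, h1, h2, h2]

theorem mem_closure_of_mem_leftGerm {F : Set ℂ} {y d : ℂ} (hd : d ≠ 0) (h : F ∈ leftGerm y d) :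
    y ∈ closure F :=
  have := tendsto_leftGerm_normal y hd
  mem_closure_of_tendsto (this.mono_right inf_le_left) (this.eventually_mem h)

/-- A face above the midline and a face below the midline are not adjacent. -/
theorem q_above_reflect (hn : Even n) (h : Γ.IsMoveSymmetric) {i j : Γ.Face} (hi : Γ.Above i)
    (hj : Γ.Above j) : Γ.q i (reflect h j) = 0 := by
  classical
  obtain ⟨E⟩ := nonempty_edgeParams (Γ := Γ)
  have hci : ∀ z ∈ closure i.1, 0 ≤ z.im := by
    have : IsClosed {z : ℂ | 0 ≤ z.im} := isClosed_le continuous_const Complex.continuous_im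
    exact fun z hz => closure_minimal (fun z hz => (hi z hz).le) this hz
  have hcj : ∀ z ∈ closure (reflect h j).1, z.im ≤ 0 := by
    have : IsClosed {z : ℂ | z.im ≤ 0} := isClosed_le Complex.continuous_im continuous_const
    refine fun z hz => closure_minimal ?_ this hz
    rintro _ ⟨w, hw, rfl⟩
    exact neg_nonpos.2 (hj w hw).le
  -- An edge with these faces on its two sides lies in both closed half-planes along its first
  -- segment, so its initial vertex would be on the midline.
  have key : ∀ A, (∀ s ∈ Ioo (0 : ℝ) 1, (AffineMap.lineMap (E.p A 0) (E.p A 1) s : ℂ) ∈ closure i.1 ∧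
      (AffineMap.lineMap (E.p A 0) (E.p A 1) s : ℂ) ∈ closure (reflect h j).1) → False := by
    intro A hA
    refine h.im_ne_zero hn (E.start_mem A) ?_
    have h1 : ∀ s ∈ Ioo (0 : ℝ) 1, (E.p A 0).im + s * ((E.p A 1).im - (E.p A 0).im) = 0 := by
      intro s hs
      have h2 := hA s hs
      rw [lineMap_eq_add] at h2
      have h3 := le_antisymm (hcj _ h2.2) (hci _ h2.1)
      simpa using h3
    have h4 := h1 (1 / 3) (by norm_num)
    have h5 := h1 (2 / 3) (by norm_num)
    linarith
  rw [E.q_eq_sum]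
  refine Finset.sum_eq_zero fun A _ => ?_
  have hm := (E.isArcParam A).pos
  have hd : E.p A 1 - E.p A 0 ≠ 0 := sub_ne_zero.2 ((E.isArcParam A).ne_succ hm).symm
  have hsides : ∀ s ∈ Ioo (0 : ℝ) 1,
      (AffineMap.lineMap (E.p A 0) (E.p A 1) s : ℂ) ∈ closure (E.left A).1 ∧
      (AffineMap.lineMap (E.p A 0) (E.p A 1) s : ℂ) ∈ closure (E.right A).1 := fun s hs =>
    ⟨mem_closure_of_mem_leftGerm hd (E.sides A 0 hm s hs).1,
      mem_closure_of_mem_leftGerm (neg_ne_zero.2 hd) (E.sides A 0 hm s hs).2⟩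
  have n1 : ¬ (E.right A = i ∧ E.left A = reflect h j) := by
    rintro ⟨e1, e2⟩
    rw [e1, e2] at hsides
    exact key A fun s hs => (hsides s hs).symm
  have n2 : ¬ (E.left A = i ∧ E.right A = reflect h j) := by
    rintro ⟨e1, e2⟩
    rw [e1, e2] at hsides
    exact key A hsides
  have z1 : (if E.right A = i then (1 : ℂ) else 0) * (if E.left A = reflect h j then 1 else 0) = 0 := by
    by_cases e1 : E.right A = i
    · rw [if_neg fun e2 => n1 ⟨e1, e2⟩, mul_zero]
    · rw [if_neg e1, zero_mul]
  have z2 : (if E.left A = i then (1 : ℂ) else 0) * (if E.right A = reflect h j then 1 else 0) = 0 := by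
    by_cases e1 : E.left A = i
    · rw [if_neg fun e2 => n2 ⟨e1, e2⟩, mul_zero]
    · rw [if_neg e1, zero_mul]
  rw [z1, z2, sub_zero, mul_zero]

end PlabicGraph

/-! ### Poisson brackets -/

namespace PoissonBracket

variable {A : Type*} [CommRing A] [Algebra ℂ A]

theorem br_swap (P : PoissonBracket A) (f g : A) : P.br f g = -P.br g f := by
  have := P.skew (f + g)
  simp only [map_add, LinearMap.add_apply, P.skew, zero_add, add_zero] at this
  exact eq_neg_of_add_eq_zero_right this

/-- If two Poisson brackets agree with `f` on generators, then they agree with `f`. -/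
theorem br_eq_of_generators (P Q : PoissonBracket A) {s : Set A} (f : A)
    (hs : Algebra.adjoin ℂ (s ∪ {g | ∃ x ∈ s, g * x = 1}) = ⊤)
    (h : ∀ x ∈ s, P.br f x = Q.br f x) (g : A) : P.br f g = Q.br f g := by
  have one : ∀ P : PoissonBracket A, P.br f 1 = 0 := fun P => by
    have := P.leibniz f 1 1
    simpa using this
  have hg : g ∈ Algebra.adjoin ℂ (s ∪ {g | ∃ x ∈ s, g * x = 1}) := hs ▸ Algebra.mem_top
  induction hg using Algebra.adjoin_induction with
  | mem x hx =>
    rcases hx with hx | ⟨y, hy, hxy⟩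
    · exact h x hx
    · have key : ∀ P : PoissonBracket A, P.br f x = -(x * x * P.br f y) := fun P => by
        have h1 := P.leibniz f x y
        rw [hxy, one P] at h1
        linear_combination (-x) * h1 + (-P.br f x) * hxy
      rw [key P, key Q, h y hy]
  | algebraMap r =>
    rw [Algebra.algebraMap_eq_smul_one, map_smul, map_smul, one P, one Q]
  | add x y _ _ hx hy => rw [map_add, map_add, hx, hy]
  | mul x y _ _ hx hy => rw [P.leibniz, Q.leibniz, hx, hy]

theorem eq_of_generators (P Q : PoissonBracket A) {s : Set A}
    (hs : Algebra.adjoin ℂ (s ∪ {g | ∃ x ∈ s, g * x = 1}) = ⊤)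
    (h : ∀ x ∈ s, ∀ y ∈ s, P.br x y = Q.br x y) : P = Q := by
  ext f g
  refine br_eq_of_generators P Q f hs (fun x hx => ?_) g
  rw [br_swap P, br_swap Q, br_eq_of_generators P Q x hs (h x hx)]

/-- A biadditive alternating form on the group of exponents defines a log-canonical Poisson bracket
on an algebra spanned by monomials. -/
theorem exists_of_exponents {N : Type*} [AddCommGroup N] (e : Multiplicative N →* A)
    (hspan : Submodule.span ℂ (range e) = ⊤)
    (hli : LinearIndependent ℂ (Subtype.val : range e → A)) (ω : N →+ N →+ ℂ)
    (hω : ∀ a, ω a a = 0) (hker : ∀ a, e (Multiplicative.ofAdd a) = 1 → ω a = 0) :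
    ∃ P : PoissonBracket A, ∀ a b, P.br (e (Multiplicative.ofAdd a)) (e (Multiplicative.ofAdd b)) =
      ω a b • (e (Multiplicative.ofAdd a) * e (Multiplicative.ofAdd b)) := by
  set E : N → A := fun a => e (Multiplicative.ofAdd a) with hE
  have Emul : ∀ a b, E (a + b) = E a * E b := fun a b => by
    rw [hE]
    simp
  have hswap : ∀ a b, ω a b = -ω b a := fun a b => by
    have := hω (a + b)
    simp only [map_add, AddMonoidHom.add_apply, hω, zero_add, add_zero] at this
    exact eq_neg_of_add_eq_zero_right this
  -- The form depends only on the monomials, so it does not matter which exponents `c` are chosen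
  -- for the basis elements.
  have hker' : ∀ a b, E a = E b → ω a = ω b := by
    intro a b hab
    rw [← sub_eq_zero, ← map_sub]
    refine hker _ ?_
    change E (a - b) = 1
    rw [sub_eq_add_neg, Emul, hab, ← Emul, add_neg_cancel]
    exact map_one e
  set b : Module.Basis (range e) ℂ A := Module.Basis.mk hli (by
    rw [Subtype.range_coe, hspan]) with hb
  have hbv : ∀ x, b x = x := fun x => by rw [hb, Module.Basis.mk_apply]
  have hpre : ∀ x : range e, ∃ a, E a = x := by
    rintro ⟨_, a, rfl⟩
    exact ⟨Multiplicative.toAdd a, rfl⟩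
  choose c hc using hpre
  set br : A →ₗ[ℂ] A →ₗ[ℂ] A := b.constr ℂ fun x => b.constr ℂ fun y =>
    ω (c x) (c y) • ((x : A) * y) with hbr
  have brE : ∀ a a', br (E a) (E a') = ω a a' • (E a * E a') := by
    intro a a'
    have h1 : E a = b ⟨E a, mem_range_self _⟩ := (hbv ⟨E a, mem_range_self _⟩).symm
    have h2 : E a' = b ⟨E a', mem_range_self _⟩ := (hbv ⟨E a', mem_range_self _⟩).symm
    have h3 : ω (c ⟨E a, mem_range_self _⟩) = ω a := hker' _ _ (hc _)
    have h4 : ω (c ⟨E a', mem_range_self _⟩) = ω a' := hker' _ _ (hc _)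
    conv_lhs => rw [h1, h2]
    rw [hbr, Module.Basis.constr_basis, Module.Basis.constr_basis, h3, hswap, h4, ← hswap]
  -- All identities to be proved are additive and homogeneous in each argument, so it suffices to
  -- check them on monomials.
  have hind : ∀ {p : A → Prop} (h1 : ∀ a, p (E a)) (h2 : p 0)
      (h3 : ∀ x y, p x → p y → p (x + y)) (h4 : ∀ (r : ℂ) x, p x → p (r • x)) (x), p x := by
    intro p h1 h2 h3 h4 x
    have hx : x ∈ Submodule.span ℂ (range e) := hspan ▸ Submodule.mem_top
    induction hx using Submodule.span_induction with
    | mem x hx =>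
      obtain ⟨a, rfl⟩ := hx
      exact h1 (Multiplicative.toAdd a)
    | zero => exact h2
    | add x y _ _ hx hy => exact h3 x y hx hy
    | smul r x _ hx => exact h4 r x hx
  have skew' : ∀ f g, br f g + br g f = 0 := by
    intro f g
    induction f using hind with
    | h1 a =>
      induction g using hind with
      | h1 a' => rw [brE, brE, hswap a', mul_comm (E a') (E a), neg_smul, add_neg_cancel]
      | h2 => simp
      | h3 x y hx hy =>
        simp only [map_add, LinearMap.add_apply]
        linear_combination hx + hy
      | h4 r x hx =>
        simp only [map_smul, LinearMap.smul_apply]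
        rw [← smul_add, hx, smul_zero]
    | h2 => simp
    | h3 x y hx hy =>
      simp only [map_add, LinearMap.add_apply]
      linear_combination hx + hy
    | h4 r x hx =>
      simp only [map_smul, LinearMap.smul_apply]
      rw [← smul_add, hx, smul_zero]
  have leib : ∀ f g k, br f (g * k) = br f g * k + g * br f k := by
    intro f g k
    induction f using hind with
    | h1 a =>
      induction g using hind with
      | h1 a' =>
        induction k using hind with
        | h1 a'' =>
          rw [← Emul, brE, brE, brE, Emul, map_add, add_smul]
          simp only [Algebra.smul_def]
          ring
        | h2 => simp
        | h3 x y hx hy =>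
          simp only [mul_add, map_add]
          linear_combination hx + hy
        | h4 r x hx =>
          simp only [mul_smul_comm, map_smul]
          rw [hx, smul_add]
      | h2 => simp
      | h3 x y hx hy =>
        simp only [add_mul, map_add]
        linear_combination hx + hy
      | h4 r x hx =>
        simp only [smul_mul_assoc, map_smul]
        rw [hx, smul_add]
    | h2 => simp
    | h3 x y hx hy =>
      simp only [mul_add, add_mul, map_add, LinearMap.add_apply]
      linear_combination hx + hy
    | h4 r x hx =>
      simp only [map_smul, LinearMap.smul_apply]
      rw [hx, smul_add, smul_mul_assoc, mul_smul_comm]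
  have jac : ∀ f g k, br f (br g k) + br g (br k f) + br k (br f g) = 0 := by
    intro f g k
    induction f using hind with
    | h1 a =>
      induction g using hind with
      | h1 a' =>
        induction k using hind with
        | h1 a'' =>
          simp only [brE, map_smul, ← Emul, map_add, hswap a' a, hswap a'' a,
            hswap a'' a']
          have e1 : a' + (a'' + a) = a + (a' + a'') := by abel
          have e2 : a'' + (a + a') = a + (a' + a'') := by abel
          rw [e1, e2]
          module
        | h2 => simp
        | h3 x y hx hy =>
          simp only [map_add, LinearMap.add_apply]
          linear_combination hx + hy
        | h4 r x hx =>
          simp only [map_smul, LinearMap.smul_apply]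
          rw [← smul_add, ← smul_add, hx, smul_zero]
      | h2 => simp
      | h3 x y hx hy =>
        simp only [map_add, LinearMap.add_apply]
        linear_combination hx + hy
      | h4 r x hx =>
        simp only [map_smul, LinearMap.smul_apply]
        rw [← smul_add, ← smul_add, hx, smul_zero]
    | h2 => simp
    | h3 x y hx hy =>
      simp only [map_add, LinearMap.add_apply]
      linear_combination hx + hy
    | h4 r x hx =>
      simp only [map_smul, LinearMap.smul_apply]
      rw [← smul_add, ← smul_add, hx, smul_zero]
  refine ⟨⟨br, fun f => ?_, jac, leib⟩, brE⟩
  have := skew' f f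
  rw [← two_smul ℂ] at this
  exact (smul_eq_zero.1 this).resolve_left two_ne_zero

end PoissonBracket

/-! ### Monomials on a torus -/

/-- The coordinates `pt` identify `X` with the set of all functions `I → ℂ` without zeros which
have product `1` and are invariant under the involution `r`. -/
structure IsTorus {I X : Type*} [Fintype I] (r : I → I) (pt : X → I → ℂ) : Prop where
  involutive : Function.Involutive r
  injective : Function.Injective pt
  mem_range_iff : ∀ Y, Y ∈ range pt ↔ (∀ i, Y i ≠ 0) ∧ ∏ i, Y i = 1 ∧ ∀ i, Y (r i) = Y i

namespace IsTorus

variable {I X : Type*} [Fintype I] {r : I → I} {pt : X → I → ℂ}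

/-- Monomials, as functions on a set with coordinates. -/
noncomputable def monomial (pt : X → I → ℂ) (a : I → ℤ) (x : X) : ℂ := ∏ i, pt x i ^ a i

/-- The algebra generated by the coordinates and their inverses. -/
def coordinateRing (pt : X → I → ℂ) : Subalgebra ℂ (X → ℂ) :=
  Algebra.adjoin ℂ ((range fun i x => pt x i) ∪ range fun i x => (pt x i)⁻¹)

theorem monomial_mem (pt : X → I → ℂ) (a : I → ℤ) : monomial pt a ∈ coordinateRing pt := by
  have : monomial pt a = ∏ i, fun x => pt x i ^ a i := by
    funext x
    rw [monomial, Finset.prod_apply]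
  rw [this]
  refine Subalgebra.prod_mem _ fun i _ => ?_
  have h1 : (fun x => pt x i) ∈ coordinateRing pt :=
    Algebra.subset_adjoin (Or.inl (mem_range_self i))
  have h2 : (fun x => (pt x i)⁻¹) ∈ coordinateRing pt :=
    Algebra.subset_adjoin (Or.inr ⟨i, rfl⟩)
  rcases Int.eq_nat_or_neg (a i) with ⟨k, hk | hk⟩
  · have := Subalgebra.pow_mem _ h1 k
    convert this using 1
    funext x
    simp [hk]
  · have := Subalgebra.pow_mem _ h2 k
    convert this using 1
    funext x
    simp [hk]

variable (T : IsTorus r pt)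
include T

theorem ne_zero (x : X) (i : I) : pt x i ≠ 0 := ((T.mem_range_iff _).1 (mem_range_self x)).1 i

theorem prod_eq_one (x : X) : ∏ i, pt x i = 1 := ((T.mem_range_iff _).1 (mem_range_self x)).2.1

theorem apply_r (x : X) (i : I) : pt x (r i) = pt x i :=
  ((T.mem_range_iff _).1 (mem_range_self x)).2.2 i

/-- Monomials as a homomorphism from the group of exponents. -/
noncomputable def monomialHom : Multiplicative (I → ℤ) →* coordinateRing pt where
  toFun a := ⟨monomial pt (Multiplicative.toAdd a), monomial_mem pt _⟩
  map_one' := by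
    ext x
    simp [monomial]
  map_mul' a b := by
    ext x
    simp [monomial, zpow_add₀ (T.ne_zero x _), Finset.prod_mul_distrib]

theorem span_range_monomialHom : Submodule.span ℂ (range T.monomialHom) = ⊤ := by
  classical
  have h1 : Submodule.map (coordinateRing pt).val.toLinearMap
      (Submodule.span ℂ (range T.monomialHom)) = Subalgebra.toSubmodule (coordinateRing pt) := by
    rw [Submodule.map_span, ← range_comp]
    apply le_antisymm
    · rw [Submodule.span_le]
      rintro _ ⟨a, rfl⟩
      exact (T.monomialHom a).2
    · change Subalgebra.toSubmodule (Algebra.adjoin ℂ _) ≤ _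
      rw [Algebra.adjoin_eq_span]
      refine Submodule.span_mono fun f hf => ?_
      induction hf using Submonoid.closure_induction with
      | mem f hf =>
        rcases hf with ⟨i, rfl⟩ | ⟨i, rfl⟩
        · refine ⟨Multiplicative.ofAdd (Pi.single i 1), ?_⟩
          funext x
          change ∏ j, pt x j ^ (Pi.single i 1 : I → ℤ) j = pt x i
          rw [Finset.prod_eq_single i]
          · simp
          · intro j _ hj
            simp [hj]
          · simp
        · refine ⟨Multiplicative.ofAdd (Pi.single i (-1)), ?_⟩
          funext x
          change ∏ j, pt x j ^ (Pi.single i (-1) : I → ℤ) j = (pt x i)⁻¹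
          rw [Finset.prod_eq_single i]
          · simp
          · intro j _ hj
            simp [hj]
          · simp
      | one => exact ⟨1, by simp⟩
      | mul f g _ _ hf hg =>
        obtain ⟨a, rfl⟩ := hf
        obtain ⟨b, rfl⟩ := hg
        exact ⟨a * b, by simp⟩
  rw [eq_top_iff]
  rintro f -
  have h2 : f.1 ∈ Subalgebra.toSubmodule (coordinateRing pt) := f.2
  rw [← h1] at h2
  obtain ⟨g, hg, e⟩ := h2
  rwa [← Subtype.ext e]

/-- The points form a group `G` under multiplication of coordinates, monomials are characters of
`G`, and distinct characters are linearly independent (Dedekind). -/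
theorem linearIndependent_monomialHom :
    LinearIndependent ℂ (Subtype.val : range T.monomialHom → coordinateRing pt) := by
  set G : Subgroup (I → ℂˣ) :=
    { carrier := {Y | ∏ i, Y i = 1 ∧ ∀ i, Y (r i) = Y i}
      one_mem' := ⟨by simp, fun i => rfl⟩
      mul_mem' := fun {Y Z} hY hZ => ⟨by simp [Finset.prod_mul_distrib, hY.1, hZ.1],
        fun i => by simp [hY.2 i, hZ.2 i]⟩
      inv_mem' := fun {Y} hY => ⟨by simp [hY.1], fun i => by simp [hY.2 i]⟩ } with hG
  have hπ : ∀ g : G, ∃ x, pt x = fun i => ((g.1 i : ℂˣ) : ℂ) := by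
    rintro ⟨Y, hY⟩
    refine (T.mem_range_iff _).2 ⟨fun i => (Y i).ne_zero, ?_, fun i => ?_⟩
    · have := congrArg (Units.coeHom ℂ) hY.1
      rw [map_prod, map_one] at this
      exact this
    · exact congrArg _ (hY.2 i)
  choose π hπ using hπ
  have hsurj : Function.Surjective π := by
    intro x
    refine ⟨⟨fun i => Units.mk0 (pt x i) (T.ne_zero x i), ?_, fun i => ?_⟩, T.injective ?_⟩
    · ext
      rw [← Units.coeHom_apply, map_prod]
      simpa using T.prod_eq_one x
    · ext
      exact T.apply_r x i
    · rw [hπ]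
      rfl
  set χ : Multiplicative (I → ℤ) → (G →* ℂ) := fun a =>
    { toFun := fun g => (T.monomialHom a).1 (π g)
      map_one' := by
        change ∏ i, pt (π 1) i ^ _ = 1
        simp [hπ]
      map_mul' := fun g g' => by
        change ∏ i, pt (π (g * g')) i ^ _ = (∏ i, pt (π g) i ^ _) * ∏ i, pt (π g') i ^ _
        simp [hπ, mul_zpow, Finset.prod_mul_distrib] } with hχ
  choose c hc using fun x : range T.monomialHom => x.2
  have hinj : Function.Injective fun x => χ (c x) := by
    intro x y hxy
    apply Subtype.ext
    rw [← hc x, ← hc y]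
    apply Subtype.ext
    funext z
    obtain ⟨g, rfl⟩ := hsurj z
    exact DFunLike.congr_fun hxy g
  have hli := (linearIndependent_monoidHom G ℂ).comp _ hinj
  set L : coordinateRing pt →ₗ[ℂ] (G → ℂ) :=
    { toFun := fun f g => f.1 (π g)
      map_add' := fun _ _ => rfl
      map_smul' := fun _ _ => rfl } with hL
  refine LinearIndependent.of_comp L ?_
  have hL' : L ∘ Subtype.val = (fun f : G →* ℂ => (f : G → ℂ)) ∘ fun x => χ (c x) := by
    funext x g
    change x.1.1 (π g) = (T.monomialHom (c x)).1 (π g)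
    rw [hc]
  rw [hL']
  exact hli

/-- The exponents of a trivial monomial. -/
theorem exponent_add_const {a : I → ℤ} (ha : T.monomialHom (Multiplicative.ofAdd a) = 1) (i j : I) :
    a i + a (r i) = a j + a (r j) := by
  classical
  by_cases hij : i = j
  · rw [hij]
  -- The point `Z * (Z ∘ r)` is invariant and has product `1`. There the monomial has the value `2 ^
  -- (a i + a (r i) - a j - a (r j))`.
  set Z : I → ℂ := fun k => if k = i then 2 else if k = j then 2⁻¹ else 1 with hZ
  have Z0 : ∀ k, Z k ≠ 0 := by
    intro k
    rw [hZ]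
    simp only
    split_ifs <;> norm_num
  have key : ∀ b : I → ℤ, ∏ k, Z k ^ b k = 2 ^ (b i - b j) := by
    intro b
    have h1 : ∀ k, Z k ^ b k = (if k = i then 2 ^ b i else 1) * if k = j then 2 ^ (-b j) else 1 := by
      intro k
      rw [hZ]
      simp only
      by_cases h2 : k = i
      · subst h2
        simp [hij]
      · by_cases h3 : k = j
        · subst h3
          simp [h2]
        · simp [h2, h3]
    simp only [h1]
    rw [Finset.prod_mul_distrib, Finset.prod_ite_eq', Finset.prod_ite_eq']
    simp only [Finset.mem_univ, if_true]
    rw [← zpow_add₀ two_ne_zero, sub_eq_add_neg]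
  have hrσ : ∀ f : I → ℂ, ∏ k, f (r k) = ∏ k, f k := fun f =>
    Equiv.prod_comp T.involutive.toPerm f
  obtain ⟨x, hx⟩ := (T.mem_range_iff fun k => Z k * Z (r k)).2
    ⟨fun k => mul_ne_zero (Z0 k) (Z0 _), by
      rw [Finset.prod_mul_distrib, hrσ Z]
      have := key 1
      simp only [Pi.one_apply, zpow_one, sub_self, zpow_zero] at this
      rw [this, one_mul], fun k => by
      rw [T.involutive k, mul_comm]⟩
  have h1 : ∏ k, pt x k ^ a k = 1 := by
    have := congrArg (fun f => f.1 x) ha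
    exact this
  rw [hx] at h1
  simp only [mul_zpow] at h1
  have h2 : ∏ k, Z (r k) ^ a k = ∏ k, Z k ^ a (r k) := by
    rw [← hrσ fun k => Z k ^ a (r k)]
    refine Finset.prod_congr rfl fun k _ => ?_
    rw [T.involutive k]
  rw [Finset.prod_mul_distrib, h2, key, key (fun k => a (r k)), ← zpow_add₀ two_ne_zero] at h1
  have h3 := congrArg norm h1
  rw [norm_zpow, norm_one, Complex.norm_ofNat] at h3
  have h4 := (zpow_eq_one_iff_right₀ (by norm_num : (0 : ℝ) ≤ 2) (by norm_num : (2 : ℝ) ≠ 1)).1 h3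
  linarith

/-- The bilinear form on exponents which is given by a matrix, symmetrized by the involution. -/
noncomputable def form (r : I → I) (q : I → I → ℂ) : (I → ℤ) →+ (I → ℤ) →+ ℂ :=
  AddMonoidHom.mk' (fun a => AddMonoidHom.mk' (fun b => 1 / 4 * ∑ i, ∑ j, q i j *
    ((a i + a (r i) : ℤ) : ℂ) * ((b j + b (r j) : ℤ) : ℂ)) fun b b' => by
      rw [← mul_add, ← Finset.sum_add_distrib]
      congr 1
      refine Finset.sum_congr rfl fun i _ => ?_
      rw [← Finset.sum_add_distrib]
      refine Finset.sum_congr rfl fun j _ => ?_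
      simp only [Pi.add_apply]
      push_cast
      ring) fun a a' => by
      ext b
      simp only [AddMonoidHom.mk'_apply, AddMonoidHom.add_apply]
      rw [← mul_add, ← Finset.sum_add_distrib]
      congr 1
      refine Finset.sum_congr rfl fun i _ => ?_
      rw [← Finset.sum_add_distrib]
      refine Finset.sum_congr rfl fun j _ => ?_
      simp only [Pi.add_apply]
      push_cast
      ring

/-- By `exponent_add_const` the symmetrized exponent of a trivial monomial is constant, so pairing
it with anything produces the row sums of `q`, which vanish. -/
theorem exists_poissonBracket {q : I → I → ℂ} (hq : ∀ i j, q i j = -q j i)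
    (hsum : ∀ i, ∑ j, q i j = 0) : ∃ P : PoissonBracket (coordinateRing pt), ∀ a b,
      P.br (T.monomialHom (Multiplicative.ofAdd a)) (T.monomialHom (Multiplicative.ofAdd b)) =
      form r q a b • (T.monomialHom (Multiplicative.ofAdd a) *
        T.monomialHom (Multiplicative.ofAdd b)) := by
  refine PoissonBracket.exists_of_exponents _ T.span_range_monomialHom
    T.linearIndependent_monomialHom _ ?_ ?_
  · intro a
    have h1 : form r q a a = -form r q a a := by
      rw [form]
      simp only [AddMonoidHom.mk'_apply]
      conv_lhs => rw [Finset.sum_comm]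
      rw [← mul_neg, ← Finset.sum_neg_distrib]
      congr 1
      refine Finset.sum_congr rfl fun i _ => ?_
      rw [← Finset.sum_neg_distrib]
      refine Finset.sum_congr rfl fun j _ => ?_
      rw [hq]
      ring
    exact self_eq_neg.1 h1
  · intro a ha
    ext b
    rw [form]
    simp only [AddMonoidHom.mk'_apply, AddMonoidHom.zero_apply]
    rw [Finset.sum_comm, Finset.sum_eq_zero, mul_zero]
    intro j _
    have h1 : ∑ i, q i j * ((a i + a (r i) : ℤ) : ℂ) * ((b j + b (r j) : ℤ) : ℂ) =
        -(∑ i, q j i) * ((a j + a (r j) : ℤ) : ℂ) * ((b j + b (r j) : ℤ) : ℂ) := by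
      rw [← Finset.sum_neg_distrib, Finset.sum_mul, Finset.sum_mul]
      refine Finset.sum_congr rfl fun i _ => ?_
      rw [T.exponent_add_const ha i j, hq i j]
    rw [h1, hsum, neg_zero, zero_mul, zero_mul]

end IsTorus

/-! ### Log-canonical brackets on a torus and on the fixed points of an involution. -/

namespace IsTorus

variable {I X : Type*} [Fintype I] {r : I → I} {pt : X → I → ℂ}

theorem monomial_single [DecidableEq I] (pt : X → I → ℂ) (i : I) :
    monomial pt (Pi.single i 1) = fun x => pt x i := by
  funext x
  rw [monomial, Finset.prod_eq_single i]
  · simp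
  · intro j _ hj
    simp [hj]
  · simp

theorem form_single [DecidableEq I] (hr : Function.Involutive r) (q : I → I → ℂ) (i j : I) :
    form r q (Pi.single i 1) (Pi.single j 1) =
      1 / 4 * (q i j + q (r i) j + q i (r j) + q (r i) (r j)) := by
  have h1 : ∀ k l, (Pi.single k 1 : I → ℤ) (r l) = (Pi.single (r k) 1 : I → ℤ) l := by
    intro k l
    simp only [Pi.single_apply, hr.eq_iff]
  rw [form]
  simp only [AddMonoidHom.mk'_apply, h1]
  simp only [Pi.single_apply, Int.cast_add, Int.cast_ite, Int.cast_one, Int.cast_zero, mul_add,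
    mul_ite, mul_one, mul_zero, Finset.sum_add_distrib, Finset.sum_ite_eq', Finset.mem_univ,
    if_true]
  ring

/-- The form of the fixed torus is the form of the whole torus averaged over the involution in each
argument; hence the factor `1 / 4`. -/
theorem form_eq_form_id (r : I → I) (q : I → I → ℂ) (a b : I → ℤ) :
    form r q a b = 1 / 4 * (form id q a b + form id q a (b ∘ r) + form id q (a ∘ r) b +
      form id q (a ∘ r) (b ∘ r)) := by
  have h1 : form r q a b = 1 / 4 * form id q (a + a ∘ r) (b + b ∘ r) := by
    rw [form, form]
    simp only [AddMonoidHom.mk'_apply]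
    congr 1
    rw [Finset.mul_sum]
    refine Finset.sum_congr rfl fun i _ => ?_
    rw [Finset.mul_sum]
    refine Finset.sum_congr rfl fun j _ => ?_
    simp only [Pi.add_apply, Function.comp_apply, id_eq]
    push_cast
    ring
  rw [h1]
  simp only [map_add, AddMonoidHom.add_apply]
  ring

section

variable {S : Subalgebra ℂ (X → ℂ)} (hS : S = coordinateRing pt)
include hS

theorem adjoin_coordinates_eq_top (T : IsTorus r pt) {Y : I → S}
    (hY : ∀ i, (Y i).1 = fun x => pt x i) :
    Algebra.adjoin ℂ (range Y ∪ {g | ∃ x ∈ range Y, g * x = 1}) = ⊤ := by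
  rw [eq_top_iff]
  rintro f -
  have h1 : S ≤ (Algebra.adjoin ℂ (range Y ∪ {g | ∃ x ∈ range Y, g * x = 1})).map S.val := by
    conv_lhs => rw [hS]
    refine Algebra.adjoin_le ?_
    rintro _ (⟨i, rfl⟩ | ⟨i, rfl⟩)
    · exact ⟨Y i, Algebra.subset_adjoin (Or.inl (mem_range_self i)), hY i⟩
    · have h2 : (fun x => (pt x i)⁻¹) ∈ S := by
        rw [hS]
        exact Algebra.subset_adjoin (Or.inr ⟨i, rfl⟩)
      refine ⟨⟨_, h2⟩, Algebra.subset_adjoin (Or.inr ⟨Y i, mem_range_self i, ?_⟩), rfl⟩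
      apply Subtype.ext
      funext x
      change (pt x i)⁻¹ * (Y i).1 x = 1
      rw [hY]
      exact inv_mul_cancel₀ (T.ne_zero x i)
  obtain ⟨g, hg, e⟩ := h1 f.2
  rwa [← Subtype.ext e]

theorem exists_logCanonical (T : IsTorus r pt) {q : I → I → ℂ} (hq : ∀ i j, q i j = -q j i)
    (hsum : ∀ i, ∑ j, q i j = 0) : ∃ P : PoissonBracket S, ∀ (a b : I → ℤ) (f g : S),
      f.1 = monomial pt a → g.1 = monomial pt b → P.br f g = form r q a b • (f * g) := by
  subst hS
  obtain ⟨P, hP⟩ := T.exists_poissonBracket hq hsum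
  refine ⟨P, fun a b f g hf hg => ?_⟩
  have h1 : f = T.monomialHom (Multiplicative.ofAdd a) := Subtype.ext hf
  have h2 : g = T.monomialHom (Multiplicative.ofAdd b) := Subtype.ext hg
  rw [h1, h2, hP]

/-- Regular functions which are invariant under a permutation of the coordinates are spanned by
symmetrized monomials. -/
theorem mem_span_of_invariant (T : IsTorus id pt) {ρ : X → X}
    (hρ : ∀ x i, pt (ρ x) (r i) = pt x i) (hr : Function.Involutive r) {f : S}
    (hf : ∀ x, f.1 (ρ x) = f.1 x) :
    f ∈ Submodule.span ℂ {g : S | ∃ a, g.1 = monomial pt a + monomial pt (a ∘ r)} := by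
  have hmon : ∀ a x, monomial pt a (ρ x) = monomial pt (a ∘ r) x := by
    intro a x
    rw [monomial, monomial, ← Equiv.prod_comp hr.toPerm]
    refine Finset.prod_congr rfl fun i _ => ?_
    change pt (ρ x) (r i) ^ _ = _
    rw [hρ]
    rfl
  -- Averaging over the involution fixes `f` and takes each monomial to half a symmetrized monomial.
  set avg : S →ₗ[ℂ] (X → ℂ) :=
    { toFun := fun f x => 1 / 2 * (f.1 x + f.1 (ρ x))
      map_add' := fun f g => by
        funext x
        change 1 / 2 * ((f.1 x + g.1 x) + (f.1 (ρ x) + g.1 (ρ x))) =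
          1 / 2 * (f.1 x + f.1 (ρ x)) + 1 / 2 * (g.1 x + g.1 (ρ x))
        ring
      map_smul' := fun c f => by
        funext x
        change 1 / 2 * (c * f.1 x + c * f.1 (ρ x)) = c * (1 / 2 * (f.1 x + f.1 (ρ x)))
        ring } with havg
  have h1 : f ∈ Submodule.span ℂ {g : S | ∃ a, g.1 = monomial pt a} := by
    have h2 : (⊤ : Submodule ℂ S) ≤ Submodule.span ℂ {g : S | ∃ a, g.1 = monomial pt a} := by
      subst hS
      rw [← T.span_range_monomialHom]
      refine Submodule.span_mono ?_
      rintro _ ⟨a, rfl⟩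
      exact ⟨_, rfl⟩
    exact h2 Submodule.mem_top
  have h3 : avg f = f.1 := by
    funext x
    change 1 / 2 * (f.1 x + f.1 (ρ x)) = f.1 x
    rw [hf]
    ring
  have h4 : Submodule.span ℂ {g : S | ∃ a, g.1 = monomial pt a} ≤ Submodule.comap avg
      ((Submodule.span ℂ {g : S | ∃ a, g.1 = monomial pt a + monomial pt (a ∘ r)}).map
        S.val.toLinearMap) := by
    rw [Submodule.span_le]
    rintro g ⟨a, ha⟩
    have hm : ∀ a, monomial pt a ∈ S := fun a => hS ▸ monomial_mem pt a
    refine ⟨(1 / 2 : ℂ) • ⟨_, S.add_mem (hm a) (hm (a ∘ r))⟩,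
      Submodule.smul_mem _ _ (Submodule.subset_span ⟨a, rfl⟩), ?_⟩
    funext x
    change 1 / 2 * (monomial pt a x + monomial pt (a ∘ r) x) = 1 / 2 * (g.1 x + g.1 (ρ x))
    rw [ha, hmon]
  obtain ⟨g, hg, e⟩ := h4 h1
  rw [h3] at e
  rwa [← Subtype.ext e]

/-- The log-canonical bracket on the fixed point set of a permutation of the coordinates is the
restriction of the log-canonical bracket on the whole torus. -/
theorem br_restrict_of_invariant (T : IsTorus id pt) {ρ : X → X}
    (hρ : ∀ x i, pt (ρ x) (r i) = pt x i) (hr : Function.Involutive r) {X' : Type*}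
    {pt' : X' → I → ℂ} {S' : Subalgebra ℂ (X' → ℂ)} {ι : X' → X} (hι : ∀ x, pt (ι x) = pt' x)
    (hr' : ∀ x i, pt' x (r i) = pt' x i) (ψ : S →ₗ[ℂ] S') (hψ : ∀ f x, (ψ f).1 x = f.1 (ι x))
    {q : I → I → ℂ} {P : PoissonBracket S} {P' : PoissonBracket S'}
    (hP : ∀ (a b : I → ℤ) (f g : S),
      f.1 = monomial pt a → g.1 = monomial pt b → P.br f g = form id q a b • (f * g))
    (hP' : ∀ (a b : I → ℤ) (f g : S'),
      f.1 = monomial pt' a → g.1 = monomial pt' b → P'.br f g = form r q a b • (f * g))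
    {f g : S} (hf : ∀ x, f.1 (ρ x) = f.1 x) (hg : ∀ x, g.1 (ρ x) = g.1 x) :
    P'.br (ψ f) (ψ g) = ψ (P.br f g) := by
  have hm : ∀ a, monomial pt a ∈ S := fun a => hS ▸ monomial_mem pt a
  have hψm : ∀ a, (ψ ⟨_, hm a⟩).1 = monomial pt' a := by
    intro a
    funext x
    rw [hψ]
    change ∏ i, pt (ι x) i ^ a i = ∏ i, pt' x i ^ a i
    rw [hι]
  have hψr : ∀ a, ψ ⟨_, hm (a ∘ r)⟩ = ψ ⟨_, hm a⟩ := by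
    intro a
    apply Subtype.ext
    rw [hψm, hψm]
    funext x
    rw [monomial, monomial, ← Equiv.prod_comp hr.toPerm]
    refine Finset.prod_congr rfl fun i _ => ?_
    change pt' x (r i) ^ a (r (r i)) = _
    rw [hr', hr]
  have hψmul : ∀ f g, ψ (f * g) = ψ f * ψ g := by
    intro f g
    apply Subtype.ext
    funext x
    change (ψ (f * g)).1 x = (ψ f).1 x * (ψ g).1 x
    rw [hψ, hψ, hψ]
    rfl
  have hf' := mem_span_of_invariant hS T hρ hr hf
  have hg' := mem_span_of_invariant hS T hρ hr hg
  clear hf hg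
  induction hf' using Submodule.span_induction with
  | zero => simp
  | add f₁ f₂ _ _ h1 h2 => simp only [map_add, LinearMap.add_apply, h1, h2]
  | smul c f₁ _ h1 => simp only [map_smul, LinearMap.smul_apply, h1]
  | mem f₁ h1 =>
    obtain ⟨a, ha⟩ := h1
    induction hg' using Submodule.span_induction with
    | zero => simp
    | add f₁ f₂ _ _ h1 h2 => simp only [map_add, h1, h2]
    | smul c f₁ _ h1 => simp only [map_smul, h1]
    | mem g₁ h2 =>
      obtain ⟨b, hb⟩ := h2
      -- The monomials of `a` and `a ∘ r` have the same restriction. So the bracket of two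
      -- symmetrized monomials restricts to one monomial times the sum of four coefficients, while
      -- the bracket of the restrictions has coefficient `4 * form r q a b`; these agree by
      -- `form_eq_form_id`.
      have ha' : f₁ = ⟨_, hm a⟩ + ⟨_, hm (a ∘ r)⟩ := Subtype.ext ha
      have hb' : g₁ = ⟨_, hm b⟩ + ⟨_, hm (b ∘ r)⟩ := Subtype.ext hb
      rw [ha', hb']
      simp only [map_add, LinearMap.add_apply]
      rw [hP a b ⟨_, hm a⟩ ⟨_, hm b⟩ rfl rfl, hP a (b ∘ r) ⟨_, hm a⟩ ⟨_, hm (b ∘ r)⟩ rfl rfl,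
        hP (a ∘ r) b ⟨_, hm (a ∘ r)⟩ ⟨_, hm b⟩ rfl rfl,
        hP (a ∘ r) (b ∘ r) ⟨_, hm (a ∘ r)⟩ ⟨_, hm (b ∘ r)⟩ rfl rfl]
      simp only [map_smul, hψmul, hψr]
      rw [hP' a b _ _ (hψm a) (hψm b), form_eq_form_id]
      module

end

end IsTorus

/-! ### The two weight spaces as tori. -/

namespace PlabicGraph

variable {n : ℕ} {Γ : PlabicGraph n}

/-- Without midline squares the regularity condition is empty and the whole torus remains. -/
theorem isTorus_regularWeighting [Fintype Γ.Face] (hs : ∀ i, ¬ Γ.IsMidlineSquare i) :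
    IsTorus id fun Y : Γ.RegularWeighting => Y.1.1 where
  involutive _ := rfl
  injective _ _ h := Subtype.ext (Subtype.ext h)
  mem_range_iff Y := by
    constructor
    · rintro ⟨Z, rfl⟩
      exact ⟨Z.1.2.1, by rw [← finprod_eq_prod_of_fintype]; exact Z.1.2.2, fun _ => rfl⟩
    · rintro ⟨h1, h2, -⟩
      exact ⟨⟨⟨Y, h1, by rw [finprod_eq_prod_of_fintype, h2]⟩, fun s hs' => absurd hs' (hs s)⟩, rfl⟩

theorem isTorus_MSWeighting [Fintype Γ.Face] (h : Γ.IsMoveSymmetric) (hn : Even n) :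
    IsTorus (reflect h) fun Y : MSWeighting h => Y.1.1.1 where
  involutive := reflect_reflect h
  injective _ _ e := Subtype.ext (Subtype.ext (Subtype.ext e))
  mem_range_iff Y := by
    have T := isTorus_regularWeighting (not_isMidlineSquare hn h)
    constructor
    · rintro ⟨Z, rfl⟩
      refine ⟨T.ne_zero Z.1, T.prod_eq_one Z.1, fun i => ?_⟩
      have := congrFun Z.2 i
      rwa [sigma_eq hn h] at this
    · rintro ⟨h1, h2, h3⟩
      obtain ⟨Z, rfl⟩ := (T.mem_range_iff Y).2 ⟨h1, h2, fun _ => rfl⟩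
      refine ⟨⟨Z, ?_⟩, rfl⟩
      funext i
      rw [sigma_eq hn h]
      exact h3 i

theorem regularFunctions_eq [Fintype Γ.Face] (hs : ∀ i, ¬ Γ.IsMidlineSquare i) :
    Γ.regularFunctions = IsTorus.coordinateRing fun Y : Γ.RegularWeighting => Y.1.1 := by
  have h1 : {f | ∃ s, Γ.IsMidlineSquare s ∧ f = (1 + Γ.coord s)⁻¹} = ∅ := by
    ext f
    simp [hs]
  rw [regularFunctions, h1, union_empty]
  rfl

theorem msFunctions_eq [Fintype Γ.Face] (h : Γ.IsMoveSymmetric) (hn : Even n) :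
    msFunctions h = IsTorus.coordinateRing fun Y : MSWeighting h => Y.1.1.1 := by
  rw [msFunctions, regularFunctions_eq (not_isMidlineSquare hn h), IsTorus.coordinateRing,
    IsTorus.coordinateRing, AlgHom.map_adjoin, image_union, ← range_comp, ← range_comp]
  rfl

/-- Restriction to the space of move-symmetric weightings as a linear map. -/
def resLinear (h : Γ.IsMoveSymmetric) : Γ.regularFunctions →ₗ[ℂ] msFunctions h where
  toFun := res h
  map_add' _ _ := rfl
  map_smul' _ _ := rfl

/-- The involution `σ` on the face weight space, if no vertices are on the midline. -/
theorem exists_involution [Fintype Γ.Face] (h : Γ.IsMoveSymmetric) (hn : Even n) :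
    ∃ ρ : Γ.RegularWeighting → Γ.RegularWeighting, ∀ Y i, (ρ Y).1.1 i = Y.1.1 (reflect h i) := by
  have T := isTorus_regularWeighting (not_isMidlineSquare hn h)
  have h1 : ∀ Y : Γ.RegularWeighting, ∃ Z : Γ.RegularWeighting,
      Z.1.1 = fun i => Y.1.1 (reflect h i) := by
    intro Y
    refine (T.mem_range_iff _).2 ⟨fun i => T.ne_zero Y _, ?_, fun _ => rfl⟩
    refine Eq.trans ?_ (T.prod_eq_one Y)
    exact Equiv.prod_comp (Function.Involutive.toPerm _ (reflect_reflect h)) Y.1.1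
  choose ρ hρ using h1
  exact ⟨ρ, fun Y i => congrFun (hρ Y) i⟩

theorem isInvariant_iff (h : Γ.IsMoveSymmetric) (hn : Even n)
    {ρ : Γ.RegularWeighting → Γ.RegularWeighting}
    (hρ : ∀ Y i, (ρ Y).1.1 i = Y.1.1 (reflect h i)) {f : Γ.regularFunctions} :
    IsInvariant h f ↔ ∀ Y, f.1 (ρ Y) = f.1 Y := by
  constructor
  · intro hf Y
    refine hf Y (ρ Y) ?_
    funext i
    rw [sigma_eq hn h, hρ]
  · intro hf Y Y' e
    rw [← hf Y]
    refine congrArg f.1 (Subtype.ext (Subtype.ext ?_))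
    funext i
    rw [e, sigma_eq hn h, hρ]

theorem foldedMatrix_of_onMidline (h : Γ.IsMoveSymmetric) {i : Γ.Face} (hi : Γ.OnMidline i)
    (j : Γ.Face) : foldedMatrix h i j = 2 * Γ.q i j := by
  rw [foldedMatrix, if_pos hi, reflect_of_onMidline h hi]
  simp

theorem foldedMatrix_of_above (h : Γ.IsMoveSymmetric) {i : Γ.Face} (hi : Γ.Above i)
    (j : Γ.Face) : foldedMatrix h i j = Γ.q i j + Γ.q (reflect h i) j := by
  have h1 : ¬ Γ.OnMidline i := fun h2 => reflect_ne_of_above h hi (reflect_of_onMidline h h2)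
  classical
  rw [foldedMatrix, if_neg h1, one_mul, Finset.sum_pair (reflect_ne_of_above h hi).symm]

end PlabicGraph

/-! ### The proposition. -/

theorem mainTheorem8 (n : ℕ) (hn : Even n) (Γ : PlabicGraph n) (h : Γ.IsMoveSymmetric) :
    ∃ P : PoissonBracket Γ.regularFunctions,
      (PlabicGraph.IsQuiverBracket P ∧
        ∀ Q : PoissonBracket Γ.regularFunctions, PlabicGraph.IsQuiverBracket Q → Q = P) ∧
      ∃ P' : PoissonBracket (PlabicGraph.msFunctions h),
        (PlabicGraph.IsInducedBracket h P P' ∧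
          ∀ Q' : PoissonBracket (PlabicGraph.msFunctions h),
            PlabicGraph.IsInducedBracket h P Q' → Q' = P') ∧
        (∀ i j : Γ.Face, Γ.OnMidline i ∨ Γ.OnMidline j →
          P'.br (PlabicGraph.yms h i) (PlabicGraph.yms h j) =
            Γ.q i j • (PlabicGraph.yms h i * PlabicGraph.yms h j)) ∧
        (∀ i j : Γ.Face, Γ.Above i → Γ.Above j →
          P'.br (PlabicGraph.yms h i) (PlabicGraph.yms h j) =
            (1 / 2 * Γ.q i j) • (PlabicGraph.yms h i * PlabicGraph.yms h j)) ∧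
        (∀ i j : Γ.Face, Γ.OnMidline i ∨ Γ.Above i → Γ.OnMidline j ∨ Γ.Above j →
          (2 : ℂ) • P'.br (PlabicGraph.yms h i) (PlabicGraph.yms h j) =
            PlabicGraph.foldedMatrix h i j •
              (PlabicGraph.yms h i * PlabicGraph.yms h j)) := by
  classical
  have : Fintype Γ.Face := Fintype.ofFinite _
  have hsq := PlabicGraph.not_isMidlineSquare hn h
  have T := PlabicGraph.isTorus_regularWeighting hsq
  have T' := PlabicGraph.isTorus_MSWeighting h hn
  have hS := PlabicGraph.regularFunctions_eq hsq
  have hS' := PlabicGraph.msFunctions_eq h hn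
  obtain ⟨ρ, hρ⟩ := PlabicGraph.exists_involution h hn
  obtain ⟨P, hP⟩ := T.exists_logCanonical hS PlabicGraph.q_skew PlabicGraph.sum_q
  obtain ⟨P', hP'⟩ := T'.exists_logCanonical hS' PlabicGraph.q_skew PlabicGraph.sum_q
  have hy : ∀ i, (Γ.y i).1 = fun Y => Y.1.1 i := fun _ => rfl
  have hyms : ∀ i, (PlabicGraph.yms h i).1 = fun Y => Y.1.1.1 i := fun _ => rfl
  have hquiver : PlabicGraph.IsQuiverBracket P := by
    intro i j
    rw [hP (Pi.single i 1) (Pi.single j 1), IsTorus.form_single fun _ => rfl]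
    · congr 1
      simp only [id_eq]
      ring
    · rw [IsTorus.monomial_single, hy]
    · rw [IsTorus.monomial_single, hy]
  have hinduced : PlabicGraph.IsInducedBracket h P P' := by
    intro f g hf hg
    exact IsTorus.br_restrict_of_invariant hS T (ρ := ρ)
      (fun Y i => by rw [hρ, PlabicGraph.reflect_reflect]) (PlabicGraph.reflect_reflect h)
      (ι := Subtype.val) (fun _ => rfl) T'.apply_r (PlabicGraph.resLinear h) (fun _ _ => rfl)
      hP hP' ((PlabicGraph.isInvariant_iff h hn hρ).1 hf)
      ((PlabicGraph.isInvariant_iff h hn hρ).1 hg)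
  -- By invariance of `q` under the reflection, the four terms of the averaged form are equal in
  -- pairs.
  have hbr : ∀ i j, P'.br (PlabicGraph.yms h i) (PlabicGraph.yms h j) =
      (1 / 2 * (Γ.q i j + Γ.q i (PlabicGraph.reflect h j))) •
        (PlabicGraph.yms h i * PlabicGraph.yms h j) := by
    intro i j
    have h1 : Γ.q (PlabicGraph.reflect h i) j = Γ.q i (PlabicGraph.reflect h j) := by
      rw [← PlabicGraph.q_reflect hn h i, PlabicGraph.reflect_reflect]
    rw [hP' (Pi.single i 1) (Pi.single j 1), IsTorus.form_single (PlabicGraph.reflect_reflect h),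
      PlabicGraph.q_reflect hn h, h1]
    · congr 1
      ring
    · rw [IsTorus.monomial_single, hyms]
    · rw [IsTorus.monomial_single, hyms]
  have hmid : ∀ i j, Γ.OnMidline i ∨ Γ.OnMidline j →
      Γ.q i (PlabicGraph.reflect h j) = Γ.q i j := by
    rintro i j (hi | hj)
    · rw [← PlabicGraph.q_reflect hn h, PlabicGraph.reflect_reflect,
        PlabicGraph.reflect_of_onMidline h hi]
    · rw [PlabicGraph.reflect_of_onMidline h hj]
  have hfold : ∀ i j, Γ.OnMidline i ∨ Γ.Above i →
      PlabicGraph.foldedMatrix h i j = Γ.q i j + Γ.q i (PlabicGraph.reflect h j) := by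
    rintro i j (hi | hi)
    · rw [PlabicGraph.foldedMatrix_of_onMidline h hi, hmid i j (Or.inl hi), two_mul]
    · rw [PlabicGraph.foldedMatrix_of_above h hi, ← PlabicGraph.q_reflect hn h i,
        ← PlabicGraph.q_reflect hn h i (PlabicGraph.reflect h j), PlabicGraph.reflect_reflect]
  refine ⟨P, ⟨hquiver, fun Q hQ => ?_⟩, P', ⟨hinduced, fun Q' hQ' => ?_⟩, ?_, ?_, ?_⟩
  · refine PoissonBracket.eq_of_generators Q P (T.adjoin_coordinates_eq_top hS hy) ?_
    rintro _ ⟨i, rfl⟩ _ ⟨j, rfl⟩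
    rw [hQ, hquiver]
  · refine PoissonBracket.eq_of_generators Q' P' (T'.adjoin_coordinates_eq_top hS' hyms) ?_
    -- A single weight `y i` need not be invariant. Its average `z i` is, and has the same
    -- restriction to the fixed points, so an induced bracket is determined on the generators.
    set z : Γ.Face → Γ.regularFunctions :=
      fun i => (1 / 2 : ℂ) • (Γ.y i + Γ.y (PlabicGraph.reflect h i)) with hz
    have z_inv : ∀ i, PlabicGraph.IsInvariant h (z i) := by
      intro i
      rw [PlabicGraph.isInvariant_iff h hn hρ]
      intro Y
      change 1 / 2 * ((ρ Y).1.1 i + (ρ Y).1.1 (PlabicGraph.reflect h i)) =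
        1 / 2 * (Y.1.1 i + Y.1.1 (PlabicGraph.reflect h i))
      rw [hρ, hρ, PlabicGraph.reflect_reflect, add_comm]
    have res_z : ∀ i, PlabicGraph.res h (z i) = PlabicGraph.yms h i := by
      intro i
      apply Subtype.ext
      funext Y
      change 1 / 2 * (Y.1.1.1 i + Y.1.1.1 (PlabicGraph.reflect h i)) = Y.1.1.1 i
      rw [T'.apply_r Y i]
      ring
    rintro _ ⟨i, rfl⟩ _ ⟨j, rfl⟩
    rw [← res_z, ← res_z, hQ' _ _ (z_inv i) (z_inv j), hinduced _ _ (z_inv i) (z_inv j)]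
  · intro i j hij
    rw [hbr, hmid i j hij]
    congr 1
    ring
  · intro i j hi hj
    rw [hbr, PlabicGraph.q_above_reflect hn h hi hj, add_zero]
  · intro i j hi _
    rw [hbr, hfold i j hi, smul_smul]
    congr 1
    ring
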